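/- **Setting.** Let $p\in\mathbb{N}$, let $h^*$ be a real polynomial in $p$ variables, and let $K_\sigma,K_\xi,K_\rho>0$. For $d\in\mathbb{N}$, a $p$-dimensional subspace $V\subset\mathbb{R}^d$ and an orthonormal basis of $V$, regard $h^*$ as a polynomial map $V\to\mathbb{R}$ in the coordinates of this basis, and put $f^*(x)=h^*(x_V)$, where $x_V$ is the orthogonal projection of $x\in\mathbb{R}^d$ onto $V$. Write $\mathbb{E}_x$ for the expectation over $x\sim\mathcal{N}(0,I_d)$, and $\theta=(a,w)\in\mathbb{R}\times\mathbb{R}^d=\mathbb{R}^{d+1}$. For $\sigma:\mathbb{R}\to\mathbb{R}$ and a probability measure $\rho$ on $\mathbb{R}^{d+1}$ let $$f_{\mathrm{NN}}(x;\rho)=\int a\,\sigma(w^\top x)\,\rho(da,dw),\qquad \Phi(\theta;\rho)=a\,\mathbb{E}_x\big[(f_{\mathrm{NN}}(x;\rho)-f^*(x))\,\sigma(w^\top x)\big].$$ Let $\xi(t)=\mathrm{diag}(\xi_a(t),\xi_w(t)I_d)$ with $\xi_a,\xi_w:[0,\infty)\to[0,\infty)$. A *mean-field flow* is a family $(\rho_t)_{t\ge0}$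 of probability measures on $\mathbb{R}^{d+1}$, continuous in $t\in[0,\infty)$ for weak convergence, such that $\int|a|\,\rho_t(da,dw)$ is finite for every $t\ge0$ and is an integrable function of $t$ on every interval $[0,T]$, and which solves $\partial_t\rho_t=\nabla_\theta\cdot(\rho_t\,\xi(t)\nabla_\theta\Phi(\theta;\rho_t))$ in the weak sense: $$\int_0^\infty\!\!\int\big(-\partial_t\eta+\nabla_\theta\eta\cdot(\xi(t)\nabla_\theta\Phi(\theta;\rho_t))\big)\,\rho_t(d\theta)\,dt=0\qquad\text{for all }\eta\in C_c^\infty(\mathbb{R}^{d+1}\times(0,\infty)).$$ **Assumption 1** (for the initial law $\rho_0$). (i) $\sigma\in C^2(\mathbb{R})$ and $|\sigma|,|\sigma'|,|\sigma''|\le K_\sigma$. (ii) $\xi_a,\xi_w$ are bounded by $K_\xi$ and Lipschitz continuous, with $\int_0^\infty\xi_a(t)\,dt=\int_0^\infty\xi_w(t)\,dt=\infty$. (iii) $\rho_0=\rho_a\times\rho_w$ for probability measures $\rho_a$ on $\mathbb{R}$ and $\rho_w$ on $\mathbb{R}^d$, where $\rho_a$ is symmetric and supported in $[-K_\rho,K_\rho]$.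 **Theorem 3.5.** For every $T\in(0,\infty)$ there is a constant $C_s>0$ depending only on $p$, $h^*$, $K_\sigma$, $K_\xi$, $K_\rho$ and $T$ (in particular not on $d$, on $V$ and its basis, on $\sigma,\xi_a,\xi_w$ beyond the constants $K_\sigma,K_\xi$, or on the initial laws) such that the following holds. If $(\rho_t)$ and $(\tilde\rho_t)$ are mean-field flows with the same $f^*$, $\sigma$, $\xi_a$, $\xi_w$, and Assumption 1 holds for both $\rho_0$ and $\tilde\rho_0$, then $$\sup_{0\le t\le T}\mathbb{E}_x\big[|f_{\mathrm{NN}}(x;\rho_t)-f_{\mathrm{NN}}(x;\tilde\rho_t)|^2\big]\le C_s\,W_2^2(\rho_0,\tilde\rho_0).$$ Here $W_2$ is the $2$-Wasserstein distance for the Euclidean distance on $\mathbb{R}^{d+1}$, that is, $W_2^2(\rho_0,\tilde\rho_0)=\inf_\gamma\int(|a-\tilde a|^2+\|w-\tilde w\|^2)\,d\gamma\in[0,\infty]$ over the couplings $\gamma$ of $\rho_0$ and $\tilde\rho_0$. -/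

import Mathlib

open MeasureTheory ProbabilityTheory Set

open scoped ENNReal ContDiff

noncomputable section

/-- The parameter space `ℝ^{d+1}` of a neuron `θ = (a, w)` with `a ∈ ℝ`, `w ∈ ℝ^d`. The product is
used for its topology and Borel sets only: the Euclidean structure of `ℝ^{d+1}` is written out
through the components `a` and `w` wherever it matters. -/
abbrev Param (d : ℕ) : Type := ℝ × EuclideanSpace ℝ (Fin d)

/-- The expectation `E_x[g(x)]` for `x ∼ N(0, I_d)`. -/
def gaussExp {d : ℕ} (g : EuclideanSpace ℝ (Fin d) → ℝ) : ℝ :=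
  ∫ x, g x ∂(stdGaussian (EuclideanSpace ℝ (Fin d)))

/-- The infinite-width two-layer network `f_NN(x; ρ) = ∫ a σ(wᵀx) ρ(da, dw)`. -/
def fNN {d : ℕ} (σ : ℝ → ℝ) (ρ : Measure (Param d)) (x : EuclideanSpace ℝ (Fin d)) : ℝ :=
  ∫ θ, θ.1 * σ (inner ℝ θ.2 x) ∂ρ

/-- The subspace-sparse polynomial `f*(x) = h*(x_V)`: `x_V` is the orthogonal projection of `x` to
the subspace `V`, and the polynomial map `h* : V → ℝ` is given as a polynomial `h` in the
coordinates with respect to an orthonormal basis `b` of `V`. -/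
def target {d p : ℕ} (h : MvPolynomial (Fin p) ℝ) (V : Submodule ℝ (EuclideanSpace ℝ (Fin d)))
    (b : OrthonormalBasis (Fin p) ℝ V) (x : EuclideanSpace ℝ (Fin d)) : ℝ :=
  MvPolynomial.eval (fun i => b.repr (V.orthogonalProjectionOnto x) i) h

/-- `Φ(θ; ρ) = a E_x[(f_NN(x; ρ) - f*(x)) σ(wᵀx)]` for `θ = (a, w)`. -/
def potential {d : ℕ} (σ : ℝ → ℝ) (fstar : EuclideanSpace ℝ (Fin d) → ℝ)
    (ρ : Measure (Param d)) (θ : Param d) : ℝ :=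
  θ.1 * gaussExp (fun x => (fNN σ ρ x - fstar x) * σ (inner ℝ θ.2 x))

/-- The integrand `-∂_t η + ∇_θ η · (ξ(t) ∇_θ Φ(θ; ρ))` of the weak formulation at `(θ, t)`, with
`ξ(t) = diag(ξ_a(t), ξ_w(t) I_d)`. -/
def weakIntegrand {d : ℕ} (σ : ℝ → ℝ) (fstar : EuclideanSpace ℝ (Fin d) → ℝ) (ξa ξw : ℝ → ℝ)
    (ρ : Measure (Param d)) (η : Param d × ℝ → ℝ) (θ : Param d) (t : ℝ) : ℝ :=
  -deriv (fun s => η (θ, s)) t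
    + (deriv (fun a => η ((a, θ.2), t)) θ.1
        * (ξa t * deriv (fun a => potential σ fstar ρ (a, θ.2)) θ.1)
      + inner ℝ (gradient (fun w => η ((θ.1, w), t)) θ.2)
          (ξw t • gradient (fun w => potential σ fstar ρ (θ.1, w)) θ.2))

/-- `(ρ_t)_{t ≥ 0}` is a weak solution of the mean-field equation
`∂_t ρ_t = ∇_θ · (ρ_t ξ(t) ∇_θ Φ(θ; ρ_t))`. The values of `ρ`, `ξa`, `ξw` at negative times play
no role. -/
structure IsMeanFieldFlow {d : ℕ} (σ : ℝ → ℝ) (fstar : EuclideanSpace ℝ (Fin d) → ℝ)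
    (ξa ξw : ℝ → ℝ) (ρ : ℝ → ProbabilityMeasure (Param d)) : Prop where
  /-- Continuity in time for weak convergence of probability measures; this gives the initial
  condition `ρ_t |_{t = 0} = ρ 0` its meaning. -/
  continuousOn : ContinuousOn ρ (Ici 0)
  /-- The integral that defines `f_NN(x; ρ_t)` converges at every time. -/
  moment_lt_top : ∀ t : ℝ, 0 ≤ t → ∫⁻ θ, ‖θ.1‖ₑ ∂(ρ t : Measure (Param d)) < ⊤
  /-- `t ↦ ∫ |a| ρ_t(da, dw)` is locally integrable on `[0, ∞)`: the time integral in the weak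
  formulation converges, since `|∇_θ Φ(θ; ρ_t)|` is at most `C (1 + |a|) (1 + ∫ |a'| ρ_t(dθ'))`. -/
  moment_integrable : ∀ T : ℝ, 0 < T →
    ∫⁻ t in Icc 0 T, ∫⁻ θ, ‖θ.1‖ₑ ∂(ρ t : Measure (Param d)) < ⊤
  /-- The weak formulation, with test functions in `C_c^∞(ℝ^{d+1} × (0, ∞))`. -/
  weak : ∀ η : Param d × ℝ → ℝ, ContDiff ℝ ∞ η → HasCompactSupport η →
    tsupport η ⊆ univ ×ˢ Ioi 0 →
    ∫ t in Ioi (0 : ℝ), ∫ θ, weakIntegrand σ fstar ξa ξw (ρ t) η θ t ∂(ρ t : Measure (Param d)) = 0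

/-- The activation function is `C²`, and `σ`, `σ'`, `σ''` are bounded by `K`. -/
structure IsActivation (σ : ℝ → ℝ) (K : ℝ) : Prop where
  contDiff : ContDiff ℝ 2 σ
  bound : ∀ s, |σ s| ≤ K
  bound_deriv : ∀ s, |deriv σ s| ≤ K
  bound_deriv_two : ∀ s, |deriv (deriv σ) s| ≤ K

/-- A learning rate `ξ : [0, ∞) → [0, ∞)`: bounded by `K`, Lipschitz continuous, and with
`∫_0^∞ ξ(t) dt = ∞`. -/
structure IsLearningRate (ξ : ℝ → ℝ) (K : ℝ) : Prop where
  nonneg : ∀ t, 0 ≤ t → 0 ≤ ξ t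
  bound : ∀ t, 0 ≤ t → |ξ t| ≤ K
  lipschitz : ∃ L, LipschitzOnWith L ξ (Ici 0)
  integral_eq_top : ∫⁻ t in Ici 0, ENNReal.ofReal (ξ t) = ⊤

/-- The initialization is `ρ₀ = ρ_a × ρ_w`, where `ρ_a` is symmetric and is supported in
`[-K, K]`. -/
def IsInitialization {d : ℕ} (ρ₀ : ProbabilityMeasure (Param d)) (K : ℝ) : Prop :=
  ∃ (ρa : Measure ℝ) (ρw : Measure (EuclideanSpace ℝ (Fin d))),
    IsProbabilityMeasure ρa ∧ IsProbabilityMeasure ρw ∧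
      (ρ₀ : Measure (Param d)) = ρa.prod ρw ∧
      ρa.map (fun a => -a) = ρa ∧ ρa (Icc (-K) K)ᶜ = 0

/-- The couplings of `μ` and `ν`: the measures on the product space with marginals `μ` and `ν`. -/
def couplings {d : ℕ} (μ ν : Measure (Param d)) : Set (Measure (Param d × Param d)) :=
  {γ | γ.map Prod.fst = μ ∧ γ.map Prod.snd = ν}

/-- The 2-Wasserstein distance for the Euclidean distance on `ℝ^{d+1}`, with values in `[0, ∞]`. -/
def W2 {d : ℕ} (μ ν : Measure (Param d)) : ℝ≥0∞ :=
  (⨅ γ ∈ couplings μ ν,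
    ∫⁻ z, ENNReal.ofReal (|z.1.1 - z.2.1| ^ 2 + ‖z.1.2 - z.2.2‖ ^ 2) ∂γ) ^ (1 / 2 : ℝ)

end

noncomputable section

namespace MeanFieldStability

/-! ### Cauchy–Schwarz and Gaussian moments -/

/-! Both flows solve a continuity equation `∂_t ρ = -∇·(ρ V)` with `V = -ξ ∇Φ`, and `V` depends on
the measure only through the residual `f_NN(·; ρ_t) - f*`, linearly. The quantity to control is the
distance `u(t)` of the two outputs in `L²(N(0, I_d))`. As `f_NN` is linear in the measure, `u(t)² =
∫ φ dρ_t - ∫ φ dρ'_t` for `φ(a, w) = a E_x[g(x) σ(wᵀx)]`, with `g` the difference of the outputs at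
time `t` (`gaussNorm_sq_fNN_sub`). For bounded `a`, this `φ` is Lipschitz with a constant
proportional to `u(t)`, and the two velocity fields at time `s` differ by at most a constant times
`u(s)`. Moving a coupling `γ` of the initial laws along both fields therefore bounds `u(t)` by `D =
∫ ‖θ - θ'‖ dγ` plus a time integral of `u`. A Grönwall argument gives `u(t) ≤ C D`, and `D²` is at
most the quadratic cost of `γ`. Three points need care.

Dimension. All first-order estimates of `E_x[g(x) s(wᵀx) x]` are made after pairing with a vector,
so that `x` enters only through one-dimensional marginals and their second and fourth moments
(`norm_beta_le`, `norm_beta_sub_le`). The target enters only through `‖f*‖ = ‖h*‖` in `L²(N(0,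
I_p))` (`gaussNorm_target`).

Growth in `a`. The speed of `a` is bounded by an affine function of the first moment of `|a|`, so
this moment obeys a Grönwall inequality (`absMoment_le`). Exponential moments of arbitrarily high
rate then show that `|a|` stays below a fixed radius `ρ_t`-almost everywhere (`ae_abs_le_radius`).
The factor `a` of the field and of `φ` may thus be replaced by a smooth bounded truncation.

Weak solutions. No representation by characteristics is assumed. The equation is extended to bounded
`C¹` test functions (`IsTransport.evolves`), and `ρ_t` is compared with the image of `ρ_0` under an
Euler scheme by pulling the test function back step by step (`abs_integral_sub_eulerScheme_le`).
This needs `C^{1,1}` fields, whereas `σ''` is merely continuous, so `σ` is replaced by its Steklov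
average over length `δ`. The second-order constants depend on `d` and `δ`, but always carry the step
size `h` as a factor. Letting `h → 0` first and `δ → 0` afterwards leaves constants free of `d`
(`gaussNorm_fNN_sub_fNN_le_of_le`). -/

theorem integral_abs_mul_le_sqrt {α : Type*} [MeasurableSpace α] {μ : Measure α} {f g : α → ℝ}
    (hf : MemLp f 2 μ) (hg : MemLp g 2 μ) :
    ∫ x, |f x| * |g x| ∂μ ≤ √(∫ x, f x ^ 2 ∂μ) * √(∫ x, g x ^ 2 ∂μ) := by
  have h := integral_mul_le_Lp_mul_Lq_of_nonneg (μ := μ) (f := fun x => |f x|)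
    (g := fun x => |g x|) Real.HolderConjugate.two_two (ae_of_all _ fun x => abs_nonneg _)
    (ae_of_all _ fun x => abs_nonneg _) (by rw [ENNReal.ofReal_ofNat]; exact hf.abs)
    (by rw [ENNReal.ofReal_ofNat]; exact hg.abs)
  simpa [Real.sqrt_eq_rpow] using h

theorem integrable_mul_of_memLp_two {α : Type*} [MeasurableSpace α] {μ : Measure α}
    {f g : α → ℝ} (hf : MemLp f 2 μ) (hg : MemLp g 2 μ) : Integrable (fun x => f x * g x) μ :=
  hf.integrable_mul hg

/-- The standard Gaussian measure on `ℝ^d`. -/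
abbrev gauss (d : ℕ) : Measure (EuclideanSpace ℝ (Fin d)) :=
  stdGaussian (EuclideanSpace ℝ (Fin d))

/-- The norm of `L²(N(0, I_d))`. -/
def gaussNorm {d : ℕ} (g : EuclideanSpace ℝ (Fin d) → ℝ) : ℝ :=
  √(∫ x, g x ^ 2 ∂(gauss d))

theorem gaussNorm_nonneg {d : ℕ} (g : EuclideanSpace ℝ (Fin d) → ℝ) : 0 ≤ gaussNorm g :=
  Real.sqrt_nonneg _

theorem gaussNorm_sq {d : ℕ} (g : EuclideanSpace ℝ (Fin d) → ℝ) :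
    gaussNorm g ^ 2 = ∫ x, g x ^ 2 ∂(gauss d) :=
  Real.sq_sqrt (integral_nonneg fun _ => sq_nonneg _)

theorem integral_abs_mul_le_gaussNorm {d : ℕ} {f g : EuclideanSpace ℝ (Fin d) → ℝ}
    (hf : MemLp f 2 (gauss d)) (hg : MemLp g 2 (gauss d)) :
    ∫ x, |f x| * |g x| ∂(gauss d) ≤ gaussNorm f * gaussNorm g :=
  integral_abs_mul_le_sqrt hf hg

theorem gaussNorm_le_of_abs_le {d : ℕ} {g : EuclideanSpace ℝ (Fin d) → ℝ} {C : ℝ} (hC : 0 ≤ C)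
    (h : ∀ x, |g x| ≤ C) : gaussNorm g ≤ C := by
  refine Real.sqrt_le_iff.2 ⟨hC, ?_⟩
  by_cases hi : Integrable (fun x => g x ^ 2) (gauss d)
  · calc ∫ x, g x ^ 2 ∂(gauss d) ≤ ∫ _, C ^ 2 ∂(gauss d) :=
        integral_mono hi (integrable_const _) fun x =>
          sq_le_sq' (abs_le.1 (h x)).1 (abs_le.1 (h x)).2
      _ = C ^ 2 := by simp
  -- If the square is not integrable, its integral has the default value `0`.
  · rw [integral_undef hi]; positivity

theorem gaussNorm_add_le {d : ℕ} {f g : EuclideanSpace ℝ (Fin d) → ℝ}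
    (hf : MemLp f 2 (gauss d)) (hg : MemLp g 2 (gauss d)) :
    gaussNorm (fun x => f x + g x) ≤ gaussNorm f + gaussNorm g := by
  refine abs_le_of_sq_le_sq' ?_ (add_nonneg (gaussNorm_nonneg f) (gaussNorm_nonneg g)) |>.2
  have hfg := integrable_mul_of_memLp_two hf hg
  have h2 : ∫ x, f x * g x ∂(gauss d) ≤ gaussNorm f * gaussNorm g := by
    refine le_trans (integral_mono hfg ?_ fun x => ?_) (integral_abs_mul_le_gaussNorm hf hg)
    · exact integrable_mul_of_memLp_two hf.abs hg.abs
    · exact (le_abs_self _).trans (abs_mul _ _).le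
  have e : ∫ x, (f x + g x) ^ 2 ∂(gauss d)
      = (∫ x, f x ^ 2 ∂(gauss d)) + 2 * (∫ x, f x * g x ∂(gauss d)) + ∫ x, g x ^ 2 ∂(gauss d) := by
    have h1 : Integrable (fun x => f x ^ 2 + 2 * (f x * g x)) (gauss d) :=
      hf.integrable_sq.add (hfg.const_mul 2)
    rw [← integral_const_mul, ← integral_add hf.integrable_sq (hfg.const_mul 2),
      ← integral_add h1 hg.integrable_sq]
    exact integral_congr_ae (ae_of_all _ fun x => by simp only; ring)
  rw [gaussNorm_sq, e, ← gaussNorm_sq, ← gaussNorm_sq]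
  nlinarith

theorem memLp_norm_gauss (d : ℕ) (q : ℝ≥0∞) (hq : q ≠ ⊤) :
    MemLp (fun x : EuclideanSpace ℝ (Fin d) => ‖x‖) q (gauss d) :=
  (IsGaussian.memLp_id (gauss d) q hq).norm

theorem integrable_norm_pow_gauss (d k : ℕ) :
    Integrable (fun x : EuclideanSpace ℝ (Fin d) => ‖x‖ ^ k) (gauss d) := by
  rcases Nat.eq_zero_or_pos k with rfl | hk
  · simp
  · have := (memLp_norm_gauss d k (by simp)).integrable_norm_rpow (by simp; omega) (by simp)
    simpa using this

theorem memLp_two_norm_pow_gauss (d k : ℕ) :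
    MemLp (fun x : EuclideanSpace ℝ (Fin d) => ‖x‖ ^ k) 2 (gauss d) := by
  rw [memLp_two_iff_integrable_sq (by fun_prop)]
  simpa only [← pow_mul] using integrable_norm_pow_gauss d (k * 2)

/-- The law of `uᵀx` depends on `u` only through `‖u‖`. This is the source of all dimension-free
moment bounds below. -/
theorem map_inner_gauss {d : ℕ} (u : EuclideanSpace ℝ (Fin d)) :
    (gauss d).map (fun x => inner ℝ u x) = (gaussianReal 0 1).map (fun y => ‖u‖ * y) := by
  have h := IsGaussian.map_eq_gaussianReal (μ := gauss d) (innerSL ℝ u)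
  rw [integral_strongDual_stdGaussian, variance_dual_stdGaussian] at h
  rw [gaussianReal_map_const_mul]
  simp only [innerSL_apply_norm] at h
  rw [show (gauss d).map (fun x => inner ℝ u x) = _ from h, mul_zero]
  congr 1
  ext
  simp [Real.coe_toNNReal _ (sq_nonneg ‖u‖)]

/-- The fourth moment of the standard normal distribution. -/
def fourthMoment : ℝ := ∫ y, y ^ 4 ∂(gaussianReal 0 1)

theorem fourthMoment_nonneg : 0 ≤ fourthMoment :=
  integral_nonneg fun y => by positivity

theorem integral_inner_pow_gauss {d : ℕ} (u : EuclideanSpace ℝ (Fin d)) (k : ℕ) :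
    ∫ x, (inner ℝ u x) ^ k ∂(gauss d) = ‖u‖ ^ k * ∫ y, y ^ k ∂(gaussianReal 0 1) := by
  have h1 : ∫ x, (inner ℝ u x) ^ k ∂(gauss d)
      = ∫ y, y ^ k ∂((gauss d).map (fun x => inner ℝ u x)) := by
    rw [integral_map (by fun_prop) (by fun_prop)]
  rw [h1, map_inner_gauss, integral_map (by fun_prop) (by fun_prop), ← integral_const_mul]
  simp [mul_pow]

theorem memLp_inner_gauss {d : ℕ} (u : EuclideanSpace ℝ (Fin d)) :
    MemLp (fun x => inner ℝ u x) 2 (gauss d) :=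
  IsGaussian.memLp_dual (gauss d) (innerSL ℝ u) 2 (by simp)

theorem gaussNorm_inner {d : ℕ} (u : EuclideanSpace ℝ (Fin d)) :
    gaussNorm (fun x => inner ℝ u x) = ‖u‖ := by
  have h1 : ∫ y, y ^ 2 ∂(gaussianReal 0 1) = 1 := by
    have := variance_id_gaussianReal (μ := 0) (v := 1)
    rw [variance_eq_integral (by fun_prop)] at this
    simpa using this
  rw [gaussNorm, integral_inner_pow_gauss, h1, mul_one, Real.sqrt_sq (norm_nonneg _)]

theorem memLp_inner_sq_gauss {d : ℕ} (u : EuclideanSpace ℝ (Fin d)) :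
    MemLp (fun x => (inner ℝ u x) ^ 2) 2 (gauss d) := by
  refine ((memLp_two_norm_pow_gauss d 2).const_mul (‖u‖ ^ 2)).mono (by fun_prop)
    (ae_of_all _ fun x => ?_)
  simp only [norm_pow, norm_mul, norm_norm, ← mul_pow]
  exact pow_le_pow_left₀ (norm_nonneg _) (norm_inner_le_norm u x) 2

theorem memLp_inner_mul_inner_gauss {d : ℕ} (u v : EuclideanSpace ℝ (Fin d)) :
    MemLp (fun x => inner ℝ u x * inner ℝ v x) 2 (gauss d) := by
  refine ((memLp_two_norm_pow_gauss d 2).const_mul (‖u‖ * ‖v‖)).mono (by fun_prop)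
    (ae_of_all _ fun x => ?_)
  simp only [norm_pow, norm_mul, norm_norm]
  calc ‖inner ℝ u x‖ * ‖inner ℝ v x‖ ≤ (‖u‖ * ‖x‖) * (‖v‖ * ‖x‖) :=
        mul_le_mul (norm_inner_le_norm u x) (norm_inner_le_norm v x) (norm_nonneg _) (by positivity)
    _ = ‖u‖ * ‖v‖ * ‖x‖ ^ 2 := by ring

/-- Cauchy–Schwarz applied to the two squares separates the marginals; each contributes a fourth
moment of a one-dimensional Gaussian. -/
theorem gaussNorm_inner_mul_inner {d : ℕ} (u v : EuclideanSpace ℝ (Fin d)) :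
    gaussNorm (fun x => inner ℝ u x * inner ℝ v x) ≤ √fourthMoment * (‖u‖ * ‖v‖) := by
  have key : ∀ w : EuclideanSpace ℝ (Fin d),
      √(∫ x, ((inner ℝ w x) ^ 2) ^ 2 ∂(gauss d)) = √fourthMoment * ‖w‖ ^ 2 := fun w => by
    simp only [← pow_mul]
    rw [integral_inner_pow_gauss, mul_comm, show ‖w‖ ^ (2 * 2) = (‖w‖ ^ 2) ^ 2 by ring]
    exact (Real.sqrt_mul fourthMoment_nonneg _).trans (by rw [Real.sqrt_sq (by positivity)])
  have h := integral_abs_mul_le_sqrt (memLp_inner_sq_gauss u) (memLp_inner_sq_gauss v)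
  rw [key, key] at h
  refine Real.sqrt_le_iff.2 ⟨by positivity, ?_⟩
  rw [mul_pow, Real.sq_sqrt fourthMoment_nonneg]
  calc ∫ x, (inner ℝ u x * inner ℝ v x) ^ 2 ∂(gauss d)
      = ∫ x, |(inner ℝ u x) ^ 2| * |(inner ℝ v x) ^ 2| ∂(gauss d) :=
        integral_congr_ae (ae_of_all _ fun x => by simp [mul_pow])
    _ ≤ _ := h
    _ = fourthMoment * (‖u‖ * ‖v‖) ^ 2 := by
        have := Real.mul_self_sqrt fourthMoment_nonneg
        calc _ = (√fourthMoment * √fourthMoment) * (‖u‖ * ‖v‖) ^ 2 := by ring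
          _ = _ := by rw [this]

/-! ### The target function -/

theorem memLp_eval_gauss {p : ℕ} (h : MvPolynomial (Fin p) ℝ) (q : ℝ≥0∞) (hq : q ≠ ⊤) :
    MemLp (fun y : EuclideanSpace ℝ (Fin p) => MvPolynomial.eval (fun i => y i) h) q (gauss p) := by
  induction h using MvPolynomial.induction_on generalizing q with
  | C a => simpa using memLp_const a
  | add f g hf hg => simp only [map_add]; exact (hf q hq).add (hg q hq)
  | mul_X f i hf =>
    have h1 : MemLp (fun y : EuclideanSpace ℝ (Fin p) => y i) (q * 2) (gauss p) :=
      IsGaussian.memLp_dual (gauss p) (EuclideanSpace.proj i) _ (ENNReal.mul_ne_top hq (by simp))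
    have h2 := hf (q * 2) (ENNReal.mul_ne_top hq (by simp))
    -- Hölder's inequality for a product costs a doubling of the exponent, so the induction runs
    -- over all finite exponents at once.
    have : ENNReal.HolderTriple (q * 2) (q * 2) q := ⟨by
      rcases eq_or_ne q 0 with rfl | hq0
      · simp
      · rw [ENNReal.mul_inv (by simp) (by simp), ← mul_add, ENNReal.inv_two_add_inv_two, mul_one]⟩
    simpa using h1.mul' h2

/-- Characteristic functions decide: pairing the coordinates of `x_V` with `t` is pairing `x` with
the vector of `V` that has coordinates `t`, and this vector has norm `‖t‖`. -/
theorem measurePreserving_repr_proj {d p : ℕ} (V : Submodule ℝ (EuclideanSpace ℝ (Fin d)))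
    (b : OrthonormalBasis (Fin p) ℝ V) :
    MeasurePreserving (fun x => b.repr (V.orthogonalProjectionOnto x)) (gauss d) (gauss p) := by
  have hm : Continuous (fun x => b.repr (V.orthogonalProjectionOnto x)) := by fun_prop
  refine ⟨hm.measurable, ?_⟩
  have : IsProbabilityMeasure ((gauss d).map fun x => b.repr (V.orthogonalProjectionOnto x)) :=
    Measure.isProbabilityMeasure_map hm.aemeasurable
  refine Measure.ext_of_charFun ?_
  ext t
  rw [charFun_stdGaussian, charFun_apply, integral_map hm.aemeasurable (by fun_prop)]
  have hi : ∀ x : EuclideanSpace ℝ (Fin d), inner ℝ (b.repr (V.orthogonalProjectionOnto x)) t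
      = inner ℝ x (b.repr.symm t : EuclideanSpace ℝ (Fin d)) := fun x => by
    rw [← b.repr.symm.inner_map_map, LinearIsometryEquiv.symm_apply_apply,
      ← Submodule.inner_orthogonalProjectionOnto_eq_of_mem_right]
  calc _ = charFun (gauss d) (b.repr.symm t : EuclideanSpace ℝ (Fin d)) := by
        rw [charFun_apply]
        exact integral_congr_ae (ae_of_all _ fun x =>
          congrArg (fun r : ℝ => Complex.exp (r * Complex.I)) (hi x))
    _ = _ := by rw [charFun_stdGaussian, Submodule.norm_coe, LinearIsometryEquiv.norm_map]

theorem continuous_target {d p : ℕ} (h : MvPolynomial (Fin p) ℝ)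
    (V : Submodule ℝ (EuclideanSpace ℝ (Fin d))) (b : OrthonormalBasis (Fin p) ℝ V) :
    Continuous (target h V b) := by
  unfold target
  exact (MvPolynomial.continuous_eval h).comp (by fun_prop)

theorem memLp_target {d p : ℕ} (h : MvPolynomial (Fin p) ℝ)
    (V : Submodule ℝ (EuclideanSpace ℝ (Fin d))) (b : OrthonormalBasis (Fin p) ℝ V) :
    MemLp (target h V b) 2 (gauss d) :=
  (memLp_eval_gauss h 2 (by simp)).comp_measurePreserving (measurePreserving_repr_proj V b)

/-- Here `d`, `V` and the basis disappear from the constants: every later bound sees the target only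
through this norm. -/
theorem gaussNorm_target {d p : ℕ} (h : MvPolynomial (Fin p) ℝ)
    (V : Submodule ℝ (EuclideanSpace ℝ (Fin d))) (b : OrthonormalBasis (Fin p) ℝ V) :
    gaussNorm (target h V b)
      = gaussNorm (fun y : EuclideanSpace ℝ (Fin p) => MvPolynomial.eval (fun i => y i) h) := by
  unfold gaussNorm
  rw [← (measurePreserving_repr_proj V b).map_eq, integral_map (by fun_prop) ?_]
  · rfl
  · exact (((MvPolynomial.continuous_eval h).comp
      (f := fun y : EuclideanSpace ℝ (Fin p) => fun i => y i) (by fun_prop)).pow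
        2).aestronglyMeasurable

end MeanFieldStability

namespace MeanFieldStability

/-! ### Gaussian averages of ridge functions -/

section Ridge

variable {d : ℕ} {F : Type*} [NormedAddCommGroup F] [NormedSpace ℝ F]

/-- The Gaussian average `w ↦ E_x[s(wᵀx) G(x)]`. -/
def ridge (s : ℝ → ℝ) (G : EuclideanSpace ℝ (Fin d) → F) (w : EuclideanSpace ℝ (Fin d)) : F :=
  ∫ x, s (inner ℝ w x) • G x ∂(gauss d)

theorem integrable_ridge {s : ℝ → ℝ} (hs : Continuous s) {K : ℝ} (hK : ∀ r, |s r| ≤ K)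
    {G : EuclideanSpace ℝ (Fin d) → F} (hG : Integrable G (gauss d))
    (w : EuclideanSpace ℝ (Fin d)) :
    Integrable (fun x => s (inner ℝ w x) • G x) (gauss d) := by
  exact hG.bdd_smul K (hs.comp (by fun_prop)).aestronglyMeasurable (ae_of_all _ fun x => hK _)

/-- The moment of `‖x‖` in this constant grows with `d`. The bound is reserved for second-order
quantities, whose size does not matter in the limit of vanishing step size. -/
theorem norm_ridge_sub_le {s : ℝ → ℝ} (hs : Continuous s) {K L : ℝ} (hK : ∀ r, |s r| ≤ K)
    (hL : ∀ r r', |s r - s r'| ≤ L * |r - r'|)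
    {G : EuclideanSpace ℝ (Fin d) → F} (hG : Integrable G (gauss d))
    (hG' : Integrable (fun x => ‖x‖ * ‖G x‖) (gauss d)) (w w' : EuclideanSpace ℝ (Fin d)) :
    ‖ridge s G w - ridge s G w'‖ ≤ L * (∫ x, ‖x‖ * ‖G x‖ ∂(gauss d)) * ‖w - w'‖ := by
  have hL0 : 0 ≤ L := by simpa using (abs_nonneg _).trans (hL 1 0)
  unfold ridge
  rw [← integral_sub (integrable_ridge hs hK hG w) (integrable_ridge hs hK hG w'),
    mul_right_comm, ← integral_const_mul]
  refine norm_integral_le_of_norm_le (hG'.const_mul _) (ae_of_all _ fun x => ?_)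
  rw [← sub_smul, norm_smul, Real.norm_eq_abs]
  calc |s (inner ℝ w x) - s (inner ℝ w' x)| * ‖G x‖
      ≤ L * (‖w - w'‖ * ‖x‖) * ‖G x‖ := by
        gcongr
        refine (hL _ _).trans ?_
        rw [← inner_sub_left]
        gcongr
        exact abs_real_inner_le_norm _ _
    _ = _ := by ring

theorem hasFDerivAt_ridge {s : ℝ → ℝ} (hs : ContDiff ℝ 1 s) {K K' : ℝ} (hK : ∀ r, |s r| ≤ K)
    (hK' : ∀ r, |deriv s r| ≤ K') {G : EuclideanSpace ℝ (Fin d) → F} (hG : Integrable G (gauss d))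
    (hG' : Integrable (fun x => ‖x‖ * ‖G x‖) (gauss d)) (w : EuclideanSpace ℝ (Fin d)) :
    HasFDerivAt (ridge s G) (ridge (deriv s) (fun x => (innerSL ℝ x).smulRight (G x)) w) w := by
  have hs' : Continuous (deriv s) := hs.continuous_deriv le_rfl
  refine hasFDerivAt_integral_of_dominated_of_fderiv_le (𝕜 := ℝ)
    (F := fun w x => s (inner ℝ w x) • G x)
    (F' := fun w x => deriv s (inner ℝ w x) • (innerSL ℝ x).smulRight (G x))
    (bound := fun x => K' * (‖x‖ * ‖G x‖))
    Filter.univ_mem (Filter.Eventually.of_forall fun w =>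
      (integrable_ridge hs.continuous hK hG w).aestronglyMeasurable)
    (integrable_ridge hs.continuous hK hG w) ?_ (ae_of_all _ fun x w _ => ?_) (hG'.const_mul _)
    (ae_of_all _ fun x w _ => ?_)
  · refine ((hs'.comp (by fun_prop)).aestronglyMeasurable).smul ?_
    have h1 : AEStronglyMeasurable (fun x : EuclideanSpace ℝ (Fin d) => innerSL ℝ x) (gauss d) :=
      (innerSL ℝ).continuous.aestronglyMeasurable
    exact (ContinuousLinearMap.smulRightL ℝ (EuclideanSpace ℝ (Fin d)) F).aestronglyMeasurable_comp₂
      h1 hG.aestronglyMeasurable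
  · rw [norm_smul, ContinuousLinearMap.norm_smulRight_apply, innerSL_apply_norm]
    exact mul_le_mul_of_nonneg_right (hK' _) (by positivity)
  · have h1 : HasFDerivAt (fun w : EuclideanSpace ℝ (Fin d) => inner ℝ w x) (innerSL ℝ x) w := by
      have := (innerSL ℝ x).hasFDerivAt (x := w)
      refine this.congr_of_eventuallyEq (Filter.Eventually.of_forall fun y => ?_)
      simp [real_inner_comm]
    have h2 := ((hs.differentiable one_ne_zero _).hasDerivAt.comp_hasFDerivAt w h1).smul_const (G x)
    have e : deriv s (inner ℝ w x) • (innerSL ℝ x).smulRight (G x)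
        = (deriv s (inner ℝ w x) • innerSL ℝ x).smulRight (G x) :=
      ContinuousLinearMap.ext fun v => smul_smul _ _ _
    rw [e]
    exact h2

end Ridge

/-! ### Dimension-free estimates for the potential and its gradient. -/

section AlphaBeta

variable {d : ℕ}

/-- `E_x[g(x) s(wᵀx)]`. -/
def alpha (s : ℝ → ℝ) (g : EuclideanSpace ℝ (Fin d) → ℝ) (w : EuclideanSpace ℝ (Fin d)) : ℝ :=
  ridge s g w

/-- `E_x[g(x) s(wᵀx) x]`. -/
def beta (s : ℝ → ℝ) (g : EuclideanSpace ℝ (Fin d) → ℝ) (w : EuclideanSpace ℝ (Fin d)) :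
    EuclideanSpace ℝ (Fin d) :=
  ridge s (fun x => g x • x) w

variable {g g' : EuclideanSpace ℝ (Fin d) → ℝ}

theorem integrable_norm_pow_mul (hg : MemLp g 2 (gauss d)) (k : ℕ) :
    Integrable (fun x => ‖x‖ ^ k * ‖g x‖) (gauss d) :=
  integrable_mul_of_memLp_two (memLp_two_norm_pow_gauss d k) hg.norm

theorem integrable_smul_id (hg : MemLp g 2 (gauss d)) :
    Integrable (fun x => g x • x) (gauss d) := by
  refine (integrable_norm_pow_mul hg 1).mono' (hg.1.smul (by fun_prop)) (ae_of_all _ fun x => ?_)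
  rw [norm_smul, pow_one, mul_comm]

theorem integrable_norm_mul_smul_id (hg : MemLp g 2 (gauss d)) :
    Integrable (fun x => ‖x‖ * ‖g x • x‖) (gauss d) := by
  refine (integrable_norm_pow_mul hg 2).congr (ae_of_all _ fun x => ?_)
  simp only [norm_smul]; ring

/-- The common shape of the estimates below: `g` is only in `L²`, and the other factor is dominated
by a product `q` of one-dimensional marginals. -/
theorem abs_integral_mul_le {c q : EuclideanSpace ℝ (Fin d) → ℝ} {K : ℝ}
    (hq : MemLp q 2 (gauss d)) (hg : MemLp g 2 (gauss d)) (hc : ∀ x, |c x| ≤ K * |q x|)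
    (hK : 0 ≤ K) :
    |∫ x, c x * g x ∂(gauss d)| ≤ K * (gaussNorm q * gaussNorm g) := by
  have h1 : Integrable (fun x => K * (|q x| * |g x|)) (gauss d) :=
    (integrable_mul_of_memLp_two hq.abs hg.abs).const_mul K
  calc |∫ x, c x * g x ∂(gauss d)| ≤ ∫ x, K * (|q x| * |g x|) ∂(gauss d) := by
        refine norm_integral_le_of_norm_le (f := fun x => c x * g x) h1 (ae_of_all _ fun x => ?_)
        rw [norm_mul, Real.norm_eq_abs, Real.norm_eq_abs, ← mul_assoc]
        exact mul_le_mul_of_nonneg_right (hc x) (abs_nonneg _)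
    _ ≤ _ := by
        rw [integral_const_mul]
        exact mul_le_mul_of_nonneg_left (integral_abs_mul_le_gaussNorm hq hg) hK

theorem alpha_sub_left {s s' : ℝ → ℝ} (hs : Continuous s) (hs' : Continuous s') {K K' : ℝ}
    (hK : ∀ r, |s r| ≤ K) (hK' : ∀ r, |s' r| ≤ K') (hg : MemLp g 2 (gauss d))
    (w : EuclideanSpace ℝ (Fin d)) :
    alpha s g w - alpha s' g w = alpha (fun r => s r - s' r) g w := by
  unfold alpha ridge
  rw [← integral_sub (integrable_ridge hs hK (hg.integrable (by norm_num)) w)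
    (integrable_ridge hs' hK' (hg.integrable (by norm_num)) w)]
  simp only [sub_smul]

theorem beta_sub_left {s s' : ℝ → ℝ} (hs : Continuous s) (hs' : Continuous s') {K K' : ℝ}
    (hK : ∀ r, |s r| ≤ K) (hK' : ∀ r, |s' r| ≤ K') (hg : MemLp g 2 (gauss d))
    (w : EuclideanSpace ℝ (Fin d)) :
    beta s g w - beta s' g w = beta (fun r => s r - s' r) g w := by
  unfold beta ridge
  rw [← integral_sub (integrable_ridge hs hK (integrable_smul_id hg) w)
    (integrable_ridge hs' hK' (integrable_smul_id hg) w)]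
  simp only [sub_smul]

theorem alpha_sub_right {s : ℝ → ℝ} (hs : Continuous s) {K : ℝ} (hK : ∀ r, |s r| ≤ K)
    (hg : MemLp g 2 (gauss d)) (hg' : MemLp g' 2 (gauss d)) (w : EuclideanSpace ℝ (Fin d)) :
    alpha s g w - alpha s g' w = alpha s (fun x => g x - g' x) w := by
  unfold alpha ridge
  rw [← integral_sub (integrable_ridge hs hK (hg.integrable (by norm_num)) w)
    (integrable_ridge hs hK (hg'.integrable (by norm_num)) w)]
  simp only [smul_sub]

theorem beta_sub_right {s : ℝ → ℝ} (hs : Continuous s) {K : ℝ} (hK : ∀ r, |s r| ≤ K)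
    (hg : MemLp g 2 (gauss d)) (hg' : MemLp g' 2 (gauss d)) (w : EuclideanSpace ℝ (Fin d)) :
    beta s g w - beta s g' w = beta s (fun x => g x - g' x) w := by
  unfold beta ridge
  rw [← integral_sub (integrable_ridge hs hK (integrable_smul_id hg) w)
    (integrable_ridge hs hK (integrable_smul_id hg') w)]
  simp only [smul_sub, sub_smul]

theorem abs_alpha_le {s : ℝ → ℝ} {K : ℝ} (hK : ∀ r, |s r| ≤ K)
    (hg : MemLp g 2 (gauss d)) (w : EuclideanSpace ℝ (Fin d)) :
    |alpha s g w| ≤ K * gaussNorm g := by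
  have h := abs_integral_mul_le (c := fun x => s (inner ℝ w x)) (memLp_const (1 : ℝ)) hg
    (fun x => by simpa using hK _) ((abs_nonneg _).trans (hK 0))
  have h1 : gaussNorm (fun _ : EuclideanSpace ℝ (Fin d) => (1 : ℝ)) = 1 := by simp [gaussNorm]
  rwa [h1, one_mul] at h

theorem inner_beta {s : ℝ → ℝ} (hs : Continuous s) {K : ℝ} (hK : ∀ r, |s r| ≤ K)
    (hg : MemLp g 2 (gauss d)) (w u : EuclideanSpace ℝ (Fin d)) :
    inner ℝ u (beta s g w) = ∫ x, (s (inner ℝ w x) * inner ℝ u x) * g x ∂(gauss d) := by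
  unfold beta ridge
  rw [← integral_inner (integrable_ridge hs hK (integrable_smul_id hg) w)]
  refine integral_congr_ae (ae_of_all _ fun x => ?_)
  simp only [inner_smul_right]; ring

theorem norm_le_of_inner_self_le {E : Type*} [NormedAddCommGroup E] [InnerProductSpace ℝ E]
    {v : E} {C : ℝ} (hC : 0 ≤ C) (h : |inner ℝ v v| ≤ C * ‖v‖) : ‖v‖ ≤ C := by
  rw [real_inner_self_eq_norm_sq, abs_of_nonneg (sq_nonneg _), sq] at h
  rcases (norm_nonneg v).eq_or_lt with h0 | h0
  · rwa [← h0]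
  · exact le_of_mul_le_mul_right h h0

/-- Estimating under the integral would produce `‖x‖`, of order `√d`. Pairing the vector `v =
E_x[g(x) s(wᵀx) x]` with itself leaves only the marginal `vᵀx`, of `L²` norm `‖v‖`. -/
theorem norm_beta_le {s : ℝ → ℝ} (hs : Continuous s) {K : ℝ} (hK : ∀ r, |s r| ≤ K)
    (hg : MemLp g 2 (gauss d)) (w : EuclideanSpace ℝ (Fin d)) :
    ‖beta s g w‖ ≤ K * gaussNorm g := by
  have hK0 : 0 ≤ K := (abs_nonneg _).trans (hK 0)
  refine norm_le_of_inner_self_le (mul_nonneg hK0 (gaussNorm_nonneg g)) ?_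
  have h := abs_integral_mul_le (c := fun x => s (inner ℝ w x) * inner ℝ (beta s g w) x)
    (memLp_inner_gauss (beta s g w)) hg
    (fun x => by rw [abs_mul]; exact mul_le_mul_of_nonneg_right (hK _) (abs_nonneg _)) hK0
  rw [gaussNorm_inner] at h
  rw [inner_beta hs hK hg]
  linarith

/-- Pairing the difference `v` with itself again, the Lipschitz bound for `s` leaves the product of
the marginals `(w - w')ᵀx` and `vᵀx`, which the fourth moment controls. -/
theorem norm_beta_sub_le {s : ℝ → ℝ} (hs : Continuous s) {K L : ℝ} (hK : ∀ r, |s r| ≤ K)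
    (hL : ∀ r r', |s r - s r'| ≤ L * |r - r'|)
    (hg : MemLp g 2 (gauss d))
    (w w' : EuclideanSpace ℝ (Fin d)) :
    ‖beta s g w - beta s g w'‖ ≤ L * √fourthMoment * gaussNorm g * ‖w - w'‖ := by
  have hL0 : 0 ≤ L := by simpa using (abs_nonneg _).trans (hL 1 0)
  have hg0 := gaussNorm_nonneg g
  refine norm_le_of_inner_self_le (by positivity) ?_
  set v := beta s g w - beta s g w' with hv
  have h := abs_integral_mul_le
    (c := fun x => (s (inner ℝ w x) - s (inner ℝ w' x)) * inner ℝ v x)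
    (memLp_inner_mul_inner_gauss (w - w') v) hg (fun x => by
      rw [abs_mul, abs_mul, ← mul_assoc, inner_sub_left (𝕜 := ℝ) w w' x]
      exact mul_le_mul_of_nonneg_right (hL _ _) (abs_nonneg _)) hL0
  have hi : ∀ y, Integrable (fun x => (s (inner ℝ y x) * inner ℝ v x) * g x) (gauss d) :=
      fun y => by
    refine ((integrable_ridge hs hK (integrable_smul_id hg) y).const_inner v).congr
      (ae_of_all _ fun x => ?_)
    simp only [inner_smul_right]; ring
  have e : inner ℝ v v
      = ∫ x, (s (inner ℝ w x) - s (inner ℝ w' x)) * inner ℝ v x * g x ∂(gauss d) := by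
    nth_rewrite 2 [hv]
    rw [inner_sub_right, inner_beta hs hK hg, inner_beta hs hK hg, ← integral_sub (hi w) (hi w')]
    simp only [sub_mul]
  rw [e]
  refine h.trans ?_
  have := gaussNorm_inner_mul_inner (w - w') v
  calc L * (gaussNorm (fun x => inner ℝ (w - w') x * inner ℝ v x) * gaussNorm g)
      ≤ L * (√fourthMoment * (‖w - w'‖ * ‖v‖) * gaussNorm g) := by gcongr
    _ = _ := by ring

theorem hasFDerivAt_alpha {s : ℝ → ℝ} (hs : ContDiff ℝ 1 s) {K K' : ℝ} (hK : ∀ r, |s r| ≤ K)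
    (hK' : ∀ r, |deriv s r| ≤ K') (hg : MemLp g 2 (gauss d)) (w : EuclideanSpace ℝ (Fin d)) :
    HasFDerivAt (alpha s g) (innerSL ℝ (beta (deriv s) g w)) w := by
  have h := hasFDerivAt_ridge hs hK hK' (hg.integrable (by norm_num))
    (by simpa using integrable_norm_pow_mul hg 1) w
  suffices e : innerSL ℝ (beta (deriv s) g w)
      = ridge (deriv s) (fun x => (innerSL ℝ x).smulRight (g x)) w by rw [e]; exact h
  unfold beta ridge
  rw [← ContinuousLinearMap.integral_comp_comm _
    (integrable_ridge (hs.continuous_deriv le_rfl) hK' (integrable_smul_id hg) w)]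
  refine integral_congr_ae (ae_of_all _ fun x => ?_)
  refine ContinuousLinearMap.ext fun v => ?_
  change inner ℝ (deriv s (inner ℝ w x) • g x • x) v
    = deriv s (inner ℝ w x) • (inner ℝ x v * g x)
  rw [real_inner_smul_left, real_inner_smul_left, smul_eq_mul]
  ring

/-- The derivative of `w ↦ E_x[g(x) s(wᵀx) x]`. -/
def betaDeriv (s : ℝ → ℝ) (g : EuclideanSpace ℝ (Fin d) → ℝ) (w : EuclideanSpace ℝ (Fin d)) :
    EuclideanSpace ℝ (Fin d) →L[ℝ] EuclideanSpace ℝ (Fin d) :=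
  ridge (deriv s) (fun x => (innerSL ℝ x).smulRight (g x • x)) w

theorem hasFDerivAt_beta {s : ℝ → ℝ} (hs : ContDiff ℝ 1 s) {K K' : ℝ} (hK : ∀ r, |s r| ≤ K)
    (hK' : ∀ r, |deriv s r| ≤ K') (hg : MemLp g 2 (gauss d)) (w : EuclideanSpace ℝ (Fin d)) :
    HasFDerivAt (beta s g) (betaDeriv s g w) w :=
  hasFDerivAt_ridge hs hK hK' (integrable_smul_id hg) (integrable_norm_mul_smul_id hg) w

/-- The sixth moment of `‖x‖` behind this constant depends on `d`. It enters only the second-order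
constant of the velocity field. -/
theorem norm_betaDeriv_sub_le {s : ℝ → ℝ} (hs : ContDiff ℝ 1 s) {K' L : ℝ}
    (hK' : ∀ r, |deriv s r| ≤ K') (hL : ∀ r r', |deriv s r - deriv s r'| ≤ L * |r - r'|)
    (hg : MemLp g 2 (gauss d))
    (w w' : EuclideanSpace ℝ (Fin d)) :
    ‖betaDeriv s g w - betaDeriv s g w'‖
      ≤ L * (gaussNorm (fun x : EuclideanSpace ℝ (Fin d) => ‖x‖ ^ 3) * gaussNorm g) * ‖w - w'‖ := by
  have hL0 : 0 ≤ L := by simpa using (abs_nonneg _).trans (hL 1 0)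
  have hm : AEStronglyMeasurable (fun x : EuclideanSpace ℝ (Fin d) =>
      (innerSL ℝ x).smulRight (g x • x)) (gauss d) := by
    have h1 : AEStronglyMeasurable (fun x : EuclideanSpace ℝ (Fin d) => innerSL ℝ x) (gauss d) :=
      (innerSL ℝ).continuous.aestronglyMeasurable
    exact (ContinuousLinearMap.smulRightL ℝ (EuclideanSpace ℝ (Fin d))
      (EuclideanSpace ℝ (Fin d))).aestronglyMeasurable_comp₂ h1
      (integrable_smul_id hg).aestronglyMeasurable
  have hn : ∀ x, ‖(innerSL ℝ x).smulRight (g x • x)‖ = ‖x‖ ^ 2 * ‖g x‖ := fun x => by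
    rw [ContinuousLinearMap.norm_smulRight_apply, innerSL_apply_norm, norm_smul]; ring
  have h := norm_ridge_sub_le (hs.continuous_deriv le_rfl) hK' hL
    ((integrable_norm_pow_mul hg 2).mono' hm (ae_of_all _ fun x => (hn x).le))
    ((integrable_norm_pow_mul hg 3).congr (ae_of_all _ fun x => by simp only [hn]; ring)) w w'
  refine h.trans ?_
  gcongr
  refine le_trans (le_of_eq ?_) (integral_abs_mul_le_gaussNorm (memLp_two_norm_pow_gauss d 3) hg)
  refine integral_congr_ae (ae_of_all _ fun x => ?_)
  simp only [hn, abs_pow, abs_norm, Real.norm_eq_abs]; ring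

end AlphaBeta

/-! ### Steklov averages of an activation function -/

section Steklov

/-- The Steklov average `(1/ε) ∫_r^{r+ε} s`. -/
def steklov (s : ℝ → ℝ) (ε : ℝ) (r : ℝ) : ℝ := ε⁻¹ * ∫ y in r..r + ε, s y

theorem hasDerivAt_steklov {s : ℝ → ℝ} (hs : Continuous s) (ε r : ℝ) :
    HasDerivAt (steklov s ε) (ε⁻¹ * (s (r + ε) - s r)) r := by
  have h : ∀ r, HasDerivAt (fun r => ∫ y in (0 : ℝ)..r, s y) (s r) r := fun r =>
    intervalIntegral.integral_hasDerivAt_right (hs.intervalIntegrable _ _)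
      (hs.stronglyMeasurableAtFilter _ _) hs.continuousAt
  have h2 := ((h (r + ε)).comp_add_const r ε).sub (h r)
  refine (h2.const_mul ε⁻¹).congr_of_eventuallyEq (Filter.Eventually.of_forall fun y => ?_)
  simp only [steklov, Pi.sub_apply]
  rw [intervalIntegral.integral_interval_sub_left (hs.intervalIntegrable _ _)
    (hs.intervalIntegrable _ _)]

theorem deriv_steklov {s : ℝ → ℝ} (hs : Continuous s) (ε : ℝ) :
    deriv (steklov s ε) = fun r => ε⁻¹ * (s (r + ε) - s r) :=
  funext fun r => (hasDerivAt_steklov hs ε r).deriv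

theorem abs_sub_le_of_abs_deriv_le {s : ℝ → ℝ} (hs : Differentiable ℝ s) {K : ℝ}
    (hK : ∀ r, |deriv s r| ≤ K) (r r' : ℝ) : |s r - s r'| ≤ K * |r - r'| :=
  convex_univ.norm_image_sub_le_of_norm_deriv_le (𝕜 := ℝ) (fun x _ => hs x)
    (fun x _ => hK x) (mem_univ r') (mem_univ r)

variable {σ : ℝ → ℝ} {K ε : ℝ}

theorem abs_inv_mul_sub_le {s : ℝ → ℝ} (hε : 0 < ε) (hL : ∀ r r', |s r - s r'| ≤ K * |r - r'|)
    (r : ℝ) : |ε⁻¹ * (s (r + ε) - s r)| ≤ K := by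
  have := hL (r + ε) r
  rw [add_sub_cancel_left, abs_of_pos hε] at this
  rw [abs_mul, abs_of_pos (inv_pos.2 hε), inv_mul_le_iff₀ hε]
  linarith

theorem differentiable_deriv_of_isActivation (hσ : IsActivation σ K) :
    Differentiable ℝ (deriv σ) :=
  (hσ.contDiff.deriv' (n := 1)).differentiable one_ne_zero

theorem deriv_deriv_steklov (hσ : IsActivation σ K) :
    deriv (deriv (steklov σ ε)) = fun r => ε⁻¹ * (deriv σ (r + ε) - deriv σ r) := by
  have hd := hσ.contDiff.differentiable two_ne_zero
  rw [deriv_steklov hσ.contDiff.continuous]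
  funext r
  exact ((((hd (r + ε)).hasDerivAt.comp_add_const r ε).sub (hd r).hasDerivAt).const_mul ε⁻¹).deriv

/-- The derivatives of the average are difference quotients of `σ` and `σ'`, so the mean value
inequality preserves the constant `K` exactly. -/
theorem isActivation_steklov (hσ : IsActivation σ K) (hε : 0 < ε) :
    IsActivation (steklov σ ε) K where
  contDiff := by
    rw [show (2 : WithTop ℕ∞) = 1 + 1 from rfl, contDiff_succ_iff_deriv]
    refine ⟨fun r => (hasDerivAt_steklov hσ.contDiff.continuous ε r).differentiableAt, by simp, ?_⟩
    rw [deriv_steklov hσ.contDiff.continuous]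
    have := hσ.contDiff.of_le (m := 1) (by norm_num)
    fun_prop
  bound r := by
    have h := intervalIntegral.norm_integral_le_of_norm_le_const (a := r) (b := r + ε) (f := σ)
      (C := K) fun x _ => hσ.bound x
    rw [add_sub_cancel_left, abs_of_pos hε, Real.norm_eq_abs] at h
    rw [steklov, abs_mul, abs_of_pos (inv_pos.2 hε), inv_mul_le_iff₀ hε]
    linarith
  bound_deriv r := by
    rw [deriv_steklov hσ.contDiff.continuous]
    exact abs_inv_mul_sub_le hε
      (abs_sub_le_of_abs_deriv_le (hσ.contDiff.differentiable two_ne_zero) hσ.bound_deriv) r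
  bound_deriv_two r := by
    rw [deriv_deriv_steklov hσ]
    exact abs_inv_mul_sub_le hε
      (abs_sub_le_of_abs_deriv_le (differentiable_deriv_of_isActivation hσ) hσ.bound_deriv_two) r

/-- The purpose of the averaging: the second derivative becomes a difference quotient of the
Lipschitz function `σ'`. The constant explodes as `ε → 0`, which is harmless because the step size
tends to zero before `ε` does. -/
theorem lipschitz_deriv_deriv_steklov (hσ : IsActivation σ K) (hε : 0 < ε) (r r' : ℝ) :
    |deriv (deriv (steklov σ ε)) r - deriv (deriv (steklov σ ε)) r'|
      ≤ (2 * K * ε⁻¹) * |r - r'| := by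
  have h := abs_sub_le_of_abs_deriv_le (differentiable_deriv_of_isActivation hσ) hσ.bound_deriv_two
  have h1 := h (r + ε) (r' + ε)
  have h2 := h r r'
  rw [add_sub_add_right_eq_sub] at h1
  rw [deriv_deriv_steklov hσ]
  simp only
  rw [← mul_sub, abs_mul, abs_of_pos (inv_pos.2 hε), mul_right_comm, mul_comm]
  refine mul_le_mul_of_nonneg_right ?_ (inv_pos.2 hε).le
  rw [abs_le] at *
  constructor <;> linarith

theorem abs_steklov_sub_le (hσ : IsActivation σ K) (hε : 0 < ε) (r : ℝ) :
    |steklov σ ε r - σ r| ≤ K * ε := by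
  have hc := hσ.contDiff.continuous
  have e : steklov σ ε r - σ r = ε⁻¹ * ∫ y in r..r + ε, (σ y - σ r) := by
    rw [intervalIntegral.integral_sub (hc.intervalIntegrable _ _) (by simp), steklov]
    simp
    field_simp
  have h := intervalIntegral.norm_integral_le_of_norm_le_const (a := r) (b := r + ε)
    (f := fun y => σ y - σ r) (C := K * ε) fun y hy => by
      rw [uIoc_of_le (by linarith)] at hy
      refine (abs_sub_le_of_abs_deriv_le (hσ.contDiff.differentiable two_ne_zero)
        hσ.bound_deriv y r).trans ?_
      have hK : 0 ≤ K := (abs_nonneg _).trans (hσ.bound 0)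
      rw [abs_of_nonneg (by linarith [hy.1])]
      exact mul_le_mul_of_nonneg_left (by linarith [hy.2]) hK
  rw [add_sub_cancel_left, abs_of_pos hε, Real.norm_eq_abs] at h
  rw [e, abs_mul, abs_of_pos (inv_pos.2 hε), inv_mul_le_iff₀ hε]
  linarith

theorem abs_deriv_steklov_sub_le (hσ : IsActivation σ K) (hε : 0 < ε) (r : ℝ) :
    |deriv (steklov σ ε) r - deriv σ r| ≤ K * ε := by
  have hd := hσ.contDiff.differentiable two_ne_zero
  obtain ⟨c, hc, he⟩ := exists_deriv_eq_slope σ (by linarith : r < r + ε)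
    hd.continuous.continuousOn hd.differentiableOn
  rw [deriv_steklov hσ.contDiff.continuous]
  have : ε⁻¹ * (σ (r + ε) - σ r) = deriv σ c := by rw [he, add_sub_cancel_left]; field_simp
  simp only [this]
  refine (abs_sub_le_of_abs_deriv_le (differentiable_deriv_of_isActivation hσ)
    hσ.bound_deriv_two c r).trans ?_
  have hK : 0 ≤ K := (abs_nonneg _).trans (hσ.bound 0)
  rw [abs_of_nonneg (by linarith [hc.1])]
  exact mul_le_mul_of_nonneg_left (by linarith [hc.2]) hK

end Steklov

end MeanFieldStability

namespace MeanFieldStability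

/-! ### Functions with a weak derivative in time -/

section WeakDerivative

open Filter Topology

/-- Smooth bumps on the real line that concentrate at the origin. -/
def shrinkingBump {E : Type*} [NormedAddCommGroup E] (n : ℕ) : ContDiffBump (0 : E) where
  rIn := 1 / ((n : ℝ) + 2)
  rOut := 1 / ((n : ℝ) + 1)
  rIn_pos := by positivity
  rIn_lt_rOut := by
    apply one_div_lt_one_div_of_lt <;> linarith [(Nat.cast_nonneg n : (0 : ℝ) ≤ n)]

theorem tendsto_shrinkingBump_rOut {E : Type*} [NormedAddCommGroup E] :
    Tendsto (fun n => (shrinkingBump (E := E) n).rOut) atTop (𝓝 0) :=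
  tendsto_one_div_add_atTop_nhds_zero_nat

/-- A smooth approximation of the indicator function of `[s, t]`. -/
def smoothIndicator (s t : ℝ) (n : ℕ) (r : ℝ) : ℝ :=
  ∫ y in (r - t)..(r - s), (shrinkingBump (E := ℝ) n).normed volume y

variable {s t : ℝ} {n : ℕ}

theorem normed_shrinkingBump_eq_zero {y : ℝ} (hy : (shrinkingBump (E := ℝ) n).rOut ≤ |y|) :
    (shrinkingBump (E := ℝ) n).normed volume y = 0 := by
  rw [← Function.notMem_support, ContDiffBump.support_normed_eq]
  simpa using hy

/-- The derivative is a bump at `s` minus a bump at `t`; integrated against a continuous `F`, it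
tends to `F s - F t`. -/
theorem hasDerivAt_smoothIndicator (s t : ℝ) (n : ℕ) (r : ℝ) :
    HasDerivAt (smoothIndicator s t n) ((shrinkingBump (E := ℝ) n).normed volume (r - s)
      - (shrinkingBump (E := ℝ) n).normed volume (r - t)) r := by
  have hc : Continuous ((shrinkingBump (E := ℝ) n).normed volume) :=
    ContDiffBump.continuous_normed _
  have h : ∀ r, HasDerivAt (fun r => ∫ y in (0 : ℝ)..r, (shrinkingBump (E := ℝ) n).normed volume y)
      ((shrinkingBump (E := ℝ) n).normed volume r) r := fun r =>
    intervalIntegral.integral_hasDerivAt_right (hc.intervalIntegrable _ _)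
      (hc.stronglyMeasurableAtFilter _ _) hc.continuousAt
  have h2 := ((h (r - s)).comp_sub_const r s).sub ((h (r - t)).comp_sub_const r t)
  refine h2.congr_of_eventuallyEq (Eventually.of_forall fun y => ?_)
  simp only [smoothIndicator, Pi.sub_apply]
  rw [intervalIntegral.integral_interval_sub_left (hc.intervalIntegrable _ _)
    (hc.intervalIntegrable _ _)]

theorem contDiff_smoothIndicator (s t : ℝ) (n : ℕ) : ContDiff ℝ ∞ (smoothIndicator s t n) := by
  rw [contDiff_infty_iff_deriv]
  refine ⟨fun r => (hasDerivAt_smoothIndicator s t n r).differentiableAt, ?_⟩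
  rw [funext fun r => (hasDerivAt_smoothIndicator s t n r).deriv]
  have h : ContDiff ℝ ∞ ((shrinkingBump (E := ℝ) n).normed volume) := ContDiffBump.contDiff_normed _
  exact (h.comp (contDiff_id.sub contDiff_const)).sub (h.comp (contDiff_id.sub contDiff_const))

theorem smoothIndicator_nonneg (hst : s ≤ t) (r : ℝ) : 0 ≤ smoothIndicator s t n r :=
  intervalIntegral.integral_nonneg (by linarith) fun _ _ => ContDiffBump.nonneg_normed _ _

theorem smoothIndicator_le_one (hst : s ≤ t) (r : ℝ) : smoothIndicator s t n r ≤ 1 := by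
  rw [smoothIndicator, intervalIntegral.integral_of_le (by linarith),
    ← (shrinkingBump (E := ℝ) n).integral_normed (μ := volume)]
  exact setIntegral_le_integral (ContDiffBump.integrable_normed _)
    (ae_of_all _ fun _ => ContDiffBump.nonneg_normed _ _)

theorem smoothIndicator_eq_zero (hst : s ≤ t) {r : ℝ}
    (h : r ≤ s - (shrinkingBump (E := ℝ) n).rOut ∨ t + (shrinkingBump (E := ℝ) n).rOut ≤ r) :
    smoothIndicator s t n r = 0 := by
  rw [smoothIndicator, intervalIntegral.integral_of_le (by linarith)]
  refine setIntegral_eq_zero_of_forall_eq_zero fun y hy => normed_shrinkingBump_eq_zero ?_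
  rcases h with h | h
  · exact le_trans (by linarith [hy.2]) (neg_le_abs y)
  · exact le_trans (by linarith [hy.1]) (le_abs_self y)

theorem smoothIndicator_eq_one {r : ℝ} (h1 : s + (shrinkingBump (E := ℝ) n).rOut ≤ r)
    (h2 : r ≤ t - (shrinkingBump (E := ℝ) n).rOut) : smoothIndicator s t n r = 1 := by
  have h0 := (shrinkingBump (E := ℝ) n).rOut_pos
  rw [smoothIndicator, intervalIntegral.integral_of_le (by linarith),
    ← (shrinkingBump (E := ℝ) n).integral_normed (μ := volume)]
  refine setIntegral_eq_integral_of_forall_compl_eq_zero fun y hy =>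
    normed_shrinkingBump_eq_zero ?_
  by_contra hlt
  rw [not_le, abs_lt] at hlt
  exact hy ⟨by linarith, by linarith⟩

/-- The endpoints are left out, since the values there need not converge to those of the indicator;
they form a null set. -/
theorem tendsto_smoothIndicator (hst : s ≤ t) {r : ℝ} (hs : r ≠ s) (ht : r ≠ t) :
    Tendsto (fun n => smoothIndicator s t n r) atTop (𝓝 ((Ioc s t).indicator 1 r)) := by
  have hev : ∀ c : ℝ, 0 < c → ∀ᶠ n in atTop, (shrinkingBump (E := ℝ) n).rOut < c := fun c hc =>
    tendsto_shrinkingBump_rOut.eventually (gt_mem_nhds hc)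
  refine tendsto_const_nhds.congr' ?_
  by_cases h : r ∈ Ioc s t
  · have h2 := lt_of_le_of_ne h.2 ht
    filter_upwards [hev (r - s) (by linarith [h.1]), hev (t - r) (by linarith)] with n h3 h4
    rw [indicator_of_mem h, smoothIndicator_eq_one (by linarith) (by linarith)]; rfl
  · rw [indicator_of_notMem h]
    rcases lt_or_gt_of_ne hs with h1 | h1
    · filter_upwards [hev (s - r) (by linarith)] with n h3
      rw [smoothIndicator_eq_zero hst (Or.inl (by linarith))]
    · have h2 : t < r := not_le.1 fun h3 => h ⟨h1, h3⟩
      filter_upwards [hev (r - t) (by linarith)] with n h3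
      rw [smoothIndicator_eq_zero hst (Or.inr (by linarith))]

theorem tendsto_integral_normed_mul {F : ℝ → ℝ} (hF : Continuous F) (s : ℝ) :
    Tendsto (fun n => ∫ r, (shrinkingBump (E := ℝ) n).normed volume (r - s) * F r) atTop
      (𝓝 (F s)) := by
  have h := ContDiffBump.convolution_tendsto_right_of_continuous (μ := volume)
    (tendsto_shrinkingBump_rOut (E := ℝ)) hF s
  refine h.congr fun n => ?_
  rw [convolution_def, ← integral_sub_left_eq_self _ volume s]
  refine integral_congr_ae (ae_of_all _ fun r => ?_)
  simp only [ContinuousLinearMap.lsmul_apply, smul_eq_mul, sub_sub_cancel]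
  rw [← ContDiffBump.normed_neg, neg_sub]

theorem integrable_normed_mul {F : ℝ → ℝ} (hF : Continuous F) (s : ℝ) :
    Integrable (fun r => (shrinkingBump (E := ℝ) n).normed volume (r - s) * F r) := by
  have h : Continuous ((shrinkingBump (E := ℝ) n).normed volume) :=
    ContDiffBump.continuous_normed _
  refine Continuous.integrable_of_hasCompactSupport (by fun_prop) ?_
  refine HasCompactSupport.mul_right ?_
  exact ((shrinkingBump (E := ℝ) n).hasCompactSupport_normed).comp_homeomorph
    (Homeomorph.subRight s)

/-- A continuous function with an integrable weak derivative is its integral. -/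
theorem sub_eq_integral_of_weak_deriv {F H : ℝ → ℝ} (hF : ContinuousOn F (Ici 0))
    (hH : ∀ T, 0 < T → IntegrableOn H (Icc 0 T))
    (hw : ∀ ψ : ℝ → ℝ, ContDiff ℝ ∞ ψ → HasCompactSupport ψ → tsupport ψ ⊆ Ioi 0 →
      ∫ t in Ioi (0 : ℝ), (deriv ψ t * F t + ψ t * H t) = 0)
    (hs : 0 ≤ s) (hst : s ≤ t) : F t - F s = ∫ r in s..t, H r := by
  have hint : ∀ a b, 0 ≤ a → a ≤ b → IntervalIntegrable H volume a b := fun a b ha hab => by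
    rw [intervalIntegrable_iff_integrableOn_Ioc_of_le hab]
    exact (hH (b + 1) (by linarith)).mono_set fun r hr => ⟨by linarith [hr.1], by linarith [hr.2]⟩
  have key : ∀ s, 0 < s → s < t → F t - F s = ∫ r in s..t, H r := by
    intro s hs hst
    -- A continuous extension of `F` to the whole line, constant on negative times, so that
    -- convolution with the bumps makes sense.
    set F' : ℝ → ℝ := fun r => F (max r 0) with hF'
    have hFc : Continuous F' := hF.comp_continuous (by fun_prop) fun r => le_max_right r 0
    -- A radius below `s` keeps the support of the test function in `(0, ∞)`, and a radius below `1`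
    -- keeps it inside `[0, t + 1]`, where `H` is integrable.
    have hev : ∀ᶠ n in atTop, (shrinkingBump (E := ℝ) n).rOut < min s 1 :=
      tendsto_shrinkingBump_rOut.eventually (gt_mem_nhds (lt_min hs one_pos))
    have hHi : IntegrableOn H (Icc 0 (t + 1)) := hH _ (by linarith)
    have hsupp : ∀ n, (shrinkingBump (E := ℝ) n).rOut < min s 1 → ∀ r, r ∉ Icc 0 (t + 1) →
        smoothIndicator s t n r = 0 := by
      intro n hn r hr
      refine smoothIndicator_eq_zero hst.le ?_
      by_contra! hlt
      exact hr ⟨by linarith [min_le_left s 1], by linarith [min_le_right s 1]⟩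
    have h1 : ∀ᶠ n in atTop, (∫ r, smoothIndicator s t n r * (Icc 0 (t + 1)).indicator H r)
        = (∫ r, (shrinkingBump (E := ℝ) n).normed volume (r - t) * F' r)
          - ∫ r, (shrinkingBump (E := ℝ) n).normed volume (r - s) * F' r := by
      filter_upwards [hev] with n hn
      have hn1 := hn.trans_le (min_le_left s 1)
      have hsub : tsupport (smoothIndicator s t n) ⊆ Icc (s - (shrinkingBump (E := ℝ) n).rOut)
          (t + (shrinkingBump (E := ℝ) n).rOut) := by
        refine closure_minimal (fun r hr => ?_) isClosed_Icc
        by_contra hr'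
        rw [mem_Icc, not_and_or, not_le, not_le] at hr'
        exact hr (smoothIndicator_eq_zero hst.le (hr'.imp le_of_lt le_of_lt))
      have hz := hw (smoothIndicator s t n) (contDiff_smoothIndicator s t n)
        (isCompact_Icc.of_isClosed_subset (isClosed_tsupport _) hsub)
        (fun r hr => lt_of_lt_of_le (by linarith) (hsub hr).1)
      have hi1 : Integrable fun r => (shrinkingBump (E := ℝ) n).normed volume (r - s) * F' r
          - (shrinkingBump (E := ℝ) n).normed volume (r - t) * F' r :=
        (integrable_normed_mul (n := n) hFc s).sub (integrable_normed_mul (n := n) hFc t)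
      have hi2 : Integrable fun r => smoothIndicator s t n r * (Icc 0 (t + 1)).indicator H r := by
        refine ((integrable_indicator_iff measurableSet_Icc).2 hHi).bdd_mul (c := 1)
          (contDiff_smoothIndicator s t n).continuous.aestronglyMeasurable (ae_of_all _ fun r => ?_)
        rw [Real.norm_eq_abs, abs_of_nonneg (smoothIndicator_nonneg hst.le r)]
        exact smoothIndicator_le_one hst.le r
      have e : ∫ r, (((shrinkingBump (E := ℝ) n).normed volume (r - s) * F' r
          - (shrinkingBump (E := ℝ) n).normed volume (r - t) * F' r)
          + smoothIndicator s t n r * (Icc 0 (t + 1)).indicator H r) = 0 := by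
        refine Eq.trans ?_ hz
        rw [← setIntegral_eq_integral_of_forall_compl_eq_zero (s := Ioi 0) fun r hr => ?_]
        · refine setIntegral_congr_fun measurableSet_Ioi fun r hr => ?_
          have hF0 : F' r = F r := by rw [hF']; simp only; rw [max_eq_left (le_of_lt hr)]
          simp only [(hasDerivAt_smoothIndicator s t n r).deriv, hF0, sub_mul]
          by_cases h : r ∈ Icc 0 (t + 1)
          · rw [indicator_of_mem h]
          · rw [hsupp n hn r h, zero_mul, zero_mul]
        · rw [mem_Ioi, not_lt] at hr
          rw [normed_shrinkingBump_eq_zero (le_trans (by linarith) (neg_le_abs (r - s))),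
            normed_shrinkingBump_eq_zero (le_trans (by linarith) (neg_le_abs (r - t))),
            smoothIndicator_eq_zero hst.le (Or.inl (by linarith))]
          simp
      rw [integral_add hi1 hi2, integral_sub (integrable_normed_mul hFc s)
        (integrable_normed_mul hFc t)] at e
      linarith
    have h2 : Tendsto (fun n => ∫ r, smoothIndicator s t n r * (Icc 0 (t + 1)).indicator H r) atTop
        (𝓝 (F' t - F' s)) :=
      ((tendsto_integral_normed_mul hFc t).sub (tendsto_integral_normed_mul hFc s)).congr'
        (h1.mono fun n hn => hn.symm)
    have h3 : Tendsto (fun n => ∫ r, smoothIndicator s t n r * (Icc 0 (t + 1)).indicator H r) atTop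
        (𝓝 (∫ r, (Ioc s t).indicator 1 r * (Icc 0 (t + 1)).indicator H r)) := by
      have hHi' := (integrable_indicator_iff measurableSet_Icc).2 hHi
      refine tendsto_integral_of_dominated_convergence
        (fun r => ‖(Icc 0 (t + 1)).indicator H r‖) (fun n => ?_) hHi'.norm
        (fun n => ae_of_all _ fun r => ?_) ?_
      · exact (contDiff_smoothIndicator s t n).continuous.aestronglyMeasurable.mul
          hHi'.aestronglyMeasurable
      · rw [norm_mul, Real.norm_eq_abs, abs_of_nonneg (smoothIndicator_nonneg hst.le r)]
        exact mul_le_of_le_one_left (norm_nonneg _) (smoothIndicator_le_one hst.le r)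
      · filter_upwards [(countable_singleton s).ae_notMem volume,
          (countable_singleton t).ae_notMem volume] with r hr1 hr2
        exact (tendsto_smoothIndicator hst.le hr1 hr2).mul_const _
    have h4 := tendsto_nhds_unique h2 h3
    have e : (fun r => (Ioc s t).indicator 1 r * (Icc 0 (t + 1)).indicator H r)
        = (Ioc s t).indicator H := by
      funext r
      by_cases hr : r ∈ Ioc s t
      · have hr' : r ∈ Icc 0 (t + 1) := ⟨by linarith [hr.1], by linarith [hr.2]⟩
        simp [hr, hr']
      · simp [hr]
    rw [e, integral_indicator measurableSet_Ioc, ← intervalIntegral.integral_of_le hst.le] at h4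
    simpa [hF', hs.le, (hs.trans hst).le] using h4
  rcases hst.eq_or_lt with rfl | hst
  · simp
  rcases hs.eq_or_lt with rfl | hs
  -- The test functions do not reach time `0`. The case `s = 0` follows by letting `s ↓ 0`, with
  -- continuity of `F` at `0` and of the primitive of `H`.
  · have h5 : Tendsto (fun s => F t - F s) (𝓝[>] 0) (𝓝 (F t - F 0)) :=
      tendsto_const_nhds.sub ((hF 0 self_mem_Ici).mono_left (nhdsWithin_mono _ Ioi_subset_Ici_self))
    have h6 : Tendsto (fun s => ∫ r in s..t, H r) (𝓝[>] 0) (𝓝 (∫ r in (0 : ℝ)..t, H r)) := by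
      have hc := intervalIntegral.continuousOn_primitive_interval_left (f := H) (a := 0) (b := t)
        (μ := volume) (by rw [uIcc_of_le hst.le]; exact hH t hst)
      rw [uIcc_of_le hst.le] at hc
      refine (hc 0 ⟨le_rfl, hst.le⟩).mono_left ?_
      rw [← nhdsWithin_Ioc_eq_nhdsGT hst]
      exact nhdsWithin_mono _ Ioc_subset_Icc_self
    refine tendsto_nhds_unique (h5.congr' ?_) h6
    filter_upwards [Ioo_mem_nhdsGT hst] with s hs using key s hs.1 hs.2
  · exact key s hs hst

end WeakDerivative

end MeanFieldStability

namespace MeanFieldStability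

/-! ### The continuity equation tested against `C¹` functions -/

section Transport

open Filter Topology Convolution

set_option linter.unusedSectionVars false

variable {X : Type*} [NormedAddCommGroup X] [NormedSpace ℝ X] [FiniteDimensional ℝ X]
  [MeasurableSpace X] [BorelSpace X]

/-- The integrated form of the continuity equation `∂_t μ_t = -∇ · (μ_t V_t)` on `[0, T]` for one
test function. -/
def Evolves (μ : ℝ → Measure X) (V : ℝ → X → X) (T : ℝ) (φ : X → ℝ) : Prop :=
  ∀ s t, 0 ≤ s → s ≤ t → t ≤ T → (∫ θ, φ θ ∂μ t) - ∫ θ, φ θ ∂μ s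
    = ∫ r in s..t, ∫ θ, fderiv ℝ φ θ (V r θ) ∂μ r

/-- A solution of the continuity equation with a velocity field of linear growth, with a growth
constant that is locally integrable in time. -/
structure IsTransport (μ : ℝ → Measure X) (V : ℝ → X → X) (m : ℝ → ℝ) : Prop where
  isProbabilityMeasure : ∀ t, IsProbabilityMeasure (μ t)
  continuous_vel : ∀ t, 0 ≤ t → Continuous (V t)
  norm_vel_le : ∀ t, 0 ≤ t → ∀ θ, ‖V t θ‖ ≤ m t * (1 + ‖θ‖)
  integrableOn : ∀ T, 0 < T → IntegrableOn m (Icc 0 T)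
  measurable_flux : ∀ G : X → X →L[ℝ] ℝ, Continuous G →
    AEStronglyMeasurable (fun r => ∫ θ, G θ (V r θ) ∂μ r) (volume.restrict (Ici 0))
  smooth : ∀ φ : X → ℝ, ContDiff ℝ ∞ φ → HasCompactSupport φ → ∀ T, Evolves μ V T φ

variable {μ : ℝ → Measure X} {V : ℝ → X → X} {m : ℝ → ℝ} {T : ℝ}

theorem IsTransport.nonneg (h : IsTransport μ V m) {t : ℝ} (ht : 0 ≤ t) : 0 ≤ m t := by
  simpa using (norm_nonneg _).trans (h.norm_vel_le t ht 0)

/-- Dominated convergence twice, in `θ` and then in time; the fluxes are dominated by a multiple of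
the growth constant `m`, which is integrable in time. Both extensions of the class of test functions
rest on this. -/
theorem IsTransport.evolves_of_tendsto (h : IsTransport μ V m) {φn : ℕ → X → ℝ} {φ : X → ℝ}
    {C C' : ℝ} (hn : ∀ n, Evolves μ V T (φn n)) (hc : ∀ n, ContDiff ℝ 1 (φn n))
    (hC : ∀ n θ, |φn n θ| ≤ C) (hlim : ∀ θ, Tendsto (fun n => φn n θ) atTop (𝓝 (φ θ)))
    (hlim' : ∀ θ v, Tendsto (fun n => fderiv ℝ (φn n) θ v) atTop (𝓝 (fderiv ℝ φ θ v)))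
    (hdom : ∀ n, ∀ t ∈ Icc 0 T, ∀ᵐ θ ∂μ t, |fderiv ℝ (φn n) θ (V t θ)| ≤ C' * m t) :
    Evolves μ V T φ := by
  have hp := h.isProbabilityMeasure
  have h1 : ∀ t, Tendsto (fun n => ∫ θ, φn n θ ∂μ t) atTop (𝓝 (∫ θ, φ θ ∂μ t)) := fun t =>
    tendsto_integral_of_dominated_convergence (fun _ => C)
      (fun n => (hc n).continuous.aestronglyMeasurable) (integrable_const _)
      (fun n => ae_of_all _ fun θ => hC n θ) (ae_of_all _ hlim)
  have h2 : ∀ t ∈ Icc 0 T, Tendsto (fun n => ∫ θ, fderiv ℝ (φn n) θ (V t θ) ∂μ t) atTop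
      (𝓝 (∫ θ, fderiv ℝ φ θ (V t θ) ∂μ t)) := fun t ht =>
    tendsto_integral_of_dominated_convergence (fun _ => C' * m t)
      (fun n => ((hc n).continuous_fderiv one_ne_zero |>.clm_apply
        (h.continuous_vel t ht.1)).aestronglyMeasurable) (integrable_const _)
      (fun n => hdom n t ht) (ae_of_all _ fun θ => hlim' θ _)
  intro s t hs hst htT
  have hsub : uIoc s t ⊆ Icc 0 T := by
    rw [uIoc_of_le hst]; exact fun r hr => ⟨hs.trans hr.1.le, hr.2.trans htT⟩
  have h3 : Tendsto (fun n => ∫ r in s..t, ∫ θ, fderiv ℝ (φn n) θ (V r θ) ∂μ r) atTop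
      (𝓝 (∫ r in s..t, ∫ θ, fderiv ℝ φ θ (V r θ) ∂μ r)) := by
    refine intervalIntegral.tendsto_integral_filter_of_dominated_convergence (fun r => C' * m r)
      (Eventually.of_forall fun n => (h.measurable_flux _
        ((hc n).continuous_fderiv one_ne_zero)).mono_measure
        (Measure.restrict_mono (hsub.trans Icc_subset_Ici_self) le_rfl))
      (Eventually.of_forall fun n => ae_of_all _ fun r hr => ?_) ?_
      (ae_of_all _ fun r hr => h2 r (hsub hr))
    · simpa using norm_integral_le_of_norm_le_const (f := fun θ => fderiv ℝ (φn n) θ (V r θ))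
        (hdom n r (hsub hr))
    · rw [intervalIntegrable_iff_integrableOn_Ioc_of_le hst]
      exact ((h.integrableOn (t + 1) (by linarith)).mono_set fun r hr =>
        ⟨hs.trans hr.1.le, by linarith [hr.2]⟩).const_mul C'
  exact tendsto_nhds_unique ((h1 t).sub (h1 s)) (h3.congr fun n => (hn n s t hs hst htT).symm)

theorem abs_convolution_le {C : ℝ} {ψ : X → ℝ}
    (hψ : ∀ x, |ψ x| ≤ C) (n : ℕ) (x : X) :
    |((shrinkingBump (E := X) n).normed (Measure.addHaar (G := X))
      ⋆[ContinuousLinearMap.lsmul ℝ ℝ, Measure.addHaar] ψ) x| ≤ C := by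
  rw [convolution_def, ← Real.norm_eq_abs]
  refine (norm_integral_le_of_norm_le (((shrinkingBump (E := X) n).integrable_normed
    (μ := Measure.addHaar)).mul_const C) (ae_of_all _ fun y => ?_)).trans ?_
  · rw [ContinuousLinearMap.lsmul_apply, smul_eq_mul, norm_mul, Real.norm_eq_abs,
      abs_of_nonneg (ContDiffBump.nonneg_normed _ _)]
    exact mul_le_mul_of_nonneg_left (hψ _) (ContDiffBump.nonneg_normed _ _)
  · rw [integral_mul_const, ContDiffBump.integral_normed, one_mul]

theorem convolution_eq_zero {R : ℝ} {ψ : X → ℝ} (hψ : ∀ x, R < ‖x‖ → ψ x = 0) (n : ℕ) {x : X}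
    (hx : R + 1 < ‖x‖) :
    ((shrinkingBump (E := X) n).normed (Measure.addHaar (G := X))
      ⋆[ContinuousLinearMap.lsmul ℝ ℝ, Measure.addHaar] ψ) x = 0 := by
  rw [convolution_def]
  refine integral_eq_zero_of_ae (ae_of_all _ fun y => ?_)
  simp only [ContinuousLinearMap.lsmul_apply, smul_eq_mul, Pi.zero_apply]
  by_cases hy : ‖y‖ < 1
  · rw [hψ (x - y) (by linarith [norm_sub_norm_le x y]), mul_zero]
  · have h1 : (shrinkingBump (E := X) n).rOut ≤ 1 := by
      change 1 / ((n : ℝ) + 1) ≤ 1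
      rw [div_le_one (by positivity)]
      linarith [(Nat.cast_nonneg n : (0 : ℝ) ≤ n)]
    have : (shrinkingBump (E := X) n).normed (Measure.addHaar (G := X)) y = 0 := by
      rw [← Function.notMem_support, ContDiffBump.support_normed_eq]
      simp only [Metric.mem_ball, dist_zero_right, not_lt]
      linarith
    rw [this, zero_mul]

/-- Mollification: the directional derivative of the convolution is the convolution of the
directional derivative, so it inherits the uniform bound and converges pointwise. -/
theorem IsTransport.evolves_of_hasCompactSupport (h : IsTransport μ V m) {φ : X → ℝ}
    (hφ : ContDiff ℝ 1 φ) (hs : HasCompactSupport φ) : Evolves μ V T φ := by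
  set φn : ℕ → X → ℝ := fun n => (shrinkingBump (E := X) n).normed (Measure.addHaar (G := X))
      ⋆[ContinuousLinearMap.lsmul ℝ ℝ, Measure.addHaar] φ with hφn
  have hli : ∀ n, LocallyIntegrable ((shrinkingBump (E := X) n).normed (Measure.addHaar (G := X)))
      Measure.addHaar := fun n =>
    ((shrinkingBump (E := X) n).integrable_normed (μ := Measure.addHaar)).locallyIntegrable
  have hsm : ∀ n, ContDiff ℝ ∞ (φn n) := fun n =>
    (ContDiffBump.hasCompactSupport_normed _).contDiff_convolution_left _
      (ContDiffBump.contDiff_normed _) (hφ.continuous.locallyIntegrable)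
  have hd : ∀ n x v, fderiv ℝ (φn n) x v
      = ((shrinkingBump (E := X) n).normed (Measure.addHaar (G := X))
        ⋆[ContinuousLinearMap.lsmul ℝ ℝ, Measure.addHaar] (fun y => fderiv ℝ φ y v)) x := by
    intro n x v
    rw [(hs.hasFDerivAt_convolution_right (ContinuousLinearMap.lsmul ℝ ℝ) (hli n) hφ x).fderiv]
    exact convolution_precompR_apply _ (hli n) (hs.fderiv ℝ) (hφ.continuous_fderiv one_ne_zero) x v
  have hcd := hφ.continuous_fderiv one_ne_zero
  obtain ⟨C, hC⟩ := hs.exists_bound_of_continuous hφ.continuous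
  obtain ⟨A, hA⟩ := (hs.fderiv ℝ).exists_bound_of_continuous hcd
  obtain ⟨R, hR⟩ := (hs.fderiv ℝ).isCompact.isBounded.exists_norm_le
  have hA0 : 0 ≤ A := (norm_nonneg _).trans (hA 0)
  have hR' : ∀ v x, max R 0 < ‖x‖ → fderiv ℝ φ x v = 0 := fun v x hx => by
    have : fderiv ℝ φ x = 0 := by
      by_contra h0
      exact absurd (hR x (subset_tsupport _ h0)) (not_le.2 ((le_max_left _ _).trans_lt hx))
    rw [this]; rfl
  -- All mollified derivatives live in the ball of radius `max R 0 + 1`, where the linear growth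
  -- factor `1 + ‖x‖` is at most `max R 0 + 2`.
  refine h.evolves_of_tendsto (φn := φn) (C := C) (C' := A * (max R 0 + 2))
    (fun n => h.smooth _ (hsm n) ((ContDiffBump.hasCompactSupport_normed _).convolution _ hs) T)
    (fun n => (hsm n).of_le (by exact_mod_cast le_top))
    (fun n x => abs_convolution_le (fun y => hC y) n x)
    (fun x => ContDiffBump.convolution_tendsto_right_of_continuous tendsto_shrinkingBump_rOut
      hφ.continuous x)
    (fun x v => ?_) (fun n t ht => ae_of_all _ fun x => ?_)
  · simp only [hd]
    exact ContDiffBump.convolution_tendsto_right_of_continuous tendsto_shrinkingBump_rOut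
      (by fun_prop : Continuous fun y => fderiv ℝ φ y v) x
  · have hm := h.nonneg ht.1
    rw [hd]
    by_cases hx : max R 0 + 1 < ‖x‖
    · rw [convolution_eq_zero (hR' _) n hx, abs_zero]
      positivity
    · refine (abs_convolution_le (C := A * ‖V t x‖) (fun y => ?_) n x).trans ?_
      · exact ((fderiv ℝ φ y).le_opNorm _).trans (mul_le_mul_of_nonneg_right (hA y) (norm_nonneg _))
      · rw [mul_assoc]
        refine mul_le_mul_of_nonneg_left ((h.norm_vel_le t ht.1 x).trans ?_) hA0
        rw [mul_comm]
        exact mul_le_mul_of_nonneg_right (by linarith) hm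

/-- A smooth cut-off function. -/
def cutoff (X : Type*) [NormedAddCommGroup X] : ContDiffBump (0 : X) where
  rIn := 1
  rOut := 2
  rIn_pos := one_pos
  rIn_lt_rOut := one_lt_two

/-- The continuity equation holds for bounded `C¹` test functions whose derivative along the
velocity field is controlled by the growth constant. -/
theorem IsTransport.evolves (h : IsTransport μ V m) {φ : X → ℝ} (hφ : ContDiff ℝ 1 φ) {C C' : ℝ}
    (hC : ∀ θ, |φ θ| ≤ C) (hC' : ∀ t ∈ Icc 0 T, ∀ᵐ θ ∂μ t, |fderiv ℝ φ θ (V t θ)| ≤ C' * m t) :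
    Evolves μ V T φ := by
  have hχ : ContDiff ℝ 1 (cutoff X) := (cutoff X).contDiff
  have hχs : HasCompactSupport (cutoff X) := (cutoff X).hasCompactSupport
  obtain ⟨A, hA⟩ := (hχs.fderiv ℝ).exists_bound_of_continuous (hχ.continuous_fderiv one_ne_zero)
  have hA0 : 0 ≤ A := (norm_nonneg _).trans (hA 0)
  have hC0 : 0 ≤ C := (abs_nonneg _).trans (hC 0)
  set c : ℕ → ℝ := fun n => ((n : ℝ) + 1)⁻¹ with hc
  have hcpos : ∀ n, 0 < c n := fun n => by positivity
  have hctend : Tendsto c atTop (𝓝 0) := by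
    simpa [hc] using tendsto_one_div_add_atTop_nhds_zero_nat (𝕜 := ℝ)
  have hcsm : ∀ n, ContDiff ℝ 1 fun θ : X => cutoff X (c n • θ) := fun n => hχ.comp (by fun_prop)
  have hd : ∀ n θ v, fderiv ℝ (fun θ => cutoff X (c n • θ) * φ θ) θ v
      = cutoff X (c n • θ) * fderiv ℝ φ θ v + φ θ * (c n * fderiv ℝ (cutoff X) (c n • θ) v) := by
    intro n θ v
    have h1 : HasFDerivAt (fun θ : X => c n • θ) (c n • ContinuousLinearMap.id ℝ X) θ :=
      (hasFDerivAt_id θ).const_smul (c n)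
    have h2 := ((hχ.differentiable one_ne_zero) (c n • θ)).hasFDerivAt.comp θ h1
    have h3 := h2.mul ((hφ.differentiable one_ne_zero) θ).hasFDerivAt
    rw [show (fun θ => cutoff X (c n • θ) * φ θ) = ((cutoff X) ∘ fun θ => c n • θ) * φ from rfl,
      h3.fderiv]
    simp
  -- The extra term `φ · D(cutoff)` carries a factor `c n` and vanishes unless `c n * ‖θ‖ ≤ 2`. As
  -- `c n ≤ 1`, it meets the linear growth only through `c n * (1 + ‖θ‖) ≤ 3`, whence the summand `C
  -- * (3 * A)`.
  refine h.evolves_of_tendsto (φn := fun n θ => cutoff X (c n • θ) * φ θ) (C := C)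
    (C' := C' + C * (3 * A))
    (fun n => h.evolves_of_hasCompactSupport ((hcsm n).mul hφ) ?_) (fun n => (hcsm n).mul hφ)
    (fun n θ => ?_) (fun θ => ?_) (fun θ v => ?_) (fun n t ht => ?_)
  · exact (hχs.comp_smul (hcpos n).ne').mul_right
  · rw [abs_mul, abs_of_nonneg (ContDiffBump.nonneg _)]
    exact (mul_le_of_le_one_left (abs_nonneg _) (ContDiffBump.le_one _)).trans (hC θ)
  · have : Tendsto (fun n => cutoff X (c n • θ)) atTop (𝓝 (cutoff X ((0 : ℝ) • θ))) :=
      (hχ.continuous.tendsto _).comp (hctend.smul_const θ)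
    rw [zero_smul, ContDiffBump.one_of_mem_closedBall _ (by simp [cutoff])] at this
    simpa using this.mul_const (φ θ)
  · simp only [hd]
    have h1 : Tendsto (fun n => cutoff X (c n • θ)) atTop (𝓝 (cutoff X ((0 : ℝ) • θ))) :=
      (hχ.continuous.tendsto _).comp (hctend.smul_const θ)
    rw [zero_smul, ContDiffBump.one_of_mem_closedBall _ (by simp [cutoff])] at h1
    have h2 : Tendsto (fun n => fderiv ℝ (cutoff X) (c n • θ) v) atTop
        (𝓝 (fderiv ℝ (cutoff X) ((0 : ℝ) • θ) v)) :=
      ((hχ.continuous_fderiv_apply one_ne_zero).comp (by fun_prop : Continuous fun y : X => (y, v))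
        |>.tendsto _).comp (hctend.smul_const θ)
    simpa using (h1.mul_const (fderiv ℝ φ θ v)).add ((hctend.mul h2).const_mul (φ θ))
  · have hm := h.nonneg ht.1
    filter_upwards [hC' t ht] with θ hθ
    rw [hd, add_mul]
    refine (abs_add_le _ _).trans (add_le_add ?_ ?_)
    · rw [abs_mul, abs_of_nonneg (ContDiffBump.nonneg _)]
      exact (mul_le_of_le_one_left (abs_nonneg _) (ContDiffBump.le_one _)).trans hθ
    · rw [abs_mul, mul_assoc]
      refine mul_le_mul (hC θ) ?_ (abs_nonneg _) hC0
      by_cases hx : c n * ‖θ‖ ≤ 2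
      · have h1 : |fderiv ℝ (cutoff X) (c n • θ) (V t θ)| ≤ A * (m t * (1 + ‖θ‖)) :=
          ((fderiv ℝ (cutoff X) (c n • θ)).le_opNorm _).trans
            (mul_le_mul (hA _) (h.norm_vel_le t ht.1 θ) (norm_nonneg _) hA0)
        have h2 : c n ≤ 1 := inv_le_one_of_one_le₀ (by linarith [(Nat.cast_nonneg n : (0 : ℝ) ≤ n)])
        rw [abs_mul, abs_of_pos (hcpos n)]
        calc c n * |fderiv ℝ (cutoff X) (c n • θ) (V t θ)| ≤ c n * (A * (m t * (1 + ‖θ‖))) :=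
              mul_le_mul_of_nonneg_left h1 (hcpos n).le
          _ = A * m t * (c n + c n * ‖θ‖) := by ring
          _ ≤ A * m t * (1 + 2) := by gcongr
          _ = _ := by ring
      · have h0 : fderiv ℝ (cutoff X) (c n • θ) = 0 := by
          by_contra h0
          have h1 := tsupport_fderiv_subset ℝ (subset_tsupport _ h0)
          rw [ContDiffBump.tsupport_eq] at h1
          simp only [cutoff, Metric.mem_closedBall, dist_zero_right, norm_smul, Real.norm_eq_abs,
            abs_of_pos (hcpos n)] at h1
          exact hx h1
        rw [h0]
        simp only [zero_apply, mul_zero, abs_zero]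
        positivity

end Transport

end MeanFieldStability

namespace MeanFieldStability

/-! ### Mean-field flows as solutions of a continuity equation -/

open Filter Topology

/-- By the portmanteau theorem the mass of an open set is lower semicontinuous under weak
convergence, and the open sets are a generating π-system. -/
theorem measurable_of_continuous_probabilityMeasure {Ω : Type*} [TopologicalSpace Ω]
    [MeasurableSpace Ω] [BorelSpace Ω] [HasOuterApproxClosed Ω] {f : ℝ → ProbabilityMeasure Ω}
    (hf : Continuous f) : Measurable fun t => (f t : Measure Ω) := by
  refine Measurable.measure_of_isPiSystem_of_isProbabilityMeasure
    (BorelSpace.measurable_eq.trans rfl) isPiSystem_isOpen fun U hU => ?_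
  refine LowerSemicontinuous.measurable fun t y hy => ?_
  have h := ProbabilityMeasure.le_liminf_measure_open_of_tendsto (hf.tendsto t) hU
  exact eventually_lt_of_lt_liminf (hy.trans_le h)

variable {d : ℕ}

/-- The residual `f_NN(x; μ) - f*(x)`. -/
def resid (σ : ℝ → ℝ) (fstar : EuclideanSpace ℝ (Fin d) → ℝ) (μ : Measure (Param d))
    (x : EuclideanSpace ℝ (Fin d)) : ℝ :=
  fNN σ μ x - fstar x

/-- The velocity field with activation function `s`, second-layer weights transformed by `τ`,
learning rates `ca`, `cw` and residual `g`. -/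
def vel (s τ : ℝ → ℝ) (ca cw : ℝ) (g : EuclideanSpace ℝ (Fin d) → ℝ) (θ : Param d) : Param d :=
  (-(ca * alpha s g θ.2), -((cw * τ θ.1) • beta (deriv s) g θ.2))

/-- The velocity field of a mean-field flow. -/
def flowVel (σ : ℝ → ℝ) (fstar : EuclideanSpace ℝ (Fin d) → ℝ) (ξa ξw : ℝ → ℝ)
    (ρ : ℝ → ProbabilityMeasure (Param d)) (t : ℝ) : Param d → Param d :=
  vel σ id (ξa t) (ξw t) (resid σ fstar (ρ t : Measure (Param d)))

/-- The first absolute moment of the second-layer weights. -/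
def absMoment (μ : Measure (Param d)) : ℝ := ∫ θ, |θ.1| ∂μ

theorem absMoment_nonneg (μ : Measure (Param d)) : 0 ≤ absMoment μ :=
  integral_nonneg fun _ => abs_nonneg _

/-! ### The residual and the velocity field at a fixed time. -/

section FixedTime

variable {σ : ℝ → ℝ} {K : ℝ} {fstar : EuclideanSpace ℝ (Fin d) → ℝ} {μ : Measure (Param d)}

theorem lipschitz_deriv_of_isActivation (hσ : IsActivation σ K) (r r' : ℝ) :
    |deriv σ r - deriv σ r'| ≤ K * |r - r'| :=
  abs_sub_le_of_abs_deriv_le (differentiable_deriv_of_isActivation hσ) hσ.bound_deriv_two r r'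

theorem nonneg_of_isActivation (hσ : IsActivation σ K) : 0 ≤ K :=
  (abs_nonneg _).trans (hσ.bound 0)

theorem contDiff_deriv_of_isActivation (hσ : IsActivation σ K) : ContDiff ℝ 1 (deriv σ) :=
  hσ.contDiff.deriv' (n := 1)

theorem abs_fNN_le (hσ : IsActivation σ K) (hμ : Integrable (fun θ : Param d => θ.1) μ)
    (x : EuclideanSpace ℝ (Fin d)) : |fNN σ μ x| ≤ K * absMoment μ := by
  rw [fNN, absMoment, ← integral_const_mul, ← Real.norm_eq_abs]
  refine norm_integral_le_of_norm_le (hμ.abs.const_mul K) (ae_of_all _ fun θ => ?_)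
  rw [norm_mul, mul_comm]
  exact mul_le_mul_of_nonneg_right (hσ.bound _) (abs_nonneg _)

theorem stronglyMeasurable_fNN [SFinite μ] (hσ : IsActivation σ K) :
    StronglyMeasurable (fNN σ μ) := by
  have hc := hσ.contDiff.continuous
  refine StronglyMeasurable.integral_prod_right
    (f := fun (x : EuclideanSpace ℝ (Fin d)) (θ : Param d) => θ.1 * σ (inner ℝ θ.2 x)) ?_
  exact Continuous.stronglyMeasurable (by fun_prop)

theorem memLp_fNN [SFinite μ] (hσ : IsActivation σ K)
    (hμ : Integrable (fun θ : Param d => θ.1) μ) : MemLp (fNN σ μ) 2 (gauss d) :=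
  MemLp.of_bound (stronglyMeasurable_fNN hσ).aestronglyMeasurable _
    (ae_of_all _ fun x => abs_fNN_le hσ hμ x)

theorem memLp_resid [SFinite μ] (hσ : IsActivation σ K) (hf : MemLp fstar 2 (gauss d))
    (hμ : Integrable (fun θ : Param d => θ.1) μ) : MemLp (resid σ fstar μ) 2 (gauss d) :=
  (memLp_fNN hσ hμ).sub hf

theorem gaussNorm_neg (g : EuclideanSpace ℝ (Fin d) → ℝ) :
    gaussNorm (fun x => -g x) = gaussNorm g := by
  simp [gaussNorm]

theorem gaussNorm_resid_le [SFinite μ] (hσ : IsActivation σ K) (hf : MemLp fstar 2 (gauss d))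
    (hμ : Integrable (fun θ : Param d => θ.1) μ) :
    gaussNorm (resid σ fstar μ) ≤ K * absMoment μ + gaussNorm fstar := by
  have h := gaussNorm_add_le (memLp_fNN hσ hμ) hf.neg
  have h1 := gaussNorm_le_of_abs_le (g := fNN σ μ)
    (mul_nonneg (nonneg_of_isActivation hσ) (absMoment_nonneg μ)) (abs_fNN_le hσ hμ)
  have e : resid σ fstar μ = fun x => fNN σ μ x + (-fstar) x := by
    funext x; simp [resid, sub_eq_add_neg]
  have e2 : gaussNorm (-fstar) = gaussNorm fstar := gaussNorm_neg fstar
  rw [e]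
  linarith

theorem continuous_alpha {g : EuclideanSpace ℝ (Fin d) → ℝ} (hσ : IsActivation σ K)
    (hg : MemLp g 2 (gauss d)) : Continuous (alpha σ g) :=
  continuous_iff_continuousAt.2 fun w => (hasFDerivAt_alpha (hσ.contDiff.of_le (by norm_num))
    hσ.bound hσ.bound_deriv hg w).continuousAt

theorem continuous_beta {g : EuclideanSpace ℝ (Fin d) → ℝ} (hσ : IsActivation σ K)
    (hg : MemLp g 2 (gauss d)) : Continuous (beta (deriv σ) g) :=
  continuous_iff_continuousAt.2 fun w => (hasFDerivAt_beta (contDiff_deriv_of_isActivation hσ)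
    hσ.bound_deriv hσ.bound_deriv_two hg w).continuousAt

theorem potential_eq (θ : Param d) :
    potential σ fstar μ θ = θ.1 * alpha σ (resid σ fstar μ) θ.2 := by
  simp only [potential, gaussExp, alpha, ridge, resid, smul_eq_mul]
  congr 1
  exact integral_congr_ae (ae_of_all _ fun x => mul_comm _ _)

theorem deriv_potential (a : ℝ) (w : EuclideanSpace ℝ (Fin d)) :
    deriv (fun a => potential σ fstar μ (a, w)) a = alpha σ (resid σ fstar μ) w := by
  simp only [potential_eq]
  simp

theorem gradient_potential [SFinite μ] (hσ : IsActivation σ K) (hf : MemLp fstar 2 (gauss d))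
    (hμ : Integrable (fun θ : Param d => θ.1) μ) (a : ℝ) (w : EuclideanSpace ℝ (Fin d)) :
    gradient (fun w => potential σ fstar μ (a, w)) w
      = a • beta (deriv σ) (resid σ fstar μ) w := by
  simp only [potential_eq]
  have h := (hasFDerivAt_alpha (hσ.contDiff.of_le (by norm_num)) hσ.bound hσ.bound_deriv
    (memLp_resid hσ hf hμ) w).const_mul a
  refine HasGradientAt.gradient ?_
  rw [hasGradientAt_iff_hasFDerivAt]
  refine h.congr_fderiv (ContinuousLinearMap.ext fun v => ?_)
  change a * inner ℝ _ v = inner ℝ (a • _) v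
  rw [real_inner_smul_left]

/-- For a test function `φ(θ) ψ(t)` the weak formulation says that `∫ φ dρ_t` has the flux of `φ` as
its weak derivative in time. The signs of the equation are absorbed in `vel`, which is a descent
direction. -/
theorem weakIntegrand_mul [SFinite μ] (hσ : IsActivation σ K) (hf : MemLp fstar 2 (gauss d))
    (hμ : Integrable (fun θ : Param d => θ.1) μ) (ξa ξw : ℝ → ℝ) {φ : Param d → ℝ}
    (hφ : Differentiable ℝ φ) (ψ : ℝ → ℝ) (θ : Param d) (t : ℝ) :
    weakIntegrand σ fstar ξa ξw μ (fun z => φ z.1 * ψ z.2) θ t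
      = -(deriv ψ t * φ θ
        + ψ t * fderiv ℝ φ θ (vel σ id (ξa t) (ξw t) (resid σ fstar μ) θ)) := by
  have h1 : deriv (fun s => φ θ * ψ s) t = φ θ * deriv ψ t := deriv_const_mul_field _
  have ha : HasFDerivAt (fun a : ℝ => ((a, θ.2) : Param d))
      (ContinuousLinearMap.inl ℝ ℝ (EuclideanSpace ℝ (Fin d))) θ.1 := hasFDerivAt_prodMk_left _ _
  have hw : HasFDerivAt (fun w : EuclideanSpace ℝ (Fin d) => ((θ.1, w) : Param d))
      (ContinuousLinearMap.inr ℝ ℝ (EuclideanSpace ℝ (Fin d))) θ.2 := hasFDerivAt_prodMk_right _ _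
  have h2 : deriv (fun a => φ (a, θ.2) * ψ t) θ.1 = fderiv ℝ φ θ (1, 0) * ψ t := by
    have := ((hφ θ).hasFDerivAt.comp θ.1 ha).hasDerivAt.mul_const (ψ t)
    simpa using! this.deriv
  have h3 : ∀ v, inner ℝ (gradient (fun w => φ (θ.1, w) * ψ t) θ.2) v
      = ψ t * fderiv ℝ φ θ (0, v) := fun v => by
    have := ((hφ θ).hasFDerivAt.comp θ.2 hw).mul_const (ψ t)
    have h4 := this.hasGradientAt.gradient
    rw [show (fun w => φ (θ.1, w) * ψ t) = fun w => (φ ∘ fun w => (θ.1, w)) w * ψ t from rfl,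
      h4, InnerProductSpace.toDual_symm_apply]
    rfl
  have h5 : vel σ id (ξa t) (ξw t) (resid σ fstar μ) θ
      = -((ξa t * alpha σ (resid σ fstar μ) θ.2) • ((1, 0) : Param d)
        + (0, ξw t • θ.1 • beta (deriv σ) (resid σ fstar μ) θ.2)) := by
    simp [vel, mul_smul]
  rw [weakIntegrand, h1, h2, h3, deriv_potential, gradient_potential hσ hf hμ, h5]
  simp only [map_neg, map_add, map_smul, smul_eq_mul]
  ring

/-- The norm of `Param d` is the maximum norm, so the components are bounded separately; `1 ≤ B`
lets the same bound cover the `a`-component, which has no factor `τ`. -/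
theorem norm_vel_le {s τ : ℝ → ℝ} (hs : IsActivation s K) {g : EuclideanSpace ℝ (Fin d) → ℝ}
    (hg : MemLp g 2 (gauss d)) {ca cw C B : ℝ} (hca : |ca| ≤ C) (hcw : |cw| ≤ C) (θ : Param d)
    (hB1 : 1 ≤ B) (hB : |τ θ.1| ≤ B) : ‖vel s τ ca cw g θ‖ ≤ C * (K * gaussNorm g) * B := by
  have hC : 0 ≤ C := (abs_nonneg _).trans hca
  have hK := nonneg_of_isActivation hs
  have hg0 := gaussNorm_nonneg g
  refine max_le ?_ ?_
  · simp only [vel, norm_neg, norm_mul, Real.norm_eq_abs]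
    calc |ca| * |alpha s g θ.2| ≤ C * (K * gaussNorm g) :=
          mul_le_mul hca (abs_alpha_le hs.bound hg _) (abs_nonneg _) hC
      _ ≤ _ := le_mul_of_one_le_right (by positivity) hB1
  · simp only [vel, norm_neg, norm_smul, Real.norm_eq_abs, abs_mul]
    have := norm_beta_le (contDiff_deriv_of_isActivation hs).continuous hs.bound_deriv hg θ.2
    calc |cw| * |τ θ.1| * ‖beta (deriv s) g θ.2‖ ≤ C * B * (K * gaussNorm g) := by gcongr
      _ = _ := by ring

theorem continuous_vel {s τ : ℝ → ℝ} (hs : IsActivation s K) (hτ : Continuous τ)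
    {g : EuclideanSpace ℝ (Fin d) → ℝ} (hg : MemLp g 2 (gauss d)) (ca cw : ℝ) :
    Continuous (vel s τ ca cw g) := by
  have h1 := continuous_alpha hs hg
  have h2 := continuous_beta hs hg
  unfold vel
  fun_prop

end FixedTime

/-! ### From the weak formulation to the integrated continuity equation. -/

section Flow

variable {σ : ℝ → ℝ} {Kσ Kξ : ℝ} {fstar : EuclideanSpace ℝ (Fin d) → ℝ} {ξa ξw : ℝ → ℝ}
  {ρ : ℝ → ProbabilityMeasure (Param d)}

theorem integrable_fst (hρ : IsMeanFieldFlow σ fstar ξa ξw ρ) {t : ℝ} (ht : 0 ≤ t) :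
    Integrable (fun θ : Param d => θ.1) (ρ t : Measure (Param d)) :=
  ⟨by fun_prop, hρ.moment_lt_top t ht⟩

/-- A mean-field flow, extended to negative times by its initial value, as a Markov kernel. -/
def flowKernel (hρ : IsMeanFieldFlow σ fstar ξa ξw ρ) : Kernel ℝ (Param d) where
  toFun t := (ρ (max t 0) : Measure (Param d))
  measurable' := measurable_of_continuous_probabilityMeasure
    (hρ.continuousOn.comp_continuous (by fun_prop) fun t => le_max_right t 0)

theorem flowKernel_apply (hρ : IsMeanFieldFlow σ fstar ξa ξw ρ) (t : ℝ) :
    flowKernel hρ t = (ρ (max t 0) : Measure (Param d)) := rfl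

instance (hρ : IsMeanFieldFlow σ fstar ξa ξw ρ) : IsMarkovKernel (flowKernel hρ) :=
  ⟨fun t => by rw [flowKernel_apply]; infer_instance⟩

theorem measurable_absMoment (hρ : IsMeanFieldFlow σ fstar ξa ξw ρ) :
    Measurable fun t => absMoment (ρ (max t 0) : Measure (Param d)) := by
  have : StronglyMeasurable fun t => ∫ θ, |θ.1| ∂(flowKernel hρ t) :=
    StronglyMeasurable.integral_kernel_prod_right' (κ := flowKernel hρ)
      (f := fun z : ℝ × Param d => |z.2.1|) (Continuous.stronglyMeasurable (by fun_prop))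
  exact this.measurable

theorem integrableOn_absMoment (hρ : IsMeanFieldFlow σ fstar ξa ξw ρ) {T : ℝ} (hT : 0 < T) :
    IntegrableOn (fun t => absMoment (ρ t : Measure (Param d))) (Icc 0 T) := by
  refine ⟨?_, ?_⟩
  · refine (measurable_absMoment hρ).aestronglyMeasurable.congr ?_
    filter_upwards [ae_restrict_mem measurableSet_Icc] with t ht
    rw [max_eq_left ht.1]
  · refine lt_of_le_of_lt (lintegral_mono_ae ?_) (hρ.moment_integrable T hT)
    filter_upwards [ae_restrict_mem measurableSet_Icc] with t ht
    refine (enorm_integral_le_lintegral_enorm _).trans (le_of_eq ?_)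
    simp

theorem stronglyMeasurable_resid (hσ : IsActivation σ Kσ) (hf : Continuous fstar)
    (hρ : IsMeanFieldFlow σ fstar ξa ξw ρ) :
    StronglyMeasurable fun z : ℝ × EuclideanSpace ℝ (Fin d) =>
      resid σ fstar (ρ (max z.1 0) : Measure (Param d)) z.2 := by
  have hc := hσ.contDiff.continuous
  refine StronglyMeasurable.sub ?_ (Continuous.stronglyMeasurable (by fun_prop))
  exact StronglyMeasurable.integral_kernel_prod_right'
    (κ := (flowKernel hρ).prodMkRight (EuclideanSpace ℝ (Fin d)))
    (f := fun y : (ℝ × EuclideanSpace ℝ (Fin d)) × Param d => y.2.1 * σ (inner ℝ y.2.2 y.1.2))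
    (Continuous.stronglyMeasurable (by fun_prop))

theorem stronglyMeasurable_ridge {F : Type*} [NormedAddCommGroup F] [NormedSpace ℝ F]
    {s : ℝ → ℝ} (hs : Continuous s) {G : ℝ × EuclideanSpace ℝ (Fin d) → F}
    (hG : StronglyMeasurable G) :
    StronglyMeasurable fun z : ℝ × EuclideanSpace ℝ (Fin d) =>
      ridge s (fun x => G (z.1, x)) z.2 := by
  refine StronglyMeasurable.integral_prod_right
    (f := fun (z : ℝ × EuclideanSpace ℝ (Fin d)) (x : EuclideanSpace ℝ (Fin d)) =>
      s (inner ℝ z.2 x) • G (z.1, x)) ?_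
  refine StronglyMeasurable.smul (Continuous.stronglyMeasurable (by fun_prop)) ?_
  exact hG.comp_measurable (by fun_prop)

theorem stronglyMeasurable_flowVel (hσ : IsActivation σ Kσ) (hf : Continuous fstar)
    (hξa : ContinuousOn ξa (Ici 0)) (hξw : ContinuousOn ξw (Ici 0))
    (hρ : IsMeanFieldFlow σ fstar ξa ξw ρ) :
    StronglyMeasurable fun z : ℝ × Param d => flowVel σ fstar ξa ξw ρ (max z.1 0) z.2 := by
  have hr := stronglyMeasurable_resid hσ hf hρ
  have ha : Continuous fun z : ℝ × Param d => ξa (max z.1 0) :=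
    hξa.comp_continuous (by fun_prop) fun z => le_max_right z.1 0
  have hw : Continuous fun z : ℝ × Param d => ξw (max z.1 0) :=
    hξw.comp_continuous (by fun_prop) fun z => le_max_right z.1 0
  have hp : Measurable fun z : ℝ × Param d => (z.1, z.2.2) := by fun_prop
  have h1 := (stronglyMeasurable_ridge hσ.contDiff.continuous hr).comp_measurable hp
  have h2 := (stronglyMeasurable_ridge (contDiff_deriv_of_isActivation hσ).continuous
    (hr.smul (g := fun z : ℝ × EuclideanSpace ℝ (Fin d) => z.2)
      (Continuous.stronglyMeasurable (by fun_prop)))).comp_measurable hp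
  have h3 : Continuous fun z : ℝ × Param d => id z.2.1 := by fun_prop
  exact (ha.stronglyMeasurable.mul h1).neg.prodMk
    ((hw.stronglyMeasurable.mul h3.stronglyMeasurable).smul h2).neg

theorem aestronglyMeasurable_flux (hσ : IsActivation σ Kσ) (hf : Continuous fstar)
    (hξa : ContinuousOn ξa (Ici 0)) (hξw : ContinuousOn ξw (Ici 0))
    (hρ : IsMeanFieldFlow σ fstar ξa ξw ρ) {G : Param d → Param d →L[ℝ] ℝ} (hG : Continuous G) :
    AEStronglyMeasurable (fun r => ∫ θ, G θ (flowVel σ fstar ξa ξw ρ r θ)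
      ∂(ρ r : Measure (Param d))) (volume.restrict (Ici 0)) := by
  have h : StronglyMeasurable fun z : ℝ × Param d =>
      G z.2 (flowVel σ fstar ξa ξw ρ (max z.1 0) z.2) :=
    isBoundedBilinearMap_apply.continuous.comp_stronglyMeasurable
      ((hG.comp continuous_snd).stronglyMeasurable.prodMk
        (stronglyMeasurable_flowVel hσ hf hξa hξw hρ))
  refine (h.integral_kernel_prod_right' (κ := flowKernel hρ)).aestronglyMeasurable.congr ?_
  filter_upwards [ae_restrict_mem measurableSet_Ici] with t ht
  simp only [flowKernel_apply]
  rw [max_eq_left ht]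

/-- The growth constant of the velocity field of a mean-field flow. -/
def flowGrowth (Kσ Kξ Q : ℝ) (ρ : ℝ → ProbabilityMeasure (Param d)) (t : ℝ) : ℝ :=
  Kξ * (Kσ * (Kσ * absMoment (ρ t : Measure (Param d)) + Q))

/-- Product test functions suffice: weak continuity of the flow makes `∫ φ dρ_t` continuous, and the
linear growth of the field together with the compact support of `φ` makes its weak derivative
integrable in time. -/
theorem isTransport_of_isMeanFieldFlow (hσ : IsActivation σ Kσ) (hf : MemLp fstar 2 (gauss d))
    (hfc : Continuous fstar) (hξa : IsLearningRate ξa Kξ) (hξw : IsLearningRate ξw Kξ)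
    (hρ : IsMeanFieldFlow σ fstar ξa ξw ρ) :
    IsTransport (fun t => (ρ t : Measure (Param d))) (flowVel σ fstar ξa ξw ρ)
      (flowGrowth Kσ Kξ (gaussNorm fstar) ρ) := by
  have hKξ : 0 ≤ Kξ := (abs_nonneg _).trans (hξa.bound 0 le_rfl)
  have hKσ := nonneg_of_isActivation hσ
  obtain ⟨La, hLa⟩ := hξa.lipschitz
  obtain ⟨Lw, hLw⟩ := hξw.lipschitz
  have hbound : ∀ t, 0 ≤ t → ∀ θ : Param d, ‖flowVel σ fstar ξa ξw ρ t θ‖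
      ≤ flowGrowth Kσ Kξ (gaussNorm fstar) ρ t * (1 + ‖θ‖) := by
    intro t ht θ
    have hi := integrable_fst hρ ht
    refine (norm_vel_le hσ (memLp_resid hσ hf hi) (hξa.bound t ht) (hξw.bound t ht) θ
      (B := 1 + ‖θ‖) (by linarith [norm_nonneg θ]) ?_).trans ?_
    · exact (norm_fst_le θ).trans (by linarith)
    · have := gaussNorm_resid_le hσ hf hi
      unfold flowGrowth
      gcongr
  have hint : ∀ T, 0 < T → IntegrableOn (flowGrowth Kσ Kξ (gaussNorm fstar) ρ) (Icc 0 T) := by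
    intro T hT
    have h := integrableOn_absMoment hρ hT
    exact (((h.const_mul Kσ).add (integrable_const _)).const_mul Kσ).const_mul Kξ
  refine ⟨fun t => inferInstance, fun t ht => ?_, hbound, hint,
    fun G hG => aestronglyMeasurable_flux hσ hfc hLa.continuousOn hLw.continuousOn hρ hG, ?_⟩
  · exact continuous_vel hσ continuous_id (memLp_resid hσ hf (integrable_fst hρ ht)) _ _
  · intro φ hφ hφs _ s t hs hst _
    have hd : Continuous (fderiv ℝ φ) := hφ.continuous_fderiv (by simp)
    obtain ⟨C, hC⟩ := hφs.exists_bound_of_continuous hφ.continuous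
    obtain ⟨A, hA⟩ := (hφs.fderiv ℝ).exists_bound_of_continuous hd
    obtain ⟨R, hR⟩ := (hφs.fderiv ℝ).isCompact.isBounded.exists_norm_le
    have hA0 : 0 ≤ A := (norm_nonneg _).trans (hA 0)
    have hm0 : ∀ t, 0 ≤ flowGrowth Kσ Kξ (gaussNorm fstar) ρ t := fun t => by
      have := absMoment_nonneg (ρ t : Measure (Param d))
      have := gaussNorm_nonneg fstar
      unfold flowGrowth
      positivity
    have hflux : ∀ t, 0 ≤ t → ∀ θ, ‖fderiv ℝ φ θ (flowVel σ fstar ξa ξw ρ t θ)‖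
        ≤ A * (1 + |R|) * flowGrowth Kσ Kξ (gaussNorm fstar) ρ t := by
      intro t ht θ
      by_cases h0 : fderiv ℝ φ θ = 0
      · rw [h0, zero_apply, norm_zero]
        have := hm0 t
        positivity
      · have h1 := (hR θ (subset_tsupport _ h0)).trans (le_abs_self R)
        calc _ ≤ A * (flowGrowth Kσ Kξ (gaussNorm fstar) ρ t * (1 + ‖θ‖)) :=
              ((fderiv ℝ φ θ).le_opNorm _).trans
                (mul_le_mul (hA θ) (hbound t ht θ) (norm_nonneg _) hA0)
          _ ≤ A * (flowGrowth Kσ Kξ (gaussNorm fstar) ρ t * (1 + |R|)) := by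
              have := hm0 t
              gcongr
          _ = _ := by ring
    refine sub_eq_integral_of_weak_deriv (F := fun t => ∫ θ, φ θ ∂(ρ t : Measure (Param d)))
      (H := fun t => ∫ θ, fderiv ℝ φ θ (flowVel σ fstar ξa ξw ρ t θ) ∂(ρ t : Measure (Param d)))
      ?_ (fun T hT => ?_) (fun ψ hψ hψs hψt => ?_) hs hst
    · intro t ht
      exact ProbabilityMeasure.tendsto_iff_forall_integral_tendsto.1 (hρ.continuousOn t ht)
        (BoundedContinuousFunction.ofNormedAddCommGroup φ hφ.continuous C hC)
    · refine ((hint T hT).const_mul (A * (1 + |R|))).mono' ?_ ?_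
      · exact (aestronglyMeasurable_flux hσ hfc hLa.continuousOn hLw.continuousOn hρ
          hd).mono_measure (Measure.restrict_mono Icc_subset_Ici_self le_rfl)
      · filter_upwards [ae_restrict_mem measurableSet_Icc] with t ht
        simpa using norm_integral_le_of_norm_le_const (μ := (ρ t : Measure (Param d)))
          (f := fun θ => fderiv ℝ φ θ (flowVel σ fstar ξa ξw ρ t θ))
          (ae_of_all _ (hflux t ht.1))
    · have hη := hρ.weak (fun z => φ z.1 * ψ z.2)
        ((hφ.comp contDiff_fst).mul (hψ.comp contDiff_snd)) ?_ ?_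
      · rw [← neg_eq_zero, ← integral_neg]
        refine Eq.trans (setIntegral_congr_fun measurableSet_Ioi fun t ht => ?_) hη
        have ht0 : (0 : ℝ) ≤ t := le_of_lt ht
        have hi := integrable_fst hρ ht0
        rw [integral_congr_ae (ae_of_all _ fun θ => weakIntegrand_mul hσ hf hi ξa ξw
          (hφ.differentiable (by simp)) ψ θ t), integral_neg, integral_add, integral_const_mul,
          integral_const_mul]
        · rfl
        · exact (Integrable.of_bound hφ.continuous.aestronglyMeasurable C
            (ae_of_all _ hC)).const_mul _
        · exact (Integrable.of_bound (hd.clm_apply (continuous_vel hσ continuous_id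
            (memLp_resid hσ hf hi) _ _)).aestronglyMeasurable _
            (ae_of_all _ (hflux t ht0))).const_mul _
      · refine HasCompactSupport.intro (hφs.isCompact.prod hψs.isCompact) fun z hz => ?_
        rw [mem_prod, not_and_or] at hz
        rcases hz with hz | hz
        · rw [image_eq_zero_of_notMem_tsupport hz, zero_mul]
        · rw [image_eq_zero_of_notMem_tsupport hz, mul_zero]
      · refine fun z hz => ⟨mem_univ _, hψt ?_⟩
        have : tsupport (fun z : Param d × ℝ => φ z.1 * ψ z.2) ⊆ Prod.snd ⁻¹' tsupport ψ := by
          refine closure_minimal (fun y hy => ?_) ((isClosed_tsupport ψ).preimage continuous_snd)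
          exact subset_tsupport _ (right_ne_zero_of_mul hy)
        exact this hz

end Flow

end MeanFieldStability

namespace MeanFieldStability

/-! ### A priori bounds on the second-layer weights -/

open Filter Topology

/-- Grönwall's inequality in integral form, for bounded functions. -/
theorem le_of_le_add_mul_integral {u : ℝ → ℝ} {T c K B : ℝ} (hK : 0 < K)
    (hB : ∀ t ∈ Icc 0 T, u t ≤ B) (hi : IntegrableOn u (Icc 0 T)) (h0 : ∀ t ∈ Icc 0 T, 0 ≤ u t)
    (h : ∀ t ∈ Icc 0 T, u t ≤ c + K * ∫ r in (0 : ℝ)..t, u r) {t : ℝ} (ht : t ∈ Icc 0 T) :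
    u t ≤ 2 * c * Real.exp (2 * K * t) := by
  have hT : 0 ≤ T := ht.1.trans ht.2
  have hc : 0 ≤ c := by simpa using (h0 0 ⟨le_rfl, hT⟩).trans (h 0 ⟨le_rfl, hT⟩)
  -- In the norm weighted by `exp (-2Kr)` the integral term contributes at most `S / 2`, which is
  -- absorbed on the left. Boundedness of `u` makes `S` finite, and no continuity is needed; the
  -- price is the factor `2` and the rate `2K`.
  set S : ℝ := sSup ((fun r => Real.exp (-(2 * K * r)) * u r) '' Icc 0 T) with hS
  have hbdd : BddAbove ((fun r => Real.exp (-(2 * K * r)) * u r) '' Icc 0 T) := by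
    refine ⟨B, ?_⟩
    rintro _ ⟨r, hr, rfl⟩
    refine (mul_le_of_le_one_left (h0 r hr) ?_).trans (hB r hr)
    rw [Real.exp_le_one_iff]
    have := hr.1
    have : 0 ≤ 2 * K * r := by positivity
    linarith
  have hle : ∀ r ∈ Icc 0 T, u r ≤ S * Real.exp (2 * K * r) := fun r hr => by
    have := le_csSup hbdd (mem_image_of_mem _ hr)
    rw [Real.exp_neg, inv_mul_le_iff₀ (Real.exp_pos _)] at this
    linarith
  have hS0 : 0 ≤ S := by
    have := (h0 0 ⟨le_rfl, hT⟩).trans (hle 0 ⟨le_rfl, hT⟩)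
    simpa using this
  have hstep : ∀ r ∈ Icc 0 T, u r ≤ (c + S / 2) * Real.exp (2 * K * r) := by
    intro r hr
    have h1 : ∫ y in (0 : ℝ)..r, u y ≤ ∫ y in (0 : ℝ)..r, S * Real.exp (2 * K * y) := by
      refine intervalIntegral.integral_mono_on hr.1 ?_ ?_ fun y hy =>
        hle y ⟨hy.1, hy.2.trans hr.2⟩
      · rw [intervalIntegrable_iff_integrableOn_Ioc_of_le hr.1]
        exact hi.mono_set fun y hy => ⟨hy.1.le, hy.2.trans hr.2⟩
      · exact Continuous.intervalIntegrable (by fun_prop) _ _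
    have h2 : ∫ y in (0 : ℝ)..r, S * Real.exp (2 * K * y)
        = S * ((Real.exp (2 * K * r) - 1) / (2 * K)) := by
      rw [intervalIntegral.integral_const_mul, intervalIntegral.integral_comp_mul_left _
        (by positivity : (2 * K) ≠ 0), integral_exp]
      simp [div_eq_inv_mul]
    have h3 : 1 ≤ Real.exp (2 * K * r) := Real.one_le_exp (by have := hr.1; positivity)
    calc u r ≤ c + K * (S * ((Real.exp (2 * K * r) - 1) / (2 * K))) :=
          (h r hr).trans (by rw [← h2]; gcongr)
      _ = c + S / 2 * (Real.exp (2 * K * r) - 1) := by field_simp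
      _ ≤ (c + S / 2) * Real.exp (2 * K * r) := by nlinarith
  have hS2 : S ≤ c + S / 2 := by
    refine csSup_le ⟨_, mem_image_of_mem _ (⟨le_rfl, hT⟩ : (0 : ℝ) ∈ Icc 0 T)⟩ ?_
    rintro _ ⟨r, hr, rfl⟩
    simp only
    rw [Real.exp_neg, inv_mul_le_iff₀ (Real.exp_pos _), mul_comm]
    exact hstep r hr
  refine (hle t ht).trans ?_
  gcongr
  linarith

/-- A smooth bounded substitute for the absolute value. -/
def softAbs (N a : ℝ) : ℝ := N - N ^ 2 / (N + √(1 + a ^ 2))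

section SoftAbs

variable {N : ℝ}

/-- With `v = √(1 + a²)` this is `N v / (N + v)`, from which positivity, the bound by `v` and the
limit `N → ∞` can be read off; the defining form is better suited to differentiation. -/
theorem softAbs_eq (hN : 0 < N) (a : ℝ) :
    softAbs N a = N * √(1 + a ^ 2) / (N + √(1 + a ^ 2)) := by
  have : 0 < N + √(1 + a ^ 2) := by positivity
  rw [softAbs]
  field_simp
  ring

theorem contDiff_softAbs (hN : 0 < N) : ContDiff ℝ 1 (softAbs N) := by
  have h : ContDiff ℝ 1 fun a : ℝ => √(1 + a ^ 2) :=
    ContDiff.sqrt (by fun_prop) fun a => by positivity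
  exact contDiff_const.sub (contDiff_const.div (contDiff_const.add h) fun a => by positivity)

theorem softAbs_nonneg (hN : 0 < N) (a : ℝ) : 0 ≤ softAbs N a := by
  rw [softAbs_eq hN]; positivity

theorem softAbs_le (hN : 0 < N) (a : ℝ) : softAbs N a ≤ N := by
  have : 0 ≤ N ^ 2 / (N + √(1 + a ^ 2)) := by positivity
  rw [softAbs]; linarith

theorem sqrt_one_add_sq_le (a : ℝ) : √(1 + a ^ 2) ≤ 1 + |a| := by
  refine Real.sqrt_le_iff.2 ⟨by positivity, ?_⟩
  nlinarith [sq_abs a, abs_nonneg a]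

theorem abs_le_sqrt_one_add_sq (a : ℝ) : |a| ≤ √(1 + a ^ 2) :=
  Real.abs_le_sqrt (by linarith)

theorem softAbs_le_one_add_abs (hN : 0 < N) (a : ℝ) : softAbs N a ≤ 1 + |a| := by
  refine le_trans ?_ (sqrt_one_add_sq_le a)
  rw [softAbs_eq hN, div_le_iff₀ (by positivity)]
  nlinarith [mul_self_nonneg (√(1 + a ^ 2))]

theorem abs_deriv_softAbs_le (hN : 0 < N) (a : ℝ) : |deriv (softAbs N) a| ≤ 1 := by
  have hv : 0 < √(1 + a ^ 2) := by positivity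
  have h1 : HasDerivAt (fun a : ℝ => √(1 + a ^ 2)) (a / √(1 + a ^ 2)) a := by
    have h0 : HasDerivAt (fun a : ℝ => 1 + a ^ 2) (2 * a) a := by
      simpa using (hasDerivAt_pow 2 a).const_add 1
    convert! h0.sqrt (by positivity) using 1
    field_simp
  have h2 : HasDerivAt (softAbs N) (N ^ 2 * (a / √(1 + a ^ 2)) / (N + √(1 + a ^ 2)) ^ 2) a := by
    have := ((hasDerivAt_const a (N ^ 2)).fun_div (h1.const_add N) (by positivity)).const_sub N
    convert! this using 1
    simp [neg_div]
  rw [h2.deriv, abs_div, abs_mul, abs_of_nonneg (sq_nonneg N), abs_of_nonneg (sq_nonneg (N + _)),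
    div_le_one (by positivity)]
  have h3 : |a / √(1 + a ^ 2)| ≤ 1 := by
    rw [abs_div, abs_of_pos hv, div_le_one hv]; exact abs_le_sqrt_one_add_sq a
  calc N ^ 2 * |a / √(1 + a ^ 2)| ≤ N ^ 2 * 1 := by gcongr
    _ ≤ (N + √(1 + a ^ 2)) ^ 2 := by nlinarith

theorem tendsto_softAbs (a : ℝ) :
    Tendsto (fun n : ℕ => softAbs ((n : ℝ) + 1) a) atTop (𝓝 √(1 + a ^ 2)) := by
  have h1 : Tendsto (fun n : ℕ => ((n : ℝ) + 1)⁻¹) atTop (𝓝 0) := by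
    simpa using tendsto_one_div_add_atTop_nhds_zero_nat (𝕜 := ℝ)
  have h2 : Tendsto (fun n : ℕ => √(1 + a ^ 2) / (1 + √(1 + a ^ 2) * ((n : ℝ) + 1)⁻¹)) atTop
      (𝓝 (√(1 + a ^ 2) / (1 + √(1 + a ^ 2) * 0))) :=
    tendsto_const_nhds.div (tendsto_const_nhds.add (h1.const_mul _)) (by simp)
  rw [mul_zero, add_zero, div_one] at h2
  refine h2.congr fun n => ?_
  rw [softAbs_eq (by positivity)]
  field_simp

/-- The value `N v / (N + v)` increases with `v`, and at `v = R + 1` it falls short of `R + 1` by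
`(R + 1)² / (N + R + 1)`. The condition on `N` makes this at most `1 / 2`. -/
theorem le_softAbs (hN : 0 < N) {R a : ℝ} (hR : 0 ≤ R) (hNR : 2 * (R + 1) ^ 2 ≤ N)
    (ha : R + 1 ≤ |a|) : R + 1 / 2 ≤ softAbs N a := by
  have hv := ha.trans (abs_le_sqrt_one_add_sq a)
  rw [softAbs_eq hN, le_div_iff₀ (by positivity)]
  have h1 : R + 1 / 2 ≤ N := by nlinarith
  nlinarith [mul_nonneg (sub_nonneg.2 hv) (sub_nonneg.2 h1)]

end SoftAbs

variable {d : ℕ} {σ : ℝ → ℝ} {Kσ Kξ Kρ : ℝ} {fstar : EuclideanSpace ℝ (Fin d) → ℝ} {ξa ξw : ℝ → ℝ}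
  {ρ : ℝ → ProbabilityMeasure (Param d)}

theorem ae_abs_le_of_isInitialization {ρ₀ : ProbabilityMeasure (Param d)}
    (h : IsInitialization ρ₀ Kρ) : ∀ᵐ θ ∂(ρ₀ : Measure (Param d)), |θ.1| ≤ Kρ := by
  obtain ⟨ρa, ρw, _, _, he, -, hs⟩ := h
  rw [he]
  have h1 : ∀ᵐ a ∂ρa, |a| ≤ Kρ := by
    rw [ae_iff]
    convert hs using 2
    ext a
    simp [abs_le]
  exact Measure.quasiMeasurePreserving_fst.ae h1

theorem continuousOn_integral (hρ : IsMeanFieldFlow σ fstar ξa ξw ρ) {φ : Param d → ℝ}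
    (hφ : Continuous φ) {C : ℝ} (hC : ∀ θ, ‖φ θ‖ ≤ C) :
    ContinuousOn (fun t => ∫ θ, φ θ ∂(ρ t : Measure (Param d))) (Ici 0) := fun t ht =>
  ProbabilityMeasure.tendsto_iff_forall_integral_tendsto.1 (hρ.continuousOn t ht)
    (BoundedContinuousFunction.ofNormedAddCommGroup φ hφ C hC)

section Common

variable (hσ : IsActivation σ Kσ) (hf : MemLp fstar 2 (gauss d))
  (hfc : Continuous fstar) (hξa : IsLearningRate ξa Kξ) (hξw : IsLearningRate ξw Kξ)
  (hρ : IsMeanFieldFlow σ fstar ξa ξw ρ)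

include hσ hf hfc hξa hξw hρ

/-- Test functions of the second-layer weight alone. -/
theorem abs_integral_sub_le_of_deriv {u q : ℝ → ℝ} {C C' : ℝ} (hu : ContDiff ℝ 1 u)
    (hC : ∀ a, |u a| ≤ C) (hq : Continuous q) (huq : ∀ a, |deriv u a| ≤ q a) (hC' : ∀ a, q a ≤ C')
    {t : ℝ} (ht : 0 ≤ t) (hint : IntervalIntegrable (fun r => flowGrowth Kσ Kξ (gaussNorm fstar) ρ r
      * ∫ θ, q θ.1 ∂(ρ r : Measure (Param d))) volume 0 t) :
    ∫ θ, u θ.1 ∂(ρ t : Measure (Param d)) ≤ (∫ θ, u θ.1 ∂(ρ 0 : Measure (Param d)))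
      + ∫ r in (0 : ℝ)..t, flowGrowth Kσ Kξ (gaussNorm fstar) ρ r
        * ∫ θ, q θ.1 ∂(ρ r : Measure (Param d)) := by
  have htr := isTransport_of_isMeanFieldFlow hσ hf hfc hξa hξw hρ
  have hd : ∀ θ v : Param d, fderiv ℝ (fun θ : Param d => u θ.1) θ v = deriv u θ.1 * v.1 := by
    intro θ v
    have := ((hu.differentiable one_ne_zero θ.1).hasDerivAt.comp_hasFDerivAt θ
      (hasFDerivAt_fst (𝕜 := ℝ))).fderiv
    rw [show (fun θ : Param d => u θ.1) = u ∘ Prod.fst from rfl, this]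
    simp
  have hφ : ContDiff ℝ 1 fun θ : Param d => u θ.1 := hu.comp contDiff_fst
  -- The speed of the second-layer weight has no factor `a`, so it is bounded uniformly in `θ`; the
  -- a priori bounds follow from this alone.
  have hv : ∀ t, 0 ≤ t → ∀ θ : Param d, |(flowVel σ fstar ξa ξw ρ t θ).1|
      ≤ flowGrowth Kσ Kξ (gaussNorm fstar) ρ t := by
    intro t ht θ
    have hi := integrable_fst hρ ht
    have hr := gaussNorm_resid_le hσ hf hi
    have hK := nonneg_of_isActivation hσ
    simp only [flowVel, vel, flowGrowth, abs_neg, abs_mul]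
    refine mul_le_mul (hξa.bound t ht) ((abs_alpha_le hσ.bound (memLp_resid hσ hf hi) _).trans ?_)
      (abs_nonneg _) ((abs_nonneg _).trans (hξa.bound t ht))
    gcongr
  have hflux : ∀ t, 0 ≤ t → ∀ θ : Param d,
      |fderiv ℝ (fun θ : Param d => u θ.1) θ (flowVel σ fstar ξa ξw ρ t θ)|
        ≤ flowGrowth Kσ Kξ (gaussNorm fstar) ρ t * q θ.1 := by
    intro t ht θ
    rw [hd, abs_mul, mul_comm]
    exact mul_le_mul (hv t ht θ) (huq _) (abs_nonneg _) (htr.nonneg ht)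
  have hev := htr.evolves (T := t) hφ (fun θ => hC θ.1) (C' := C') (fun t ht => ae_of_all _ fun θ =>
    (hflux t ht.1 θ).trans (by
      rw [mul_comm]; exact mul_le_mul_of_nonneg_right (hC' _) (htr.nonneg ht.1)))
  rw [← sub_le_iff_le_add', hev 0 t le_rfl ht le_rfl]
  refine (le_abs_self _).trans ?_
  rw [← Real.norm_eq_abs]
  refine intervalIntegral.norm_integral_le_of_norm_le ht (ae_of_all _ fun r hr => ?_) hint
  have hqi : Integrable (fun θ : Param d => q θ.1) (ρ r : Measure (Param d)) :=
    Integrable.of_bound (hq.comp continuous_fst).aestronglyMeasurable C' (ae_of_all _ fun θ => by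
      rw [Real.norm_eq_abs, abs_of_nonneg ((abs_nonneg _).trans (huq _))]; exact hC' _)
  rw [← integral_const_mul]
  exact norm_integral_le_of_norm_le (hqi.const_mul _) (ae_of_all _ (hflux r hr.1.le))

end Common

/-- A bound for the first moment of the second-layer weights. -/
def momentBound (Kσ Kξ Kρ Q T : ℝ) : ℝ :=
  2 * (1 + Kρ + T * (Kξ * Kσ * Q)) * Real.exp (2 * (Kξ * Kσ ^ 2) * T)

/-- A bound for the growth constant of the velocity field. -/
def growthBound (Kσ Kξ Kρ Q T : ℝ) : ℝ :=
  Kξ * (Kσ * (Kσ * momentBound Kσ Kξ Kρ Q T + Q))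

/-- A bound for the second-layer weights. -/
def radius (Kσ Kξ Kρ Q T : ℝ) : ℝ :=
  1 + Kρ + 2 * growthBound Kσ Kξ Kρ Q T * T + 1

/-! ### Moments and support of the second-layer weights. -/

section Bounds

variable (hKσ : 0 < Kσ) (hKξ : 0 < Kξ) (hKρ : 0 < Kρ) (hσ : IsActivation σ Kσ)
  (hf : MemLp fstar 2 (gauss d)) (hfc : Continuous fstar) (hξa : IsLearningRate ξa Kξ)
  (hξw : IsLearningRate ξw Kξ) (hρ : IsMeanFieldFlow σ fstar ξa ξw ρ)
  (hρ₀ : IsInitialization (ρ 0) Kρ)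

include hKσ hKξ hKρ hσ hf hfc hξa hξw hρ hρ₀

/-- The speed of `a` is at most an affine function of the moment itself, so testing with `|a|`
closes a linear Grönwall inequality. As `|a|` is neither smooth nor bounded, `softAbs N` is used
instead, with derivative bounded by `1` uniformly in `N`, and then `N → ∞`. -/
theorem absMoment_le {T t : ℝ} (ht : t ∈ Icc 0 T) :
    absMoment (ρ t : Measure (Param d)) ≤ momentBound Kσ Kξ Kρ (gaussNorm fstar) T := by
  have hT := ht.1.trans ht.2
  have hQ := gaussNorm_nonneg fstar
  have htr := isTransport_of_isMeanFieldFlow hσ hf hfc hξa hξw hρ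
  have hiM : IntegrableOn (fun t => absMoment (ρ t : Measure (Param d))) (Icc 0 T) :=
    (integrableOn_absMoment hρ (by linarith : 0 < T + 1)).mono_set
      (Icc_subset_Icc_right (by linarith))
  have hiM' : ∀ t ∈ Icc 0 T,
      IntervalIntegrable (fun t => absMoment (ρ t : Measure (Param d))) volume 0 t := fun t ht => by
    rw [intervalIntegrable_iff_integrableOn_Ioc_of_le ht.1]
    exact hiM.mono_set fun r hr => ⟨hr.1.le, hr.2.trans ht.2⟩
  have hmain : ∀ t ∈ Icc 0 T, absMoment (ρ t : Measure (Param d))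
      ≤ (1 + Kρ + T * (Kξ * Kσ * gaussNorm fstar))
        + Kξ * Kσ ^ 2 * ∫ r in (0 : ℝ)..t, absMoment (ρ r : Measure (Param d)) := by
    intro t ht
    have hi := integrable_fst hρ ht.1
    have hlim : Tendsto (fun n : ℕ => ∫ θ, softAbs ((n : ℝ) + 1) θ.1 ∂(ρ t : Measure (Param d)))
        atTop (𝓝 (∫ θ, √(1 + θ.1 ^ 2) ∂(ρ t : Measure (Param d)))) := by
      refine tendsto_integral_of_dominated_convergence (fun θ => 1 + |θ.1|)
        (fun n => ((contDiff_softAbs (by positivity)).continuous.comp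
          continuous_fst).aestronglyMeasurable) ((integrable_const _).add hi.abs)
        (fun n => ae_of_all _ fun θ => ?_) (ae_of_all _ fun θ => tendsto_softAbs _)
      rw [Real.norm_eq_abs, abs_of_nonneg (softAbs_nonneg (by positivity) _)]
      exact softAbs_le_one_add_abs (by positivity) _
    have hg : IntervalIntegrable (fun r => flowGrowth Kσ Kξ (gaussNorm fstar) ρ r
        * ∫ _, (1 : ℝ) ∂(ρ r : Measure (Param d))) volume 0 t := by
      simp only [integral_const, probReal_univ, smul_eq_mul, mul_one]
      exact ((((hiM' t ht).const_mul Kσ).add intervalIntegrable_const).const_mul Kσ).const_mul Kξ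
    have hbound : ∫ θ, √(1 + θ.1 ^ 2) ∂(ρ t : Measure (Param d)) ≤ 1 + Kρ
        + ∫ r in (0 : ℝ)..t, flowGrowth Kσ Kξ (gaussNorm fstar) ρ r := by
      refine le_of_tendsto' hlim fun n => ?_
      have h := abs_integral_sub_le_of_deriv hσ hf hfc hξa hξw hρ
        (contDiff_softAbs (N := (n : ℝ) + 1) (by positivity)) (C := (n : ℝ) + 1) (q := fun _ => 1)
        (C' := 1) (fun a => by
          rw [abs_of_nonneg (softAbs_nonneg (by positivity) _)]
          exact softAbs_le (by positivity) _)
        continuous_const (fun a => abs_deriv_softAbs_le (by positivity) a) (fun a => le_rfl) ht.1 hg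
      refine h.trans (add_le_add ?_ (le_of_eq (by simp)))
      have h0 : ∀ᵐ θ ∂(ρ 0 : Measure (Param d)), softAbs ((n : ℝ) + 1) θ.1 ≤ 1 + Kρ := by
        filter_upwards [ae_abs_le_of_isInitialization hρ₀] with θ hθ
        exact (softAbs_le_one_add_abs (by positivity) _).trans (by linarith)
      refine (integral_mono_ae ?_ (integrable_const _) h0).trans (by simp)
      exact Integrable.of_bound ((contDiff_softAbs (by positivity)).continuous.comp
        continuous_fst).aestronglyMeasurable (1 + Kρ) (by
          filter_upwards [h0] with θ hθ
          rwa [Real.norm_eq_abs, abs_of_nonneg (softAbs_nonneg (by positivity) _)])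
    have hge : absMoment (ρ t : Measure (Param d))
        ≤ ∫ θ, √(1 + θ.1 ^ 2) ∂(ρ t : Measure (Param d)) := by
      refine integral_mono hi.abs ?_ fun θ => abs_le_sqrt_one_add_sq _
      refine ((integrable_const (1 : ℝ)).add hi.abs).mono' (by fun_prop) (ae_of_all _ fun θ => ?_)
      rw [Real.norm_eq_abs, abs_of_nonneg (Real.sqrt_nonneg _)]
      exact sqrt_one_add_sq_le _
    refine (hge.trans hbound).trans ?_
    have e : ∫ r in (0 : ℝ)..t, flowGrowth Kσ Kξ (gaussNorm fstar) ρ r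
        = Kξ * Kσ ^ 2 * (∫ r in (0 : ℝ)..t, absMoment (ρ r : Measure (Param d)))
          + t * (Kξ * Kσ * gaussNorm fstar) := by
      have e1 : flowGrowth Kσ Kξ (gaussNorm fstar) ρ = fun r =>
          Kξ * Kσ ^ 2 * absMoment (ρ r : Measure (Param d)) + Kξ * Kσ * gaussNorm fstar := by
        funext r; simp only [flowGrowth]; ring
      rw [e1, intervalIntegral.integral_add ((hiM' t ht).const_mul _) intervalIntegrable_const,
        intervalIntegral.integral_const_mul, intervalIntegral.integral_const]
      simp
    rw [e]
    have : t * (Kξ * Kσ * gaussNorm fstar) ≤ T * (Kξ * Kσ * gaussNorm fstar) :=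
      mul_le_mul_of_nonneg_right ht.2 (by positivity)
    linarith
  have h := le_of_le_add_mul_integral (T := T) (by positivity)
    (B := (1 + Kρ + T * (Kξ * Kσ * gaussNorm fstar))
        + Kξ * Kσ ^ 2 * ∫ r in (0 : ℝ)..T, absMoment (ρ r : Measure (Param d))) (fun t ht => ?_) hiM
    (fun t _ => absMoment_nonneg _) hmain ht
  · refine h.trans ?_
    unfold momentBound
    gcongr
    exact ht.2
  · refine (hmain t ht).trans ?_
    gcongr
    refine intervalIntegral.integral_mono_interval le_rfl ht.1 ht.2
      (ae_of_all _ fun r => absMoment_nonneg _) (hiM' T ⟨hT, le_rfl⟩)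

theorem flowGrowth_le {T t : ℝ} (ht : t ∈ Icc 0 T) :
    flowGrowth Kσ Kξ (gaussNorm fstar) ρ t ≤ growthBound Kσ Kξ Kρ (gaussNorm fstar) T := by
  have := absMoment_le hKσ hKξ hKρ hσ hf hfc hξa hξw hρ hρ₀ ht
  unfold flowGrowth growthBound
  gcongr

/-- If `|u'| ≤ l u` and `a` moves at speed at most `growthBound`, then `∫ u(a) dρ_t` grows at most
at a rate proportional to `l`. This is meant for exponentials. -/
theorem integral_le_exp_of_deriv_le {u : ℝ → ℝ} {C l c : ℝ} (hl : 0 < l) (hu : ContDiff ℝ 1 u)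
    (hu0 : ∀ a, 0 ≤ u a) (hC : ∀ a, u a ≤ C) (hd : ∀ a, |deriv u a| ≤ l * u a)
    (hc : ∀ a, |a| ≤ Kρ → u a ≤ c) {T t : ℝ} (ht : t ∈ Icc 0 T) :
    ∫ θ, u θ.1 ∂(ρ t : Measure (Param d))
      ≤ 2 * c * Real.exp (2 * (l * growthBound Kσ Kξ Kρ (gaussNorm fstar) T) * t) := by
  have hT := ht.1.trans ht.2
  have htr := isTransport_of_isMeanFieldFlow hσ hf hfc hξa hξw hρ
  have hg0 : 0 < growthBound Kσ Kξ Kρ (gaussNorm fstar) T := by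
    have := gaussNorm_nonneg fstar
    unfold growthBound momentBound
    positivity
  have habs : ∀ a, ‖u a‖ ≤ C := fun a => by
    rw [Real.norm_eq_abs, abs_of_nonneg (hu0 a)]; exact hC a
  have hcont := continuousOn_integral hρ (hu.continuous.comp continuous_fst)
    (fun θ : Param d => habs θ.1)
  have hcontI := hcont.mono (Icc_subset_Ici_self : Icc 0 T ⊆ Ici 0)
  have hii : ∀ t ∈ Icc 0 T, IntervalIntegrable (fun t => ∫ θ, u θ.1 ∂(ρ t : Measure (Param d)))
      volume 0 t := fun t ht =>
    (hcontI.mono (by rw [uIcc_of_le ht.1]; exact Icc_subset_Icc_right ht.2)).intervalIntegrable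
  have hui : ∀ t, Integrable (fun θ => u θ.1) (ρ t : Measure (Param d)) := fun t =>
    Integrable.of_bound (hu.continuous.comp continuous_fst).aestronglyMeasurable C
      (ae_of_all _ fun θ => habs θ.1)
  have hm0 : ∀ t, 0 ≤ ∫ θ, u θ.1 ∂(ρ t : Measure (Param d)) := fun t =>
    integral_nonneg fun θ => hu0 _
  have hmC : ∀ t ∈ Icc 0 T, ∫ θ, u θ.1 ∂(ρ t : Measure (Param d)) ≤ C := fun t _ =>
    (integral_mono (hui t) (integrable_const C) fun θ => hC θ.1).trans (by simp)
  refine le_of_le_add_mul_integral (by positivity) hmC hcontI.integrableOn_Icc (fun t _ => hm0 t)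
    (fun t ht => ?_) ht
  have hfg : IntervalIntegrable (fun r => flowGrowth Kσ Kξ (gaussNorm fstar) ρ r
      * ∫ θ, l * u θ.1 ∂(ρ r : Measure (Param d))) volume 0 t := by
    simp only [integral_const_mul]
    refine IntervalIntegrable.mul_continuousOn ?_ ?_
    · rw [intervalIntegrable_iff_integrableOn_Ioc_of_le ht.1]
      exact (htr.integrableOn (t + 1) (by linarith [ht.1])).mono_set fun r hr =>
        ⟨hr.1.le, by linarith [hr.2]⟩
    · refine (hcontI.mono ?_).const_mul l
      rw [uIcc_of_le ht.1]; exact Icc_subset_Icc_right ht.2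
  have h := abs_integral_sub_le_of_deriv hσ hf hfc hξa hξw hρ hu habs
    (hu.continuous.const_mul l) hd (C' := l * C) (fun a => mul_le_mul_of_nonneg_left (hC a) hl.le)
    ht.1 hfg
  refine h.trans (add_le_add ?_ ?_)
  · have h0 : ∀ᵐ θ ∂(ρ 0 : Measure (Param d)), u θ.1 ≤ c := by
      filter_upwards [ae_abs_le_of_isInitialization hρ₀] with θ hθ using hc _ hθ
    exact (integral_mono_ae (hui 0) (integrable_const c) h0).trans (by simp)
  · rw [← intervalIntegral.integral_const_mul]
    refine intervalIntegral.integral_mono_on ht.1 hfg ((hii t ht).const_mul _) fun r hr => ?_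
    rw [integral_const_mul, mul_left_comm, mul_assoc]
    refine mul_le_mul_of_nonneg_left (mul_le_mul_of_nonneg_right ?_ (hm0 r)) hl.le
    exact flowGrowth_le hKσ hKξ hKρ hσ hf hfc hξa hξw hρ hρ₀ ⟨hr.1, hr.2.trans ht.2⟩

/-- Finite speed of propagation without characteristics. The exponential moment of rate `l` is at
most `2 exp (l R)`, while the integrand is at least `exp (l (R + 1/2))` where `|a| ≥ R + 1`.
Markov's inequality bounds the mass of that set by `2 exp (-l/2)`, and `l → ∞`. -/
theorem ae_abs_le_radius {T t : ℝ} (ht : t ∈ Icc 0 T) :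
    ∀ᵐ θ ∂(ρ t : Measure (Param d)), |θ.1| ≤ radius Kσ Kξ Kρ (gaussNorm fstar) T := by
  have hT := ht.1.trans ht.2
  have hg0 : 0 < growthBound Kσ Kξ Kρ (gaussNorm fstar) T := by
    have := gaussNorm_nonneg fstar
    unfold growthBound momentBound
    positivity
  set g := growthBound Kσ Kξ Kρ (gaussNorm fstar) T with hg
  set R := 1 + Kρ + 2 * g * T with hR
  have hR0 : 0 ≤ R := by positivity
  set N := 2 * (R + 1) ^ 2 with hN
  have hN0 : 0 < N := by positivity
  have hcs := contDiff_softAbs hN0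
  -- `R` collects the initial bound `1 + Kρ` for `softAbs` and the growth `2 g T` of the exponent
  -- per unit of `l`; the prefactor `2` does not depend on `l`.
  have hexp : ∀ l, 0 < l → ∫ θ, Real.exp (l * softAbs N θ.1) ∂(ρ t : Measure (Param d))
      ≤ 2 * Real.exp (l * R) := by
    intro l hl
    have hder : ∀ a, deriv (fun a => Real.exp (l * softAbs N a)) a
        = Real.exp (l * softAbs N a) * (l * deriv (softAbs N) a) := fun a =>
      ((hcs.differentiable one_ne_zero a).hasDerivAt.const_mul l).exp.deriv
    have h := integral_le_exp_of_deriv_le hKσ hKξ hKρ hσ hf hfc hξa hξw hρ hρ₀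
      (u := fun a => Real.exp (l * softAbs N a)) (C := Real.exp (l * N))
      (c := Real.exp (l * (1 + Kρ))) hl (contDiff_const.mul hcs).exp (fun a => (Real.exp_pos _).le)
      (fun a => Real.exp_le_exp.2 (mul_le_mul_of_nonneg_left (softAbs_le hN0 a) hl.le))
      (fun a => ?_) (fun a ha => Real.exp_le_exp.2 (mul_le_mul_of_nonneg_left
        ((softAbs_le_one_add_abs hN0 a).trans (by linarith)) hl.le)) ht
    · refine h.trans ?_
      rw [mul_assoc, ← Real.exp_add]
      refine mul_le_mul_of_nonneg_left (Real.exp_le_exp.2 ?_) zero_le_two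
      have : l * g * t ≤ l * g * T := mul_le_mul_of_nonneg_left ht.2 (by positivity)
      rw [hR]
      linarith
    · rw [hder, abs_mul, abs_mul, Real.abs_exp, abs_of_pos hl, mul_comm]
      refine mul_le_mul_of_nonneg_right ?_ (Real.exp_pos _).le
      exact mul_le_of_le_one_right hl.le (abs_deriv_softAbs_le hN0 a)
  have hmeas : ∀ l, 0 < l → (ρ t : Measure (Param d)).real {θ | R + 1 ≤ |θ.1|}
      ≤ 2 * Real.exp (-(l / 2)) := by
    intro l hl
    have hi : Integrable (fun θ => Real.exp (l * softAbs N θ.1)) (ρ t : Measure (Param d)) := by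
      refine Integrable.of_bound (((contDiff_const.mul hcs).exp.continuous).comp
        continuous_fst).aestronglyMeasurable (Real.exp (l * N)) (ae_of_all _ fun θ => ?_)
      rw [Real.norm_eq_abs, Real.abs_exp]
      exact Real.exp_le_exp.2 (mul_le_mul_of_nonneg_left (softAbs_le hN0 _) hl.le)
    have h1 := mul_meas_ge_le_integral_of_nonneg (ae_of_all _ fun θ => (Real.exp_pos _).le) hi
      (Real.exp (l * (R + 1 / 2)))
    have h2 : (ρ t : Measure (Param d)).real {θ | R + 1 ≤ |θ.1|} ≤ (ρ t : Measure (Param d)).real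
        {θ | Real.exp (l * (R + 1 / 2)) ≤ Real.exp (l * softAbs N θ.1)} := by
      refine measureReal_mono fun θ hθ => ?_
      exact Real.exp_le_exp.2 (mul_le_mul_of_nonneg_left (le_softAbs hN0 hR0 le_rfl hθ) hl.le)
    have h3 := (mul_le_mul_of_nonneg_left h2 (Real.exp_pos (l * (R + 1 / 2))).le).trans
      (h1.trans (hexp l hl))
    have e : Real.exp (l * R) = Real.exp (l * (R + 1 / 2)) * Real.exp (-(l / 2)) := by
      rw [← Real.exp_add]; congr 1; ring
    rw [e, mul_left_comm] at h3
    exact le_of_mul_le_mul_left h3 (Real.exp_pos _)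
  have hz : (ρ t : Measure (Param d)).real {θ | R + 1 ≤ |θ.1|} ≤ 0 := by
    have hlim : Tendsto (fun l : ℝ => 2 * Real.exp (-(l / 2))) atTop (𝓝 (2 * 0)) :=
      (Real.tendsto_exp_neg_atTop_nhds_zero.comp
        (tendsto_id.atTop_div_const two_pos)).const_mul 2
    rw [mul_zero] at hlim
    exact ge_of_tendsto hlim ((eventually_gt_atTop 0).mono hmeas)
  have hz' : (ρ t : Measure (Param d)) {θ | R + 1 ≤ |θ.1|} = 0 :=
    (measureReal_eq_zero_iff).1 (le_antisymm hz measureReal_nonneg)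
  refine measure_mono_null (fun θ hθ => ?_) hz'
  exact (not_le.1 (show ¬|θ.1| ≤ R + 1 from hθ)).le

end Bounds

end MeanFieldStability

namespace MeanFieldStability

/-! ### Euler approximation of solutions of the continuity equation -/

section Euler

open Filter Topology

set_option linter.unusedSectionVars false

variable {X : Type*} [NormedAddCommGroup X] [NormedSpace ℝ X]

/-- A `C^{1,1}` map with bounds `A` for the derivative and `B` for its Lipschitz constant. -/
structure IsC11 {Y : Type*} [NormedAddCommGroup Y] [NormedSpace ℝ Y] (φ : X → Y) (A B : ℝ) :
    Prop where
  differentiable : Differentiable ℝ φ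
  norm_fderiv_le : ∀ x, ‖fderiv ℝ φ x‖ ≤ A
  norm_fderiv_sub_le : ∀ x y, ‖fderiv ℝ φ x - fderiv ℝ φ y‖ ≤ B * ‖x - y‖

/-- One step of the Euler scheme. -/
def eulerStep (h : ℝ) (v : X → X) (x : X) : X := x + h • v x

section IsC11

variable {Y : Type*} [NormedAddCommGroup Y] [NormedSpace ℝ Y] {φ : X → Y} {A B : ℝ}

theorem IsC11.nonneg_left (hφ : IsC11 φ A B) : 0 ≤ A :=
  (norm_nonneg _).trans (hφ.norm_fderiv_le 0)

theorem IsC11.contDiff (hφ : IsC11 φ A B) : ContDiff ℝ 1 φ := by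
  rw [contDiff_one_iff_fderiv]
  refine ⟨hφ.differentiable, ?_⟩
  have : LipschitzWith (Real.toNNReal B) (fderiv ℝ φ) := LipschitzWith.of_dist_le' fun x y => by
    simpa [dist_eq_norm] using hφ.norm_fderiv_sub_le x y
  exact this.continuous

theorem IsC11.norm_sub_le (hφ : IsC11 φ A B) (x y : X) : ‖φ x - φ y‖ ≤ A * ‖x - y‖ :=
  convex_univ.norm_image_sub_le_of_norm_fderiv_le (𝕜 := ℝ) (fun z _ => hφ.differentiable z)
    (fun z _ => hφ.norm_fderiv_le z) (mem_univ y) (mem_univ x)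

theorem IsC11.norm_taylor_le (hφ : IsC11 φ A B) (hB : 0 ≤ B) (x v : X) :
    ‖φ (x + v) - φ x - fderiv ℝ φ x v‖ ≤ B * ‖v‖ * ‖v‖ := by
  have h := (convex_closedBall x ‖v‖).norm_image_sub_le_of_norm_hasFDerivWithin_le'
    (f := φ) (f' := fderiv ℝ φ) (φ := fderiv ℝ φ x) (C := B * ‖v‖) (x := x) (y := x + v)
    (fun z _ => (hφ.differentiable z).hasFDerivAt.hasFDerivWithinAt) (fun z hz => ?_)
    (by simp) (by simp)
  · simpa using h
  · refine (hφ.norm_fderiv_sub_le z x).trans ?_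
    rw [mem_closedBall_iff_norm] at hz
    gcongr

variable {v : X → X} {h L L₂ b : ℝ}

theorem hasFDerivAt_eulerStep (hv : IsC11 v L L₂) (x : X) :
    HasFDerivAt (eulerStep h v) (ContinuousLinearMap.id ℝ X + h • fderiv ℝ v x) x :=
  (hasFDerivAt_id x).add ((hv.differentiable x).hasFDerivAt.const_smul h)

theorem norm_id_add_le (hh : 0 ≤ h) (hv : IsC11 v L L₂) (x : X) :
    ‖ContinuousLinearMap.id ℝ X + h • fderiv ℝ v x‖ ≤ 1 + h * L := by
  refine (norm_add_le _ _).trans (add_le_add ContinuousLinearMap.norm_id_le ?_)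
  rw [norm_smul, Real.norm_of_nonneg hh]
  exact mul_le_mul_of_nonneg_left (hv.norm_fderiv_le x) hh

theorem norm_eulerStep_sub_le (hh : 0 ≤ h) (hv : IsC11 v L L₂) (x y : X) :
    ‖eulerStep h v x - eulerStep h v y‖ ≤ (1 + h * L) * ‖x - y‖ := by
  have e : eulerStep h v x - eulerStep h v y = (x - y) + h • (v x - v y) := by
    simp only [eulerStep, smul_sub]; abel
  rw [e]
  refine (norm_add_le _ _).trans ?_
  rw [norm_smul, Real.norm_of_nonneg hh]
  have := mul_le_mul_of_nonneg_left (hv.norm_sub_le x y) hh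
  linarith

theorem fderiv_comp_eulerStep (hφ : IsC11 φ A B) (hv : IsC11 v L L₂) (x : X) :
    fderiv ℝ (fun x => φ (eulerStep h v x)) x
      = (fderiv ℝ φ (eulerStep h v x)).comp (ContinuousLinearMap.id ℝ X + h • fderiv ℝ v x) :=
  ((hφ.differentiable _).hasFDerivAt.comp x (hasFDerivAt_eulerStep hv x)).fderiv

/-- Pulling back by one step multiplies the first-order bound by `1 + h L` only. The second-order
constant `L₂` of the field affects only the second-order bound of the result; hence the Lipschitz
constant of a test function stays dimension-free. -/
theorem IsC11.comp_eulerStep (hφ : IsC11 φ A B) (hB : 0 ≤ B) (hh : 0 ≤ h) (hv : IsC11 v L L₂) :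
    IsC11 (fun x => φ (eulerStep h v x)) (A * (1 + h * L))
      (B * (1 + h * L) ^ 2 + A * (h * L₂)) := by
  have hA := hφ.nonneg_left
  have hL := hv.nonneg_left
  refine ⟨fun x => ((hφ.differentiable _).hasFDerivAt.comp x
    (hasFDerivAt_eulerStep hv x)).differentiableAt, fun x => ?_, fun x y => ?_⟩
  · rw [fderiv_comp_eulerStep hφ hv]
    exact (ContinuousLinearMap.opNorm_comp_le _ _).trans
      (mul_le_mul (hφ.norm_fderiv_le _) (norm_id_add_le hh hv x) (norm_nonneg _) hA)
  · rw [fderiv_comp_eulerStep hφ hv, fderiv_comp_eulerStep hφ hv]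
    set P := fderiv ℝ φ (eulerStep h v x)
    set Q := fderiv ℝ φ (eulerStep h v y)
    have e : P.comp (ContinuousLinearMap.id ℝ X + h • fderiv ℝ v x)
        - Q.comp (ContinuousLinearMap.id ℝ X + h • fderiv ℝ v y)
        = (P - Q).comp (ContinuousLinearMap.id ℝ X + h • fderiv ℝ v x)
          + Q.comp (h • (fderiv ℝ v x - fderiv ℝ v y)) := by
      ext z
      simp [smul_sub]
      abel
    rw [e]
    refine (norm_add_le _ _).trans ?_
    have h1 : ‖P - Q‖ ≤ B * ((1 + h * L) * ‖x - y‖) :=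
      (hφ.norm_fderiv_sub_le _ _).trans
        (mul_le_mul_of_nonneg_left (norm_eulerStep_sub_le hh hv x y) hB)
    have h2 := (ContinuousLinearMap.opNorm_comp_le (P - Q)
      (ContinuousLinearMap.id ℝ X + h • fderiv ℝ v x)).trans
      (mul_le_mul h1 (norm_id_add_le hh hv x) (norm_nonneg _) (by positivity))
    have h3 : ‖h • (fderiv ℝ v x - fderiv ℝ v y)‖ ≤ h * (L₂ * ‖x - y‖) := by
      rw [norm_smul, Real.norm_of_nonneg hh]
      exact mul_le_mul_of_nonneg_left (hv.norm_fderiv_sub_le x y) hh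
    have h4 := (ContinuousLinearMap.opNorm_comp_le Q _).trans
      (mul_le_mul (hφ.norm_fderiv_le _) h3 (norm_nonneg _) hA)
    linarith

end IsC11

variable [FiniteDimensional ℝ X] [MeasurableSpace X] [BorelSpace X]
  {μ : ℝ → Measure X} {V : ℝ → X → X} {m : ℝ → ℝ} {T : ℝ}

/-- Smooth fields `w t` that approximate the velocity field of a solution of the continuity
equation on `[0, T]`, up to an error `ε`. -/
structure IsApproxField (μ : ℝ → Measure X) (V w : ℝ → X → X) (T ε b L L₂ Λ : ℝ) : Prop where
  isC11 : ∀ t ∈ Icc 0 T, IsC11 (w t) L L₂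
  norm_le : ∀ t ∈ Icc 0 T, ∀ x, ‖w t x‖ ≤ b
  norm_sub_le : ∀ s ∈ Icc 0 T, ∀ t ∈ Icc 0 T, ∀ x, ‖w t x - w s x‖ ≤ Λ * |t - s|
  norm_vel_le : ∀ t ∈ Icc 0 T, ∀ᵐ x ∂μ t, ‖V t x‖ ≤ b
  norm_vel_sub_le : ∀ t ∈ Icc 0 T, ∀ᵐ x ∂μ t, ‖V t x - w t x‖ ≤ ε

variable {w : ℝ → X → X} {ε b L L₂ Λ A B C : ℝ} {φ : X → ℝ}

/-- The local error of the Euler scheme. -/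
def localError (A B ε b L Λ h : ℝ) : ℝ :=
  A * ε + h * (A * Λ + B * b * b + (B * b + A * L) * b)

theorem abs_integral_sub_le_of_evolves [∀ t, IsProbabilityMeasure (μ t)] {ψ : X → ℝ} {D : ℝ}
    (hD : 0 ≤ D) (hψ : Evolves μ V T ψ) (hd : ∀ x, ‖fderiv ℝ ψ x‖ ≤ D)
    (hV : ∀ t ∈ Icc 0 T, ∀ᵐ x ∂μ t, ‖V t x‖ ≤ b) {s t : ℝ} (hs : 0 ≤ s) (hst : s ≤ t) (ht : t ≤ T) :
    |(∫ x, ψ x ∂μ t) - ∫ x, ψ x ∂μ s| ≤ D * b * (t - s) := by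
  rw [hψ s t hs hst ht, ← abs_of_nonneg (sub_nonneg.2 hst), ← Real.norm_eq_abs]
  refine intervalIntegral.norm_integral_le_of_norm_le_const fun r hr => ?_
  rw [uIoc_of_le hst] at hr
  have h : ∀ᵐ x ∂μ r, ‖fderiv ℝ ψ x (V r x)‖ ≤ D * b := by
    filter_upwards [hV r ⟨hs.trans hr.1.le, hr.2.trans ht⟩] with x hx
    exact ((fderiv ℝ ψ x).le_opNorm _).trans (mul_le_mul (hd x) hx (norm_nonneg _) hD)
  simpa using norm_integral_le_of_norm_le_const h

/-- The increment `ψ` of the test function over one step has derivative of order `h`. By the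
equation, the error is the integral over the step of the flux of `φ` at time `r` minus `h⁻¹ ∫ ψ
dμ_s`. The flux equals `h⁻¹ ∫ ψ dμ_r` up to `A ε` for the field, `A Λ h` for freezing time and `B b²
h` for Taylor's formula. Replacing `μ_r` by `μ_s` costs another `O(h)`, by the equation tested with
`ψ` itself. -/
theorem abs_integral_sub_eulerStep_le (htr : IsTransport μ V m)
    (hev : ∀ ψ : X → ℝ, ∀ A C, ContDiff ℝ 1 ψ → (∀ x, |ψ x| ≤ C) → (∀ x, ‖fderiv ℝ ψ x‖ ≤ A) →
      Evolves μ V T ψ)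
    (hw : IsApproxField μ V w T ε b L L₂ Λ) (hφ : IsC11 φ A B) (hB : 0 ≤ B) (hC : ∀ x, |φ x| ≤ C)
    {s h : ℝ} (hs : 0 ≤ s) (hh : 0 < h) (ht : s + h ≤ T) :
    |(∫ x, φ x ∂μ (s + h)) - ∫ x, φ (eulerStep h (w s) x) ∂μ s|
      ≤ h * localError A B ε b L Λ h := by
  have hp := htr.isProbabilityMeasure
  have hsI : s ∈ Icc 0 T := ⟨hs, by linarith⟩
  have hv := hw.isC11 s hsI
  have hA := hφ.nonneg_left
  have hL := hv.nonneg_left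
  have hb : 0 ≤ b := (norm_nonneg _).trans (hw.norm_le s hsI 0)
  set ψ : X → ℝ := fun x => φ (eulerStep h (w s) x) - φ x with hψ
  have hφE := hφ.comp_eulerStep hB hh.le hv
  have hψd : ∀ x, ‖fderiv ℝ ψ x‖ ≤ h * (B * b + A * L) := by
    intro x
    have e : fderiv ℝ ψ x = (fderiv ℝ φ (eulerStep h (w s) x) - fderiv ℝ φ x)
        + (fderiv ℝ φ (eulerStep h (w s) x)).comp (h • fderiv ℝ (w s) x) := by
      rw [hψ, fderiv_fun_sub (hφE.differentiable x) (hφ.differentiable x),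
        fderiv_comp_eulerStep hφ hv]
      ext z
      simp
      ring
    rw [e]
    refine (norm_add_le _ _).trans ?_
    have h1 : ‖eulerStep h (w s) x - x‖ ≤ h * b := by
      rw [eulerStep, add_sub_cancel_left, norm_smul, Real.norm_of_nonneg hh.le]
      exact mul_le_mul_of_nonneg_left (hw.norm_le s hsI x) hh.le
    have h2 := (hφ.norm_fderiv_sub_le (eulerStep h (w s) x) x).trans
      (mul_le_mul_of_nonneg_left h1 hB)
    have h3 : ‖h • fderiv ℝ (w s) x‖ ≤ h * L := by
      rw [norm_smul, Real.norm_of_nonneg hh.le]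
      exact mul_le_mul_of_nonneg_left (hv.norm_fderiv_le x) hh.le
    have h4 := (ContinuousLinearMap.opNorm_comp_le (fderiv ℝ φ (eulerStep h (w s) x)) _).trans
      (mul_le_mul (hφ.norm_fderiv_le _) h3 (norm_nonneg _) hA)
    linarith
  have hψc : ContDiff ℝ 1 ψ := hφE.contDiff.sub hφ.contDiff
  have hψC : ∀ x, |ψ x| ≤ C + C := fun x => (abs_sub _ _).trans (add_le_add (hC _) (hC _))
  have hψev := hev ψ _ _ hψc hψC hψd
  have hφev := hev φ _ _ hφ.contDiff hC hφ.norm_fderiv_le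
  have hint : ∀ (f : X → ℝ) (C : ℝ), Continuous f → (∀ x, |f x| ≤ C) → ∀ t, Integrable f (μ t) :=
    fun f C hf hC t => Integrable.of_bound hf.aestronglyMeasurable C (ae_of_all _ hC)
  have hflux : ∀ r ∈ Icc 0 T, ∀ᵐ x ∂μ r, ‖fderiv ℝ φ x (V r x)‖ ≤ A * b := by
    intro r hr
    filter_upwards [hw.norm_vel_le r hr] with x hx
    exact ((fderiv ℝ φ x).le_opNorm _).trans
      (mul_le_mul (hφ.norm_fderiv_le x) hx (norm_nonneg _) hA)
  have hdc := hφ.contDiff.continuous_fderiv one_ne_zero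
  have hD : IntervalIntegrable (fun r => ∫ x, fderiv ℝ φ x (V r x) ∂μ r) volume s (s + h) := by
    rw [intervalIntegrable_iff_integrableOn_Ioc_of_le (by linarith)]
    refine Integrable.of_bound ((htr.measurable_flux _ hdc).mono_measure
      (Measure.restrict_mono (fun r hr => hs.trans hr.1.le) le_rfl)) (A * b) ?_
    filter_upwards [ae_restrict_mem measurableSet_Ioc] with r hr
    simpa using norm_integral_le_of_norm_le_const
      (hflux r ⟨hs.trans hr.1.le, hr.2.trans ht⟩)
  -- The mean rate of change over the step predicted by the Euler map.
  set c : ℝ := h⁻¹ * ∫ x, ψ x ∂μ s with hc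
  have key : ∀ r ∈ Ioc s (s + h), |(∫ x, fderiv ℝ φ x (V r x) ∂μ r) - c|
      ≤ localError A B ε b L Λ h := by
    intro r hr
    have hrI : r ∈ Icc 0 T := ⟨hs.trans hr.1.le, hr.2.trans ht⟩
    have h1 := abs_integral_sub_le_of_evolves (by positivity) hψev hψd hw.norm_vel_le hs hr.1.le
      hrI.2
    have h2 : |(∫ x, fderiv ℝ φ x (V r x) ∂μ r) - h⁻¹ * ∫ x, ψ x ∂μ r|
        ≤ A * ε + A * (Λ * h) + h * (B * b * b) := by
      have hi1 : Integrable (fun x => fderiv ℝ φ x (V r x)) (μ r) :=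
        Integrable.of_bound (hdc.clm_apply (htr.continuous_vel r hrI.1)).aestronglyMeasurable _
          (hflux r hrI)
      rw [← integral_const_mul, ← integral_sub hi1 ((hint ψ _ hψc.continuous hψC r).const_mul _),
        ← Real.norm_eq_abs]
      have : ∀ᵐ x ∂μ r, ‖fderiv ℝ φ x (V r x) - h⁻¹ * ψ x‖
          ≤ A * ε + A * (Λ * h) + h * (B * b * b) := by
        filter_upwards [hw.norm_vel_sub_le r hrI] with x hx
        have e : fderiv ℝ φ x (V r x) - h⁻¹ * ψ x = fderiv ℝ φ x (V r x - w r x)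
            + fderiv ℝ φ x (w r x - w s x)
            - h⁻¹ * (φ (x + h • w s x) - φ x - fderiv ℝ φ x (h • w s x)) := by
          simp only [hψ, eulerStep, map_sub, map_smul, smul_eq_mul]
          field_simp
          ring
        have b1 := ((fderiv ℝ φ x).le_opNorm (V r x - w r x)).trans
          (mul_le_mul (hφ.norm_fderiv_le x) hx (norm_nonneg _) hA)
        have hΛ : 0 ≤ Λ * |r - s| := (norm_nonneg _).trans (hw.norm_sub_le s hsI r hrI 0)
        have hrs : |r - s| = r - s := abs_of_pos (by linarith [hr.1])
        have hΛ0 : 0 ≤ Λ := by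
          rw [hrs] at hΛ
          exact nonneg_of_mul_nonneg_left hΛ (by linarith [hr.1])
        have b2 := ((fderiv ℝ φ x).le_opNorm (w r x - w s x)).trans
          (mul_le_mul (hφ.norm_fderiv_le x) ((hw.norm_sub_le s hsI r hrI x).trans
            (mul_le_mul_of_nonneg_left (by rw [hrs]; linarith [hr.2] : |r - s| ≤ h) hΛ0))
            (norm_nonneg _) hA)
        have hn : ‖h • w s x‖ ≤ h * b := by
          rw [norm_smul, Real.norm_of_nonneg hh.le]
          exact mul_le_mul_of_nonneg_left (hw.norm_le s hsI x) hh.le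
        have b3 : ‖φ (x + h • w s x) - φ x - fderiv ℝ φ x (h • w s x)‖ ≤ B * (h * b) * (h * b) :=
          (hφ.norm_taylor_le hB x _).trans (by gcongr)
        rw [e]
        refine (norm_sub_le _ _).trans (add_le_add ((norm_add_le _ _).trans (add_le_add b1 b2)) ?_)
        rw [norm_mul, norm_inv, Real.norm_of_nonneg hh.le, inv_mul_le_iff₀ hh]
        refine b3.trans (le_of_eq (by ring))
      simpa using norm_integral_le_of_norm_le_const this
    have e : (∫ x, fderiv ℝ φ x (V r x) ∂μ r) - c
        = ((∫ x, fderiv ℝ φ x (V r x) ∂μ r) - h⁻¹ * ∫ x, ψ x ∂μ r)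
          + h⁻¹ * ((∫ x, ψ x ∂μ r) - ∫ x, ψ x ∂μ s) := by rw [hc]; ring
    rw [e]
    refine (abs_add_le _ _).trans ((add_le_add h2 ?_).trans
      (le_of_eq (by unfold localError; ring :
        _ + h * ((B * b + A * L) * b) = localError A B ε b L Λ h)))
    rw [abs_mul, abs_of_pos (inv_pos.2 hh), inv_mul_le_iff₀ hh]
    refine h1.trans ?_
    have : h * (B * b + A * L) * b * (r - s) ≤ h * (B * b + A * L) * b * h :=
      mul_le_mul_of_nonneg_left (by linarith [hr.2]) (by positivity)
    linarith
  have hfin : (∫ x, φ x ∂μ (s + h)) - ∫ x, φ (eulerStep h (w s) x) ∂μ s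
      = ∫ r in s..(s + h), ((∫ x, fderiv ℝ φ x (V r x) ∂μ r) - c) := by
    rw [intervalIntegral.integral_sub hD intervalIntegrable_const, intervalIntegral.integral_const,
      ← hφev s (s + h) hs (by linarith) ht, add_sub_cancel_left, smul_eq_mul, hc,
      mul_inv_cancel_left₀ hh.ne', hψ, integral_sub (hint _ C hφE.contDiff.continuous
        (fun x => hC _) s) (hint _ C hφ.contDiff.continuous hC s)]
    ring
  rw [hfin, ← Real.norm_eq_abs, mul_comm]
  have hfin2 := intervalIntegral.norm_integral_le_of_norm_le_const (a := s) (b := s + h)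
    (f := fun r => (∫ x, fderiv ℝ φ x (V r x) ∂μ r) - c) (C := localError A B ε b L Λ h)
    fun r hr => key r (by rwa [uIoc_of_le (by linarith)] at hr)
  rwa [add_sub_cancel_left, abs_of_pos hh] at hfin2

/-- The Euler scheme with step size `h` for the fields `w t`. -/
def eulerScheme (w : ℝ → X → X) (h : ℝ) : ℕ → X → X
  | 0 => id
  | k + 1 => fun x => eulerStep h (w (k * h)) (eulerScheme w h k x)

/-- The latest step is outermost in `eulerScheme`, so it is peeled off first and absorbed into the
test function; therefore the induction runs over all `φ`, `A`, `B`. The constants `A'`, `B'`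
dominate those of every pullback that occurs. -/
theorem abs_integral_sub_eulerScheme_le (htr : IsTransport μ V m)
    (hev : ∀ ψ : X → ℝ, ∀ A C, ContDiff ℝ 1 ψ → (∀ x, |ψ x| ≤ C) → (∀ x, ‖fderiv ℝ ψ x‖ ≤ A) →
      Evolves μ V T ψ)
    (hw : IsApproxField μ V w T ε b L L₂ Λ) (hL₂ : 0 ≤ L₂) (hε : 0 ≤ ε) (hΛ : 0 ≤ Λ) {h A' B' : ℝ}
    (hh : 0 < h) (k : ℕ) (hk : k * h ≤ T) (hφ : IsC11 φ A B) (hB : 0 ≤ B) (hC : ∀ x, |φ x| ≤ C)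
    (hA' : A * Real.exp (L * (k * h)) ≤ A')
    (hB' : (B + A' * L₂ * (k * h)) * Real.exp (2 * L * (k * h)) ≤ B') :
    |(∫ x, φ x ∂μ (k * h)) - ∫ x, φ (eulerScheme w h k x) ∂μ 0|
      ≤ k * (h * localError A' B' ε b L Λ h) := by
  induction k generalizing φ A B with
  | zero => simp [eulerScheme]
  | succ k ih =>
    have hkh : 0 ≤ (k : ℝ) * h := by positivity
    have e0 : ((k + 1 : ℕ) : ℝ) * h = k * h + h := by push_cast; ring
    rw [e0] at hA' hB' hk ⊢
    have hI : (k : ℝ) * h ∈ Icc 0 T := ⟨hkh, by linarith⟩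
    have hv := hw.isC11 _ hI
    have hL := hv.nonneg_left
    have hA := hφ.nonneg_left
    have hb : 0 ≤ b := (norm_nonneg _).trans (hw.norm_le _ hI 0)
    have hexp1 : 1 + h * L ≤ Real.exp (L * h) := by
      have := Real.add_one_le_exp (L * h); linarith
    have hexp2 : (1 + h * L) ^ 2 ≤ Real.exp (2 * L * h) := by
      calc (1 + h * L) ^ 2 ≤ Real.exp (L * h) ^ 2 := by gcongr
        _ = _ := by rw [← Real.exp_nat_mul]; congr 1; push_cast; ring
    have hAA' : A ≤ A' := (le_mul_of_one_le_right hA (Real.one_le_exp (by positivity))).trans hA'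
    have hA'0 := hA.trans hAA'
    have hBB' : B ≤ B' := by
      refine le_trans ?_ hB'
      have : B ≤ B + A' * L₂ * (k * h + h) := le_add_of_nonneg_right (by positivity)
      exact this.trans (le_mul_of_one_le_right (by positivity) (Real.one_le_exp (by positivity)))
    have h1 := abs_integral_sub_eulerStep_le htr hev hw hφ hB hC hkh hh hk
    have h2 := ih (by linarith) (hφ.comp_eulerStep hB hh.le hv)
      (by have := hφ.nonneg_left; positivity) (fun x => hC _) ?_ ?_
    · have h3 : localError A B ε b L Λ h ≤ localError A' B' ε b L Λ h := by
        unfold localError; gcongr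
      have h4 := mul_le_mul_of_nonneg_left h3 hh.le
      have e1 : ∀ x, eulerScheme w h (k + 1) x = eulerStep h (w (k * h)) (eulerScheme w h k x) :=
        fun x => rfl
      simp only [e1]
      have h5 := abs_sub_le (∫ x, φ x ∂μ (k * h + h))
        (∫ x, φ (eulerStep h (w (k * h)) x) ∂μ (k * h))
        (∫ x, φ (eulerStep h (w (k * h)) (eulerScheme w h k x)) ∂μ 0)
      push_cast
      linarith
    · refine le_trans ?_ hA'
      calc A * (1 + h * L) * Real.exp (L * (k * h))
          ≤ A * Real.exp (L * h) * Real.exp (L * (k * h)) := by gcongr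
        _ = A * Real.exp (L * (k * h + h)) := by rw [mul_add L, Real.exp_add]; ring
    · refine le_trans ?_ hB'
      have e2 : (B + A' * L₂ * (k * h + h)) * Real.exp (2 * L * (k * h + h))
          = (B + A' * L₂ * (k * h + h)) * Real.exp (2 * L * h) * Real.exp (2 * L * (k * h)) := by
        rw [mul_add (2 * L), Real.exp_add]; ring
      rw [e2]
      refine mul_le_mul_of_nonneg_right ?_ (Real.exp_pos _).le
      have h6 : 1 ≤ Real.exp (2 * L * h) := Real.one_le_exp (by positivity)
      calc B * (1 + h * L) ^ 2 + A * (h * L₂) + A' * L₂ * (k * h)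
          ≤ B * Real.exp (2 * L * h) + A' * (h * L₂) + A' * L₂ * (k * h) := by gcongr
        _ = B * Real.exp (2 * L * h) + A' * L₂ * (k * h + h) := by ring
        _ ≤ B * Real.exp (2 * L * h) + A' * L₂ * (k * h + h) * Real.exp (2 * L * h) := by
            have : 0 ≤ A' * L₂ * (k * h + h) := by positivity
            exact add_le_add le_rfl (le_mul_of_one_le_right this h6)
        _ = _ := by ring

theorem continuous_eulerScheme {h : ℝ} (hh : 0 ≤ h) (hw : ∀ t ∈ Icc 0 T, IsC11 (w t) L L₂) (k : ℕ)
    (hk : k * h ≤ T) : Continuous (eulerScheme w h k) := by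
  induction k with
  | zero => exact continuous_id
  | succ k ih =>
    push_cast at hk
    have hk' : (k : ℝ) * h ≤ T := by linarith
    have h1 := ih hk'
    have h2 := (hw (k * h) ⟨by positivity, hk'⟩).differentiable.continuous
    change Continuous fun x => eulerScheme w h k x + h • w (k * h) (eulerScheme w h k x)
    fun_prop

/-- Discrete Grönwall. The perturbation `h U exp (λ k h)` of one step fits into the claim because
`exp (λ k h) / λ + h exp (λ k h) ≤ exp (λ (k + 1) h) / λ`. The factor `1 / λ` later makes the
estimate contractive. -/
theorem norm_eulerScheme_sub_le {w' : ℝ → X → X} {h lam U : ℝ} (hh : 0 ≤ h)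
    (hw : ∀ t ∈ Icc 0 T, IsC11 (w t) L L₂) (hlam : 0 < lam) (hU : 0 ≤ U)
    (hww : ∀ t ∈ Icc 0 T, ∀ x, ‖w t x - w' t x‖ ≤ U * Real.exp (lam * t)) (k : ℕ)
    (hk : k * h ≤ T) (x x' : X) :
    ‖eulerScheme w h k x - eulerScheme w' h k x'‖
      ≤ Real.exp (L * (k * h)) * (‖x - x'‖ + U * Real.exp (lam * (k * h)) / lam) := by
  induction k with
  | zero => simp [eulerScheme]; positivity
  | succ k ih =>
    push_cast at hk
    have hkT : (k : ℝ) * h ≤ T := by linarith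
    have hI : (k : ℝ) * h ∈ Icc 0 T := ⟨by positivity, hkT⟩
    have hv := hw _ hI
    have hL := hv.nonneg_left
    set y := eulerScheme w h k x
    set y' := eulerScheme w' h k x'
    have e : eulerScheme w h (k + 1) x - eulerScheme w' h (k + 1) x'
        = (eulerStep h (w (k * h)) y - eulerStep h (w (k * h)) y')
          + h • (w (k * h) y' - w' (k * h) y') := by
      change eulerStep h (w (k * h)) y - eulerStep h (w' (k * h)) y' = _
      simp only [eulerStep, smul_sub]; abel
    have e0 : ((k + 1 : ℕ) : ℝ) * h = k * h + h := by push_cast; ring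
    rw [e, e0]
    set E := U * Real.exp (lam * (k * h)) with hE
    have hE0 : 0 ≤ E := by positivity
    have h1 := norm_eulerStep_sub_le hh hv y y'
    have h2 : ‖h • (w (k * h) y' - w' (k * h) y')‖ ≤ h * E := by
      rw [norm_smul, Real.norm_of_nonneg hh]
      exact mul_le_mul_of_nonneg_left (hww _ hI _) hh
    have hexp1 : 1 + h * L ≤ Real.exp (L * h) := by
      have := Real.add_one_le_exp (L * h); linarith
    have hexp2 : 1 + lam * h ≤ Real.exp (lam * h) := by
      have := Real.add_one_le_exp (lam * h); linarith
    have hge : 1 ≤ Real.exp (L * (k * h + h)) := Real.one_le_exp (by have := hI.1; positivity)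
    calc _ ≤ (1 + h * L) * ‖y - y'‖ + h * E := (norm_add_le _ _).trans (add_le_add h1 h2)
      _ ≤ Real.exp (L * h) * (Real.exp (L * (k * h)) * (‖x - x'‖ + E / lam))
          + Real.exp (L * (k * h + h)) * (h * E) := by
          refine add_le_add (mul_le_mul hexp1 (ih hkT) (norm_nonneg _) (Real.exp_pos _).le) ?_
          exact le_mul_of_one_le_left (by positivity) hge
      _ = Real.exp (L * (k * h + h)) * (‖x - x'‖ + E * (1 + lam * h) / lam) := by
          rw [mul_add L, Real.exp_add]; field_simp; ring
      _ ≤ Real.exp (L * (k * h + h)) * (‖x - x'‖ + E * Real.exp (lam * h) / lam) := by gcongr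
      _ = _ := by rw [mul_add lam, Real.exp_add, hE]; ring

/-- Stability of solutions of two continuity equations with approximately smooth velocity fields,
tested against a `C^{1,1}` function. -/
theorem abs_integral_sub_integral_le {μ' : ℝ → Measure X} {V' : ℝ → X → X} {m' : ℝ → ℝ}
    {w' : ℝ → X → X} (htr : IsTransport μ V m) (htr' : IsTransport μ' V' m')
    (hev : ∀ ψ : X → ℝ, ∀ A C, ContDiff ℝ 1 ψ → (∀ x, |ψ x| ≤ C) → (∀ x, ‖fderiv ℝ ψ x‖ ≤ A) →
      Evolves μ V T ψ)
    (hev' : ∀ ψ : X → ℝ, ∀ A C, ContDiff ℝ 1 ψ → (∀ x, |ψ x| ≤ C) → (∀ x, ‖fderiv ℝ ψ x‖ ≤ A) →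
      Evolves μ' V' T ψ)
    (hw : IsApproxField μ V w T ε b L L₂ Λ) (hw' : IsApproxField μ' V' w' T ε b L L₂ Λ)
    (hL₂ : 0 ≤ L₂) (hε : 0 ≤ ε) (hΛ : 0 ≤ Λ) {lam U : ℝ} (hlam : 0 < lam) (hU : 0 ≤ U)
    (hww : ∀ t ∈ Icc 0 T, ∀ x, ‖w t x - w' t x‖ ≤ U * Real.exp (lam * t))
    (hφ : IsC11 φ A B) (hB : 0 ≤ B) (hC : ∀ x, |φ x| ≤ C)
    {γ : Measure (X × X)} (hγ : γ.map Prod.fst = μ 0) (hγ' : γ.map Prod.snd = μ' 0)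
    (hint : Integrable (fun z : X × X => ‖z.1 - z.2‖) γ) {t : ℝ} (ht : t ∈ Icc 0 T) :
    |(∫ x, φ x ∂μ t) - ∫ x, φ x ∂μ' t|
      ≤ 2 * (t * (A * Real.exp (L * t) * ε))
        + A * (Real.exp (L * t) * ((∫ z, ‖z.1 - z.2‖ ∂γ) + U * Real.exp (lam * t) / lam)) := by
  have hA := hφ.nonneg_left
  have hp := htr.isProbabilityMeasure
  have hpγ : IsProbabilityMeasure γ := by
    refine ⟨?_⟩
    have := (hp 0).measure_univ
    rwa [← hγ, Measure.map_apply measurable_fst MeasurableSet.univ, preimage_univ] at this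
  -- At `t = 0` there is no positive step size `t / (n + 1)`; the Lipschitz bound of `φ` and the
  -- coupling suffice.
  rcases ht.1.eq_or_lt with rfl | ht0
  · have h1 : ∀ x x', |φ x - φ x'| ≤ A * ‖x - x'‖ := hφ.norm_sub_le
    rw [← hγ, ← hγ', integral_map (by fun_prop) hφ.contDiff.continuous.aestronglyMeasurable,
      integral_map (by fun_prop) hφ.contDiff.continuous.aestronglyMeasurable]
    have hi : ∀ f : X × X → X, Continuous f → Integrable (fun z => φ (f z)) γ := fun f hf =>
      Integrable.of_bound (hφ.contDiff.continuous.comp hf).aestronglyMeasurable C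
        (ae_of_all _ fun z => hC _)
    rw [← integral_sub (hi _ continuous_fst) (hi _ continuous_snd), ← Real.norm_eq_abs]
    refine (norm_integral_le_of_norm_le (hint.const_mul A) (ae_of_all _ fun z =>
      h1 z.1 z.2)).trans ?_
    rw [integral_const_mul]
    have : 0 ≤ A * (U / lam) := by positivity
    simp
    linarith
  · set A' := A * Real.exp (L * t)
    set B' := (B + A' * L₂ * t) * Real.exp (2 * L * t)
    set D := ∫ z, ‖z.1 - z.2‖ ∂γ
    have key : ∀ n : ℕ, |(∫ x, φ x ∂μ t) - ∫ x, φ x ∂μ' t|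
        ≤ 2 * (t * localError A' B' ε b L Λ (t * (1 / ((n : ℝ) + 1))))
          + A * (Real.exp (L * t) * (D + U * Real.exp (lam * t) / lam)) := by
      intro n
      obtain ⟨h, hh⟩ : ∃ h, h = t * (1 / ((n : ℝ) + 1)) := ⟨_, rfl⟩
      rw [← hh]
      have hh0 : 0 < h := by rw [hh]; positivity
      have hnt : ((n + 1 : ℕ) : ℝ) * h = t := by rw [hh]; push_cast; field_simp
      have hnT : ((n + 1 : ℕ) : ℝ) * h ≤ T := by rw [hnt]; exact ht.2
      have h1 := abs_integral_sub_eulerScheme_le htr hev hw hL₂ hε hΛ hh0 (n + 1) hnT hφ hB hC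
        (A' := A') (B' := B') (by rw [hnt]) (by rw [hnt])
      have h2 := abs_integral_sub_eulerScheme_le htr' hev' hw' hL₂ hε hΛ hh0 (n + 1) hnT hφ hB hC
        (A' := A') (B' := B') (by rw [hnt]) (by rw [hnt])
      have h3 : ∀ z : X × X, ‖φ (eulerScheme w h (n + 1) z.1) - φ (eulerScheme w' h (n + 1) z.2)‖
          ≤ A * (Real.exp (L * t) * (‖z.1 - z.2‖ + U * Real.exp (lam * t) / lam)) := fun z => by
        refine (hφ.norm_sub_le _ _).trans (mul_le_mul_of_nonneg_left ?_ hA)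
        have := norm_eulerScheme_sub_le hh0.le hw.isC11 hlam hU hww (n + 1) hnT z.1 z.2
        rwa [hnt] at this
      have hc1 : Continuous fun x => φ (eulerScheme w h (n + 1) x) :=
        hφ.contDiff.continuous.comp (continuous_eulerScheme hh0.le hw.isC11 (n + 1) hnT)
      have hc2 : Continuous fun x => φ (eulerScheme w' h (n + 1) x) :=
        hφ.contDiff.continuous.comp (continuous_eulerScheme hh0.le hw'.isC11 (n + 1) hnT)
      have hi1 : Integrable (fun z : X × X => φ (eulerScheme w h (n + 1) z.1)) γ :=
        Integrable.of_bound (hc1.comp continuous_fst).aestronglyMeasurable C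
          (ae_of_all _ fun z => hC _)
      have hi2 : Integrable (fun z : X × X => φ (eulerScheme w' h (n + 1) z.2)) γ :=
        Integrable.of_bound (hc2.comp continuous_snd).aestronglyMeasurable C
          (ae_of_all _ fun z => hC _)
      have h4 : |(∫ x, φ (eulerScheme w h (n + 1) x) ∂μ 0)
          - ∫ x, φ (eulerScheme w' h (n + 1) x) ∂μ' 0|
          ≤ A * (Real.exp (L * t) * (D + U * Real.exp (lam * t) / lam)) := by
        rw [← hγ, ← hγ', integral_map (by fun_prop) hc1.aestronglyMeasurable,
          integral_map (by fun_prop) hc2.aestronglyMeasurable, ← integral_sub hi1 hi2,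
          ← Real.norm_eq_abs]
        refine (norm_integral_le_of_norm_le (((hint.add (integrable_const _)).const_mul
          _).const_mul A) (ae_of_all _ h3)).trans (le_of_eq ?_)
        rw [integral_const_mul, integral_const_mul]
        congr 2
        exact (integral_add hint (integrable_const _)).trans (by simp [D])
      rw [← mul_assoc ((n + 1 : ℕ) : ℝ), hnt] at h1 h2
      have t1 := abs_sub_le (∫ x, φ x ∂μ t) (∫ x, φ (eulerScheme w h (n + 1) x) ∂μ 0)
        (∫ x, φ x ∂μ' t)
      have t2 := abs_sub_le (∫ x, φ (eulerScheme w h (n + 1) x) ∂μ 0)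
        (∫ x, φ (eulerScheme w' h (n + 1) x) ∂μ' 0) (∫ x, φ x ∂μ' t)
      rw [abs_sub_comm (∫ x, φ (eulerScheme w' h (n + 1) x) ∂μ' 0)] at t2
      linarith
    -- As the step size tends to zero, only `A' ε` remains of the local error: `B'`, and with it
    -- `L₂`, `Λ` and `b`, drop out.
    have hlim : Tendsto (fun n : ℕ => 2 * (t * localError A' B' ε b L Λ (t * (1 / ((n : ℝ) + 1))))
          + A * (Real.exp (L * t) * (D + U * Real.exp (lam * t) / lam))) atTop
        (𝓝 (2 * (t * localError A' B' ε b L Λ (t * 0))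
          + A * (Real.exp (L * t) * (D + U * Real.exp (lam * t) / lam)))) := by
      have hcont : Continuous fun y : ℝ => 2 * (t * localError A' B' ε b L Λ (t * y))
          + A * (Real.exp (L * t) * (D + U * Real.exp (lam * t) / lam)) := by
        unfold localError; fun_prop
      exact (hcont.tendsto 0).comp tendsto_one_div_add_atTop_nhds_zero_nat
    have := ge_of_tendsto' hlim key
    simpa [localError] using this

end Euler

end MeanFieldStability

namespace MeanFieldStability

/-! ### Smooth approximations of the velocity field -/

open Filter Topology

/-! ### Calculus of `C^{1,1}` maps. -/

section Calculus

variable {X Y Z : Type*} [NormedAddCommGroup X] [NormedSpace ℝ X] [NormedAddCommGroup Y]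
  [NormedSpace ℝ Y] [NormedAddCommGroup Z] [NormedSpace ℝ Z] {A B A' B' : ℝ}

theorem IsC11.mono {φ : X → Y} (hφ : IsC11 φ A B) (hA : A ≤ A') (hB : B ≤ B') : IsC11 φ A' B' :=
  ⟨hφ.differentiable, fun x => (hφ.norm_fderiv_le x).trans hA, fun x y =>
    (hφ.norm_fderiv_sub_le x y).trans (mul_le_mul_of_nonneg_right hB (norm_nonneg _))⟩

theorem IsC11.prodMk {φ : X → Y} {ψ : X → Z} (hφ : IsC11 φ A B) (hψ : IsC11 ψ A' B') :
    IsC11 (fun x => (φ x, ψ x)) (A + A') (B + B') := by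
  have hd : ∀ x, fderiv ℝ (fun x => (φ x, ψ x)) x = (fderiv ℝ φ x).prod (fderiv ℝ ψ x) := fun x =>
    ((hφ.differentiable x).hasFDerivAt.prodMk (hψ.differentiable x).hasFDerivAt).fderiv
  have hn : ∀ (f : X →L[ℝ] Y) (g : X →L[ℝ] Z), ‖f.prod g‖ ≤ ‖f‖ + ‖g‖ := fun f g => by
    rw [ContinuousLinearMap.opNorm_prod]
    exact max_le (le_add_of_nonneg_right (norm_nonneg g)) (le_add_of_nonneg_left (norm_nonneg f))
  refine ⟨fun x => (hφ.differentiable x).prodMk (hψ.differentiable x), fun x => ?_, fun x y => ?_⟩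
  · rw [hd]
    exact (hn _ _).trans (add_le_add (hφ.norm_fderiv_le x) (hψ.norm_fderiv_le x))
  · have e : (fderiv ℝ φ x).prod (fderiv ℝ ψ x) - (fderiv ℝ φ y).prod (fderiv ℝ ψ y)
        = (fderiv ℝ φ x - fderiv ℝ φ y).prod (fderiv ℝ ψ x - fderiv ℝ ψ y) := rfl
    rw [hd, hd, e, add_mul]
    exact (hn _ _).trans (add_le_add (hφ.norm_fderiv_sub_le x y) (hψ.norm_fderiv_sub_le x y))

theorem IsC11.comp_clm {φ : Y → Z} (hφ : IsC11 φ A B) (hB : 0 ≤ B) (f : X →L[ℝ] Y) (hf : ‖f‖ ≤ 1) :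
    IsC11 (fun x => φ (f x)) A B := by
  have hA := hφ.nonneg_left
  have hd : ∀ x, fderiv ℝ (fun x => φ (f x)) x = (fderiv ℝ φ (f x)).comp f := fun x =>
    ((hφ.differentiable (f x)).hasFDerivAt.comp x f.hasFDerivAt).fderiv
  refine ⟨fun x => (hφ.differentiable (f x)).comp x f.differentiableAt, fun x => ?_, fun x y => ?_⟩
  · rw [hd]
    refine (ContinuousLinearMap.opNorm_comp_le _ _).trans ?_
    exact (mul_le_of_le_one_right (norm_nonneg _) hf).trans (hφ.norm_fderiv_le _)
  · rw [hd, hd, ← ContinuousLinearMap.sub_comp]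
    refine (ContinuousLinearMap.opNorm_comp_le _ _).trans ?_
    refine (mul_le_of_le_one_right (norm_nonneg _) hf).trans ((hφ.norm_fderiv_sub_le _ _).trans ?_)
    rw [← map_sub]
    refine mul_le_mul_of_nonneg_left ((f.le_opNorm _).trans ?_) hB
    exact mul_le_of_le_one_left (norm_nonneg _) hf

theorem IsC11.const_smul {φ : X → Y} (hφ : IsC11 φ A B) (c : ℝ) :
    IsC11 (fun x => c • φ x) (|c| * A) (|c| * B) := by
  have hd : ∀ x, fderiv ℝ (fun x => c • φ x) x = c • fderiv ℝ φ x := fun x =>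
    ((hφ.differentiable x).hasFDerivAt.const_smul c).fderiv
  refine ⟨fun x => (hφ.differentiable x).const_smul c, fun x => ?_, fun x y => ?_⟩
  · rw [hd, norm_smul, Real.norm_eq_abs]
    exact mul_le_mul_of_nonneg_left (hφ.norm_fderiv_le x) (abs_nonneg c)
  · rw [hd, hd, ← smul_sub, norm_smul, Real.norm_eq_abs, mul_assoc]
    exact mul_le_mul_of_nonneg_left (hφ.norm_fderiv_sub_le x y) (abs_nonneg c)

theorem IsC11.smul {φ : X → ℝ} {ψ : X → Y} (hφ : IsC11 φ A B) (hψ : IsC11 ψ A' B') (hB : 0 ≤ B)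
    {F G : ℝ} (hF : ∀ x, |φ x| ≤ F) (hG : ∀ x, ‖ψ x‖ ≤ G) :
    IsC11 (fun x => φ x • ψ x) (F * A' + A * G) (F * B' + 2 * (A * A') + B * G) := by
  have hA := hφ.nonneg_left
  have hA' := hψ.nonneg_left
  have hF0 : 0 ≤ F := (abs_nonneg _).trans (hF 0)
  have hG0 : 0 ≤ G := (norm_nonneg _).trans (hG 0)
  have hd : ∀ x, fderiv ℝ (fun x => φ x • ψ x) x
      = φ x • fderiv ℝ ψ x + (fderiv ℝ φ x).smulRight (ψ x) := fun x =>
    ((hφ.differentiable x).hasFDerivAt.smul (hψ.differentiable x).hasFDerivAt).fderiv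
  refine ⟨fun x => (hφ.differentiable x).smul (hψ.differentiable x), fun x => ?_, fun x y => ?_⟩
  · rw [hd]
    refine (norm_add_le _ _).trans ?_
    rw [norm_smul, ContinuousLinearMap.norm_smulRight_apply]
    exact add_le_add (mul_le_mul (hF x) (hψ.norm_fderiv_le x) (norm_nonneg _) hF0)
      (mul_le_mul (hφ.norm_fderiv_le x) (hG x) (norm_nonneg _) hA)
  · have e : φ x • fderiv ℝ ψ x + (fderiv ℝ φ x).smulRight (ψ x)
        - (φ y • fderiv ℝ ψ y + (fderiv ℝ φ y).smulRight (ψ y))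
        = φ x • (fderiv ℝ ψ x - fderiv ℝ ψ y) + (φ x - φ y) • fderiv ℝ ψ y
          + ((fderiv ℝ φ x).smulRight (ψ x - ψ y)
            + (fderiv ℝ φ x - fderiv ℝ φ y).smulRight (ψ y)) := by
      ext z
      simp [smul_sub, sub_smul]
      abel
    rw [hd, hd, e]
    have b1 : ‖φ x • (fderiv ℝ ψ x - fderiv ℝ ψ y)‖ ≤ F * (B' * ‖x - y‖) := by
      rw [norm_smul]
      exact mul_le_mul (hF x) (hψ.norm_fderiv_sub_le x y) (norm_nonneg _) hF0
    have b2 : ‖(φ x - φ y) • fderiv ℝ ψ y‖ ≤ A * ‖x - y‖ * A' := by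
      rw [norm_smul]
      exact mul_le_mul (hφ.norm_sub_le x y) (hψ.norm_fderiv_le y) (norm_nonneg _) (by positivity)
    have b3 : ‖(fderiv ℝ φ x).smulRight (ψ x - ψ y)‖ ≤ A * (A' * ‖x - y‖) := by
      rw [ContinuousLinearMap.norm_smulRight_apply]
      exact mul_le_mul (hφ.norm_fderiv_le x) (hψ.norm_sub_le x y) (norm_nonneg _) hA
    have b4 : ‖(fderiv ℝ φ x - fderiv ℝ φ y).smulRight (ψ y)‖ ≤ B * ‖x - y‖ * G := by
      rw [ContinuousLinearMap.norm_smulRight_apply]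
      exact mul_le_mul (hφ.norm_fderiv_sub_le x y) (hG y) (norm_nonneg _) (by positivity)
    refine (norm_add_le _ _).trans ((add_le_add ((norm_add_le _ _).trans (add_le_add b1 b2))
      ((norm_add_le _ _).trans (add_le_add b3 b4))).trans (le_of_eq (by ring)))

theorem isC11_of_contDiff_two {f : ℝ → ℝ} (hf : ContDiff ℝ 2 f) {K K' : ℝ}
    (hK : ∀ r, |deriv f r| ≤ K) (hK' : ∀ r, |deriv (deriv f) r| ≤ K') : IsC11 f K K' := by
  have hd : ∀ x, ‖fderiv ℝ f x‖ = |deriv f x| := fun x => by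
    rw [← norm_deriv_eq_norm_fderiv, Real.norm_eq_abs]
  refine ⟨hf.differentiable two_ne_zero, fun x => by rw [hd]; exact hK x, fun x y => ?_⟩
  have e : ‖fderiv ℝ f x - fderiv ℝ f y‖ ≤ |deriv f x - deriv f y| := by
    refine ContinuousLinearMap.opNorm_le_bound _ (abs_nonneg _) fun z => le_of_eq ?_
    rw [_root_.sub_apply, fderiv_eq_smul_deriv, fderiv_eq_smul_deriv, ← smul_sub,
      norm_smul, mul_comm, Real.norm_eq_abs (deriv f x - deriv f y)]
  refine e.trans ?_
  rw [Real.norm_eq_abs]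
  exact abs_sub_le_of_abs_deriv_le ((hf.deriv' (n := 1)).differentiable one_ne_zero) hK' x y

end Calculus

/-- A truncation `τ` of the identity at level `R`, with a common bound `B` for `τ`, `τ'`, `τ''`. -/
structure IsTruncation (τ : ℝ → ℝ) (R B : ℝ) : Prop where
  one_le : 1 ≤ B
  eq_self : ∀ a, |a| ≤ R → τ a = a
  abs_le : ∀ a, |τ a| ≤ B
  isC11 : IsC11 τ B B

theorem exists_isTruncation {R : ℝ} (hR : 0 < R) : ∃ τ B, IsTruncation τ R B := by
  let f : ContDiffBump (0 : ℝ) := ⟨R, R + 1, hR, by linarith⟩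
  have hc : ContDiff ℝ 2 fun a => a * f a := contDiff_id.mul f.contDiff
  have hs : HasCompactSupport fun a => a * f a := f.hasCompactSupport.mul_left
  obtain ⟨B₀, hB₀⟩ := hs.exists_bound_of_continuous hc.continuous
  obtain ⟨B₁, hB₁⟩ := hs.deriv.exists_bound_of_continuous (hc.continuous_deriv (by norm_num))
  obtain ⟨B₂, hB₂⟩ := hs.deriv.deriv.exists_bound_of_continuous
    ((hc.deriv' (n := 1)).continuous_deriv le_rfl)
  refine ⟨fun a => a * f a, max 1 (max B₀ (max B₁ B₂)), le_max_left _ _, fun a ha => ?_,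
    fun a => (hB₀ a).trans (by simp), isC11_of_contDiff_two hc
      (fun r => (hB₁ r).trans (by simp)) (fun r => (hB₂ r).trans (by simp))⟩
  rw [f.one_of_mem_closedBall (by simpa using ha), mul_one]

variable {d : ℕ}

/-! ### The truncated velocity fields and the dual test function. -/

section Fields

variable {s s' τ : ℝ → ℝ} {K R B : ℝ} {g g' : EuclideanSpace ℝ (Fin d) → ℝ}

theorem isC11_alpha (hs : IsActivation s K) (hg : MemLp g 2 (gauss d)) :
    IsC11 (alpha s g) (K * gaussNorm g) (K * √fourthMoment * gaussNorm g) := by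
  have hd : ∀ w, fderiv ℝ (alpha s g) w = innerSL ℝ (beta (deriv s) g w) := fun w =>
    (hasFDerivAt_alpha (hs.contDiff.of_le (by norm_num)) hs.bound hs.bound_deriv hg w).fderiv
  have hc := (contDiff_deriv_of_isActivation hs).continuous
  refine ⟨fun w => (hasFDerivAt_alpha (hs.contDiff.of_le (by norm_num)) hs.bound hs.bound_deriv hg
    w).differentiableAt, fun w => ?_, fun w w' => ?_⟩
  · rw [hd, innerSL_apply_norm]
    exact norm_beta_le hc hs.bound_deriv hg w
  · rw [hd, hd, ← map_sub, innerSL_apply_norm]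
    exact norm_beta_sub_le hc hs.bound_deriv (lipschitz_deriv_of_isActivation hs) hg w w'

/-- The two constants play different roles: the first is dimension-free and survives in the final
bound, while the second may depend on `d` and on the averaging length. -/
theorem isC11_beta (hs : IsActivation s K) {L : ℝ}
    (hL : ∀ r r', |deriv (deriv s) r - deriv (deriv s) r'| ≤ L * |r - r'|)
    (hg : MemLp g 2 (gauss d)) :
    IsC11 (beta (deriv s) g) (K * √fourthMoment * gaussNorm g)
      (L * (gaussNorm (fun x : EuclideanSpace ℝ (Fin d) => ‖x‖ ^ 3) * gaussNorm g)) := by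
  have hdc := contDiff_deriv_of_isActivation hs
  have hd : ∀ w, HasFDerivAt (beta (deriv s) g) (betaDeriv (deriv s) g w) w := fun w =>
    hasFDerivAt_beta hdc hs.bound_deriv hs.bound_deriv_two hg w
  have hK := nonneg_of_isActivation hs
  have hg0 := gaussNorm_nonneg g
  refine ⟨fun w => (hd w).differentiableAt, fun w => ?_, fun w w' => ?_⟩
  -- The derivative is bounded through the dimension-free Lipschitz estimate; estimating its
  -- integral formula directly would bring in moments of `‖x‖`.
  · have hl : LipschitzWith (Real.toNNReal (K * √fourthMoment * gaussNorm g)) (beta (deriv s) g) :=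
      LipschitzWith.of_dist_le' fun w w' => by
        rw [dist_eq_norm, dist_eq_norm]
        exact norm_beta_sub_le hdc.continuous hs.bound_deriv
          (lipschitz_deriv_of_isActivation hs) hg w w'
    have := norm_fderiv_le_of_lipschitz ℝ hl (x₀ := w)
    rwa [Real.coe_toNNReal _ (by positivity)] at this
  · rw [(hd w).fderiv, (hd w').fderiv]
    exact norm_betaDeriv_sub_le hdc hs.bound_deriv_two hL hg w w'

/-- The Lipschitz constant of the truncated velocity fields. -/
def velLip (K C B N : ℝ) : ℝ := C * (K * N) + C * (B * (K * √fourthMoment * N) + B * (K * N))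

/-- The value of `L₂` is irrelevant, but it must serve all residuals and rates at once: it is used
at all times and for both flows. -/
theorem isC11_vel (hs : IsActivation s K) {L C N : ℝ} (hL0 : 0 ≤ L)
    (hL : ∀ r r', |deriv (deriv s) r - deriv (deriv s) r'| ≤ L * |r - r'|)
    (hτ : IsTruncation τ R B) :
    ∃ L₂, 0 ≤ L₂ ∧ ∀ (g : EuclideanSpace ℝ (Fin d) → ℝ) (ca cw : ℝ), MemLp g 2 (gauss d) →
      gaussNorm g ≤ N → |ca| ≤ C → |cw| ≤ C → IsC11 (vel s τ ca cw g) (velLip K C B N) L₂ := by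
  have hK := nonneg_of_isActivation hs
  have hB : 0 ≤ B := zero_le_one.trans hτ.one_le
  set S := gaussNorm (fun x : EuclideanSpace ℝ (Fin d) => ‖x‖ ^ 3)
  have hS : 0 ≤ S := gaussNorm_nonneg _
  refine ⟨|C| * (K * √fourthMoment * |N|)
    + |C| * (B * (L * (S * |N|)) + 2 * (B * (K * √fourthMoment * |N|)) + B * (K * |N|)),
    by positivity, fun g ca cw hg hN hca hcw => ?_⟩
  have hg0 := gaussNorm_nonneg g
  have hC0 : 0 ≤ C := (abs_nonneg _).trans hca
  have hN0 : 0 ≤ N := hg0.trans hN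
  rw [abs_of_nonneg hC0, abs_of_nonneg hN0]
  have h1 := ((isC11_alpha hs hg).comp_clm (by positivity)
    (ContinuousLinearMap.snd ℝ ℝ (EuclideanSpace ℝ (Fin d)))
    (ContinuousLinearMap.norm_snd_le _ _ _)).const_smul (-ca)
  have h2 := (isC11_beta hs hL hg).comp_clm (by positivity)
    (ContinuousLinearMap.snd ℝ ℝ (EuclideanSpace ℝ (Fin d)))
    (ContinuousLinearMap.norm_snd_le _ _ _)
  have h3 := hτ.isC11.comp_clm hB (ContinuousLinearMap.fst ℝ ℝ (EuclideanSpace ℝ (Fin d)))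
    (ContinuousLinearMap.norm_fst_le _ _ _)
  have h4 := (h3.smul h2 hB (fun θ => hτ.abs_le _) (fun θ =>
    norm_beta_le (contDiff_deriv_of_isActivation hs).continuous hs.bound_deriv hg
      _)).const_smul (-cw)
  have h5 := h1.prodMk h4
  have e : vel s τ ca cw g = fun θ : Param d =>
      ((-ca) • alpha s g (ContinuousLinearMap.snd ℝ ℝ (EuclideanSpace ℝ (Fin d)) θ),
        (-cw) • (τ (ContinuousLinearMap.fst ℝ ℝ (EuclideanSpace ℝ (Fin d)) θ)
          • beta (deriv s) g (ContinuousLinearMap.snd ℝ ℝ (EuclideanSpace ℝ (Fin d)) θ))) := by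
    funext θ
    simp [vel, mul_smul]
  rw [e]
  refine h5.mono ?_ ?_
  · rw [abs_neg, abs_neg, velLip]; gcongr
  · rw [abs_neg, abs_neg]; gcongr

/-- The field is linear in the rates and in the residual, which separates the two changes. This
yields both the regularity in time of one field and the comparison of the fields of two flows. -/
theorem norm_vel_sub_vel_le (hs : IsActivation s K) {C δ : ℝ} (hτ : IsTruncation τ R B)
    (hg : MemLp g 2 (gauss d)) (hg' : MemLp g' 2 (gauss d)) {ca cw ca' cw' : ℝ} (hca : |ca'| ≤ C)
    (hcw : |cw'| ≤ C) (hδa : |ca - ca'| ≤ δ) (hδw : |cw - cw'| ≤ δ) (θ : Param d) :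
    ‖vel s τ ca cw g θ - vel s τ ca' cw' g' θ‖
      ≤ B * (K * (δ * gaussNorm g + C * gaussNorm fun x => g x - g' x)) := by
  have hK := nonneg_of_isActivation hs
  have hC : 0 ≤ C := (abs_nonneg _).trans hca
  have hδ : 0 ≤ δ := (abs_nonneg _).trans hδa
  have hB : 0 ≤ B := zero_le_one.trans hτ.one_le
  have hg0 := gaussNorm_nonneg g
  have hg1 := gaussNorm_nonneg fun x => g x - g' x
  have hc := (contDiff_deriv_of_isActivation hs).continuous
  have hd : MemLp (fun x => g x - g' x) 2 (gauss d) := hg.sub hg'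
  refine max_le ?_ ?_
  · have e : (vel s τ ca cw g θ - vel s τ ca' cw' g' θ).1
        = -((ca - ca') * alpha s g θ.2 + ca' * alpha s (fun x => g x - g' x) θ.2) := by
      rw [← alpha_sub_right hs.contDiff.continuous hs.bound hg hg']
      simp only [vel, Prod.fst_sub]; ring
    rw [e, norm_neg, Real.norm_eq_abs]
    refine (abs_add_le _ _).trans ?_
    rw [abs_mul, abs_mul]
    have b1 := mul_le_mul hδa (abs_alpha_le hs.bound hg θ.2) (abs_nonneg _) hδ
    have b2 := mul_le_mul hca (abs_alpha_le hs.bound hd θ.2) (abs_nonneg _) hC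
    refine le_trans ?_ (le_mul_of_one_le_left (by positivity) hτ.one_le)
    linarith
  · have e : (vel s τ ca cw g θ - vel s τ ca' cw' g' θ).2
        = -(τ θ.1 • ((cw - cw') • beta (deriv s) g θ.2
          + cw' • beta (deriv s) (fun x => g x - g' x) θ.2)) := by
      rw [← beta_sub_right hc hs.bound_deriv hg hg']
      simp only [vel, Prod.snd_sub]
      module
    rw [e, norm_neg, norm_smul, Real.norm_eq_abs]
    refine mul_le_mul (hτ.abs_le _) ((norm_add_le _ _).trans ?_) (norm_nonneg _) hB
    rw [norm_smul, norm_smul, Real.norm_eq_abs, Real.norm_eq_abs]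
    have b1 := mul_le_mul hδw (norm_beta_le hc hs.bound_deriv hg θ.2) (norm_nonneg _) hδ
    have b2 := mul_le_mul hcw (norm_beta_le hc hs.bound_deriv hd θ.2) (norm_nonneg _) hC
    linarith

theorem norm_vel_sub_vel_activation_le {K' : ℝ} (hs : IsActivation s K) (hs' : IsActivation s' K')
    {C δ : ℝ} (hτ : IsTruncation τ R B) (hg : MemLp g 2 (gauss d)) {ca cw : ℝ} (hca : |ca| ≤ C)
    (hcw : |cw| ≤ C) (hδ : ∀ r, |s r - s' r| ≤ δ) (hδ' : ∀ r, |deriv s r - deriv s' r| ≤ δ)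
    (θ : Param d) :
    ‖vel s τ ca cw g θ - vel s' τ ca cw g θ‖ ≤ B * (C * (δ * gaussNorm g)) := by
  have hC : 0 ≤ C := (abs_nonneg _).trans hca
  have hδ0 : 0 ≤ δ := (abs_nonneg _).trans (hδ 0)
  have hB : 0 ≤ B := zero_le_one.trans hτ.one_le
  have hg0 := gaussNorm_nonneg g
  have hc := (contDiff_deriv_of_isActivation hs).continuous
  have hc' := (contDiff_deriv_of_isActivation hs').continuous
  refine max_le ?_ ?_
  · have e : (vel s τ ca cw g θ - vel s' τ ca cw g θ).1
        = -(ca * alpha (fun r => s r - s' r) g θ.2) := by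
      rw [← alpha_sub_left hs.contDiff.continuous hs'.contDiff.continuous hs.bound hs'.bound hg]
      simp only [vel, Prod.fst_sub]; ring
    rw [e, norm_neg, Real.norm_eq_abs, abs_mul]
    refine le_trans ?_ (le_mul_of_one_le_left (by positivity) hτ.one_le)
    exact mul_le_mul hca (abs_alpha_le hδ hg θ.2) (abs_nonneg _) hC
  · have e : (vel s τ ca cw g θ - vel s' τ ca cw g θ).2
        = -(τ θ.1 • (cw • beta (fun r => deriv s r - deriv s' r) g θ.2)) := by
      rw [← beta_sub_left hc hc' hs.bound_deriv hs'.bound_deriv hg]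
      simp only [vel, Prod.snd_sub]
      module
    rw [e, norm_neg, norm_smul, norm_smul, Real.norm_eq_abs, Real.norm_eq_abs]
    exact mul_le_mul (hτ.abs_le _) (mul_le_mul hcw (norm_beta_le (hc.sub hc') hδ' hg θ.2)
      (norm_nonneg _) hC) (by positivity) hB

/-- The test function `θ ↦ τ(a) E_x[g(x) s(wᵀx)]`. -/
def testFun (s τ : ℝ → ℝ) (g : EuclideanSpace ℝ (Fin d) → ℝ) (θ : Param d) : ℝ :=
  τ θ.1 * alpha s g θ.2

theorem abs_testFun_le (hs : IsActivation s K) (hτ : IsTruncation τ R B)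
    (hg : MemLp g 2 (gauss d)) (θ : Param d) : |testFun s τ g θ| ≤ B * (K * gaussNorm g) := by
  rw [testFun, abs_mul]
  exact mul_le_mul (hτ.abs_le _) (abs_alpha_le hs.bound hg _) (abs_nonneg _)
    (zero_le_one.trans hτ.one_le)

theorem isC11_testFun (hs : IsActivation s K) (hτ : IsTruncation τ R B)
    (hg : MemLp g 2 (gauss d)) :
    ∃ B', 0 ≤ B' ∧ IsC11 (testFun s τ g) (2 * B * K * gaussNorm g) B' := by
  have hK := nonneg_of_isActivation hs
  have hB : 0 ≤ B := zero_le_one.trans hτ.one_le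
  have hg0 := gaussNorm_nonneg g
  have h1 := (isC11_alpha hs hg).comp_clm (by positivity)
    (ContinuousLinearMap.snd ℝ ℝ (EuclideanSpace ℝ (Fin d)))
    (ContinuousLinearMap.norm_snd_le _ _ _)
  have h3 := hτ.isC11.comp_clm hB (ContinuousLinearMap.fst ℝ ℝ (EuclideanSpace ℝ (Fin d)))
    (ContinuousLinearMap.norm_fst_le _ _ _)
  have h4 := h3.smul h1 hB (fun θ => hτ.abs_le _) (fun θ =>
    abs_alpha_le hs.bound hg _)
  exact ⟨_, by positivity, h4.mono (by linarith) le_rfl⟩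

/-- Fubini's theorem; the truncation is invisible to `μ` because `|a| ≤ R` almost everywhere. -/
theorem integral_testFun {μ : Measure (Param d)} [IsProbabilityMeasure μ] (hs : IsActivation s K)
    (hτ : IsTruncation τ R B) (hg : MemLp g 2 (gauss d)) (hμ : ∀ᵐ θ ∂μ, |θ.1| ≤ R) :
    ∫ θ, testFun s τ g θ ∂μ = ∫ x, g x * fNN s μ x ∂(gauss d) := by
  have hc := hs.contDiff.continuous
  have hi : Integrable (fun θ : Param d => θ.1) μ :=
    Integrable.of_bound (by fun_prop) R hμ
  have hprod : Integrable (fun z : Param d × EuclideanSpace ℝ (Fin d) =>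
      s (inner ℝ z.1.2 z.2) * (z.1.1 * g z.2)) (μ.prod (gauss d)) :=
    (hi.mul_prod (hg.integrable (by norm_num))).bdd_mul (c := K)
      (Continuous.aestronglyMeasurable (by fun_prop)) (ae_of_all _ fun z => hs.bound _)
  calc ∫ θ, testFun s τ g θ ∂μ
      = ∫ θ, ∫ x, s (inner ℝ θ.2 x) * (θ.1 * g x) ∂(gauss d) ∂μ := by
        refine integral_congr_ae ?_
        filter_upwards [hμ] with θ hθ
        rw [testFun, hτ.eq_self _ hθ, alpha, ridge, ← integral_const_mul]
        refine integral_congr_ae (ae_of_all _ fun x => ?_)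
        simp only [smul_eq_mul]; ring
    _ = ∫ x, ∫ θ, s (inner ℝ θ.2 x) * (θ.1 * g x) ∂μ ∂(gauss d) := integral_integral_swap hprod
    _ = _ := by
        refine integral_congr_ae (ae_of_all _ fun x => ?_)
        simp only
        rw [fNN, ← integral_const_mul]
        refine integral_congr_ae (ae_of_all _ fun θ => ?_)
        simp only; ring

/-- The duality on which the argument rests: the difference of the outputs is paired with itself,
and by linearity in the measure this becomes a difference of integrals of one test function. -/
theorem gaussNorm_sq_fNN_sub {μ μ' : Measure (Param d)} [IsProbabilityMeasure μ]
    [IsProbabilityMeasure μ'] (hs : IsActivation s K) (hτ : IsTruncation τ R B)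
    (hμ : ∀ᵐ θ ∂μ, |θ.1| ≤ R) (hμ' : ∀ᵐ θ ∂μ', |θ.1| ≤ R) :
    gaussNorm (fun x => fNN s μ x - fNN s μ' x) ^ 2
      = (∫ θ, testFun s τ (fun x => fNN s μ x - fNN s μ' x) θ ∂μ)
        - ∫ θ, testFun s τ (fun x => fNN s μ x - fNN s μ' x) θ ∂μ' := by
  have hm := memLp_fNN hs (Integrable.of_bound (by fun_prop) R hμ)
  have hm' := memLp_fNN hs (Integrable.of_bound (by fun_prop) R hμ')
  have hg : MemLp (fun x => fNN s μ x - fNN s μ' x) 2 (gauss d) := hm.sub hm'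
  rw [integral_testFun hs hτ hg hμ, integral_testFun hs hτ hg hμ', ← integral_sub
    (integrable_mul_of_memLp_two hg hm) (integrable_mul_of_memLp_two hg hm'), gaussNorm_sq]
  refine integral_congr_ae (ae_of_all _ fun x => ?_)
  simp only; ring

end Fields

end MeanFieldStability

namespace MeanFieldStability

/-! ### Stability of mean-field flows -/

open Filter Topology

/-- A bound for the residual. -/
def residBound (Kσ Kξ Kρ Q T : ℝ) : ℝ := Kσ * momentBound Kσ Kξ Kρ Q T + Q

/-- A bound for the velocity, with a truncation bounded by `B`. -/
def velBound (Kσ Kξ Kρ Q T B : ℝ) : ℝ := growthBound Kσ Kξ Kρ Q T * B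

/-- The stability constant at rate zero. -/
def flowLip (Kσ Kξ Kρ Q T B : ℝ) : ℝ :=
  2 * B * Kσ * Real.exp (velLip Kσ Kξ B (residBound Kσ Kξ Kρ Q T) * T)

/-- The rate at which the distance between two flows may grow. -/
def flowRate (Kσ Kξ Kρ Q T B : ℝ) : ℝ := 2 * flowLip Kσ Kξ Kρ Q T B * (B * (Kσ * Kξ))

variable {d : ℕ} {σ τ : ℝ → ℝ} {Kσ Kξ Kρ B T t : ℝ} {fstar : EuclideanSpace ℝ (Fin d) → ℝ}
  {ξa ξw : ℝ → ℝ} {ρ ρ' : ℝ → ProbabilityMeasure (Param d)}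

theorem residBound_nonneg (hKσ : 0 < Kσ) (hKξ : 0 < Kξ) (hKρ : 0 < Kρ) {Q : ℝ} (hQ : 0 ≤ Q)
    (hT : 0 ≤ T) : 0 ≤ residBound Kσ Kξ Kρ Q T := by
  unfold residBound momentBound
  positivity

section Flow

variable (hKσ : 0 < Kσ) (hKξ : 0 < Kξ) (hKρ : 0 < Kρ) (hσ : IsActivation σ Kσ)
  (hf : MemLp fstar 2 (gauss d)) (hfc : Continuous fstar) (hξa : IsLearningRate ξa Kξ)
  (hξw : IsLearningRate ξw Kξ) (hρ : IsMeanFieldFlow σ fstar ξa ξw ρ)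
  (hρ₀ : IsInitialization (ρ 0) Kρ)

include hKσ hKξ hKρ hσ hf hfc hξa hξw hρ hρ₀

theorem gaussNorm_resid_le_residBound (ht : t ∈ Icc 0 T) :
    gaussNorm (resid σ fstar (ρ t : Measure (Param d)))
      ≤ residBound Kσ Kξ Kρ (gaussNorm fstar) T := by
  have h1 := absMoment_le hKσ hKξ hKρ hσ hf hfc hξa hξw hρ hρ₀ ht
  refine (gaussNorm_resid_le hσ hf (integrable_fst hρ ht.1)).trans ?_
  unfold residBound
  gcongr

variable (hτ : IsTruncation τ (radius Kσ Kξ Kρ (gaussNorm fstar) T) B)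

include hτ

theorem ae_flowVel_eq (ht : t ∈ Icc 0 T) : ∀ᵐ θ ∂(ρ t : Measure (Param d)),
    flowVel σ fstar ξa ξw ρ t θ
      = vel σ τ (ξa t) (ξw t) (resid σ fstar (ρ t : Measure (Param d))) θ := by
  filter_upwards [ae_abs_le_radius hKσ hKξ hKρ hσ hf hfc hξa hξw hρ hρ₀ ht] with θ hθ
  simp only [flowVel, vel, hτ.eq_self _ hθ, id]

theorem ae_norm_flowVel_le (ht : t ∈ Icc 0 T) : ∀ᵐ θ ∂(ρ t : Measure (Param d)),
    ‖flowVel σ fstar ξa ξw ρ t θ‖ ≤ flowGrowth Kσ Kξ (gaussNorm fstar) ρ t * B := by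
  have hi := integrable_fst hρ ht.1
  have hB := zero_le_one.trans hτ.one_le
  filter_upwards [ae_flowVel_eq hKσ hKξ hKρ hσ hf hfc hξa hξw hρ hρ₀ hτ ht] with θ hθ
  rw [hθ]
  refine (norm_vel_le hσ (memLp_resid hσ hf hi) (hξa.bound t ht.1) (hξw.bound t ht.1) θ
    hτ.one_le (hτ.abs_le _)).trans ?_
  have := gaussNorm_resid_le hσ hf hi
  unfold flowGrowth
  gcongr

theorem ae_norm_flowVel_le_velBound (ht : t ∈ Icc 0 T) : ∀ᵐ θ ∂(ρ t : Measure (Param d)),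
    ‖flowVel σ fstar ξa ξw ρ t θ‖ ≤ velBound Kσ Kξ Kρ (gaussNorm fstar) T B := by
  filter_upwards [ae_norm_flowVel_le hKσ hKξ hKρ hσ hf hfc hξa hξw hρ hρ₀ hτ ht] with θ hθ
  exact hθ.trans (mul_le_mul_of_nonneg_right
    (flowGrowth_le hKσ hKξ hKρ hσ hf hfc hξa hξw hρ hρ₀ ht) (zero_le_one.trans hτ.one_le))

theorem evolves_of_bounded {ψ : Param d → ℝ} {A C : ℝ} (hψ : ContDiff ℝ 1 ψ)
    (hC : ∀ θ, |ψ θ| ≤ C) (hA : ∀ θ, ‖fderiv ℝ ψ θ‖ ≤ A) :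
    Evolves (fun t => (ρ t : Measure (Param d))) (flowVel σ fstar ξa ξw ρ) T ψ := by
  refine (isTransport_of_isMeanFieldFlow hσ hf hfc hξa hξw hρ).evolves hψ (C' := A * B) hC
    fun t ht => ?_
  filter_upwards [ae_norm_flowVel_le hKσ hKξ hKρ hσ hf hfc hξa hξw hρ hρ₀ hτ ht] with θ hθ
  refine ((fderiv ℝ ψ θ).le_opNorm _).trans ((mul_le_mul (hA θ) hθ (norm_nonneg _)
    ((norm_nonneg _).trans (hA θ))).trans (le_of_eq (by ring)))

/-- By duality: the test function built from the increment `g` has derivative at most `2 B Kσ ‖g‖`,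
so one factor `‖g‖` cancels. This makes the velocity field Lipschitz in time. -/
theorem gaussNorm_fNN_sub_le {s : ℝ} (hs : 0 ≤ s) (hst : s ≤ t) (ht : t ≤ T) :
    gaussNorm (fun x => fNN σ (ρ t : Measure (Param d)) x - fNN σ (ρ s : Measure (Param d)) x)
      ≤ 2 * B * Kσ * velBound Kσ Kξ Kρ (gaussNorm fstar) T B * (t - s) := by
  have htI : t ∈ Icc 0 T := ⟨hs.trans hst, ht⟩
  have hsI : s ∈ Icc 0 T := ⟨hs, hst.trans ht⟩
  have hB := zero_le_one.trans hτ.one_le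
  set g : EuclideanSpace ℝ (Fin d) → ℝ :=
    fun x => fNN σ (ρ t : Measure (Param d)) x - fNN σ (ρ s : Measure (Param d)) x with hgdef
  have hg : MemLp g 2 (gauss d) :=
    (memLp_fNN hσ (integrable_fst hρ htI.1)).sub (memLp_fNN hσ (integrable_fst hρ hs))
  have hR := fun {r : ℝ} (hr : r ∈ Icc 0 T) =>
    ae_abs_le_radius hKσ hKξ hKρ hσ hf hfc hξa hξw hρ hρ₀ hr
  have hsq := gaussNorm_sq_fNN_sub hσ hτ (hR htI) (hR hsI)
  rw [← hgdef] at hsq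
  obtain ⟨B', _, hφ⟩ := isC11_testFun hσ hτ hg
  have hev := evolves_of_bounded hKσ hKξ hKρ hσ hf hfc hξa hξw hρ hρ₀ hτ hφ.contDiff
    (abs_testFun_le hσ hτ hg) hφ.norm_fderiv_le
  have h := abs_integral_sub_le_of_evolves hφ.nonneg_left hev hφ.norm_fderiv_le
    (fun r hr => ae_norm_flowVel_le_velBound hKσ hKξ hKρ hσ hf hfc hξa hξw hρ hρ₀ hτ hr) hs hst ht
  rcases (gaussNorm_nonneg g).eq_or_lt with h0 | h0
  · rw [← h0]
    have hb : 0 ≤ velBound Kσ Kξ Kρ (gaussNorm fstar) T B := by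
      have := residBound_nonneg hKσ hKξ hKρ (gaussNorm_nonneg fstar) (htI.1.trans ht)
      exact mul_nonneg (mul_nonneg hKξ.le (mul_nonneg hKσ.le this)) hB
    have := sub_nonneg.2 hst
    positivity
  · refine le_of_mul_le_mul_left ?_ h0
    calc gaussNorm g * gaussNorm g = gaussNorm g ^ 2 := (sq _).symm
      _ ≤ _ := hsq.le.trans ((le_abs_self _).trans h)
      _ = _ := by ring

/-- The regularized velocity field approximates that of a mean-field flow. -/
theorem isApproxField_flowVel {δ Lξ L₂ : ℝ} (hδ : 0 < δ) (hLξ : 0 ≤ Lξ)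
    (hLa : ∀ s ∈ Icc 0 T, ∀ t ∈ Icc 0 T, |ξa t - ξa s| ≤ Lξ * |t - s|)
    (hLw : ∀ s ∈ Icc 0 T, ∀ t ∈ Icc 0 T, |ξw t - ξw s| ≤ Lξ * |t - s|)
    (hL₂ : ∀ (g : EuclideanSpace ℝ (Fin d) → ℝ) (ca cw : ℝ), MemLp g 2 (gauss d) →
      gaussNorm g ≤ residBound Kσ Kξ Kρ (gaussNorm fstar) T → |ca| ≤ Kξ → |cw| ≤ Kξ →
      IsC11 (vel (steklov σ δ) τ ca cw g)
        (velLip Kσ Kξ B (residBound Kσ Kξ Kρ (gaussNorm fstar) T)) L₂) :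
    IsApproxField (fun t => (ρ t : Measure (Param d))) (flowVel σ fstar ξa ξw ρ)
      (fun t => vel (steklov σ δ) τ (ξa t) (ξw t) (resid σ fstar (ρ t : Measure (Param d)))) T
      (B * (Kξ * (Kσ * δ * residBound Kσ Kξ Kρ (gaussNorm fstar) T)))
      (velBound Kσ Kξ Kρ (gaussNorm fstar) T B)
      (velLip Kσ Kξ B (residBound Kσ Kξ Kρ (gaussNorm fstar) T)) L₂
      (B * (Kσ * (Lξ * residBound Kσ Kξ Kρ (gaussNorm fstar) T
        + Kξ * (2 * B * Kσ * velBound Kσ Kξ Kρ (gaussNorm fstar) T B)))) := by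
  have hB := zero_le_one.trans hτ.one_le
  have hs := isActivation_steklov hσ hδ
  have hm : ∀ {t}, t ∈ Icc 0 T → MemLp (resid σ fstar (ρ t : Measure (Param d))) 2 (gauss d) :=
    fun ht => memLp_resid hσ hf (integrable_fst hρ ht.1)
  have hr : ∀ {t}, t ∈ Icc 0 T → gaussNorm (resid σ fstar (ρ t : Measure (Param d)))
      ≤ residBound Kσ Kξ Kρ (gaussNorm fstar) T :=
    fun ht => gaussNorm_resid_le_residBound hKσ hKξ hKρ hσ hf hfc hξa hξw hρ hρ₀ ht
  refine ⟨fun t ht => hL₂ _ _ _ (hm ht) (hr ht) (hξa.bound t ht.1) (hξw.bound t ht.1),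
    fun t ht θ => ?_, fun s hsI t ht θ => ?_,
    fun t ht => ae_norm_flowVel_le_velBound hKσ hKξ hKρ hσ hf hfc hξa hξw hρ hρ₀ hτ ht,
    fun t ht => ?_⟩
  · refine (norm_vel_le hs (hm ht) (hξa.bound t ht.1) (hξw.bound t ht.1) θ hτ.one_le
      (hτ.abs_le _)).trans ?_
    have := hr ht
    change _ ≤ Kξ * (Kσ * residBound Kσ Kξ Kρ (gaussNorm fstar) T) * B
    gcongr
  · refine (norm_vel_sub_vel_le hs hτ (hm ht) (hm hsI) (hξa.bound s hsI.1) (hξw.bound s hsI.1)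
      (hLa s hsI t ht) (hLw s hsI t ht) θ).trans ?_
    have h1 := hr ht
    have h2 : gaussNorm (fun x => resid σ fstar (ρ t : Measure (Param d)) x
        - resid σ fstar (ρ s : Measure (Param d)) x)
        ≤ 2 * B * Kσ * velBound Kσ Kξ Kρ (gaussNorm fstar) T B * |t - s| := by
      simp only [resid, sub_sub_sub_cancel_right]
      rcases le_total s t with hst | hst
      · rw [abs_of_nonneg (sub_nonneg.2 hst)]
        exact gaussNorm_fNN_sub_le hKσ hKξ hKρ hσ hf hfc hξa hξw hρ hρ₀ hτ hsI.1 hst ht.2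
      · rw [abs_sub_comm, abs_of_nonneg (sub_nonneg.2 hst), ← gaussNorm_neg]
        simp only [neg_sub]
        exact gaussNorm_fNN_sub_le hKσ hKξ hKρ hσ hf hfc hξa hξw hρ hρ₀ hτ ht.1 hst hsI.2
    calc _ ≤ B * (Kσ * (Lξ * |t - s| * residBound Kσ Kξ Kρ (gaussNorm fstar) T
          + Kξ * (2 * B * Kσ * velBound Kσ Kξ Kρ (gaussNorm fstar) T B * |t - s|))) := by gcongr
      _ = _ := by ring
  · filter_upwards [ae_flowVel_eq hKσ hKξ hKρ hσ hf hfc hξa hξw hρ hρ₀ hτ ht] with θ hθ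
    rw [hθ, ← norm_neg, neg_sub]
    refine (norm_vel_sub_vel_activation_le hs hσ hτ (hm ht) (hξa.bound t ht.1) (hξw.bound t ht.1)
      (abs_steklov_sub_le hσ hδ) (abs_deriv_steklov_sub_le hσ hδ) θ).trans ?_
    have := hr ht
    gcongr

end Flow

/-! ### Comparison of two flows and closure of the estimate. -/

section TwoFlows

variable (hKσ : 0 < Kσ) (hKξ : 0 < Kξ) (hKρ : 0 < Kρ) (hσ : IsActivation σ Kσ)
  (hf : MemLp fstar 2 (gauss d)) (hfc : Continuous fstar) (hξa : IsLearningRate ξa Kξ)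
  (hξw : IsLearningRate ξw Kξ) (hρ : IsMeanFieldFlow σ fstar ξa ξw ρ)
  (hρ₀ : IsInitialization (ρ 0) Kρ) (hρ' : IsMeanFieldFlow σ fstar ξa ξw ρ')
  (hρ₀' : IsInitialization (ρ' 0) Kρ)
  (hτ : IsTruncation τ (radius Kσ Kξ Kρ (gaussNorm fstar) T) B)
  {γ : Measure (Param d × Param d)}
  (hγ : γ ∈ couplings (ρ 0 : Measure (Param d)) (ρ' 0 : Measure (Param d)))
  (hint : Integrable (fun z : Param d × Param d => ‖z.1 - z.2‖) γ)

include hKσ hKξ hKρ hσ hf hfc hξa hξw hρ hρ₀ hρ' hρ₀' hτ hγ hint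

/-- If the outputs of two flows are at distance at most `U e^{λs}` at all times `s`, then the
duality argument improves this bound. -/
theorem gaussNorm_fNN_sub_fNN_le_of_le {lam U : ℝ} (hlam : 0 < lam) (hU : 0 ≤ U)
    (hu : ∀ s ∈ Icc 0 T, gaussNorm (fun x => fNN σ (ρ s : Measure (Param d)) x
      - fNN σ (ρ' s : Measure (Param d)) x) ≤ U * Real.exp (lam * s)) (ht : t ∈ Icc 0 T) :
    gaussNorm (fun x => fNN σ (ρ t : Measure (Param d)) x - fNN σ (ρ' t : Measure (Param d)) x)
      ≤ flowLip Kσ Kξ Kρ (gaussNorm fstar) T B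
        * ((∫ z, ‖z.1 - z.2‖ ∂γ) + B * (Kσ * (Kξ * U)) * Real.exp (lam * t) / lam) := by
  have hB := zero_le_one.trans hτ.one_le
  have hT : 0 ≤ T := ht.1.trans ht.2
  set N := residBound Kσ Kξ Kρ (gaussNorm fstar) T with hN
  have hN0 : 0 ≤ N := residBound_nonneg hKσ hKξ hKρ (gaussNorm_nonneg fstar) hT
  set L := velLip Kσ Kξ B N with hLdef
  have hL0 : 0 ≤ L := by rw [hLdef, velLip]; positivity
  set g : EuclideanSpace ℝ (Fin d) → ℝ :=
    fun x => fNN σ (ρ t : Measure (Param d)) x - fNN σ (ρ' t : Measure (Param d)) x with hgdef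
  have hg : MemLp g 2 (gauss d) :=
    (memLp_fNN hσ (integrable_fst hρ ht.1)).sub (memLp_fNN hσ (integrable_fst hρ' ht.1))
  have hsq := gaussNorm_sq_fNN_sub hσ hτ
    (ae_abs_le_radius hKσ hKξ hKρ hσ hf hfc hξa hξw hρ hρ₀ ht)
    (ae_abs_le_radius hKσ hKξ hKρ hσ hf hfc hξa hξw hρ' hρ₀' ht)
  rw [← hgdef] at hsq
  obtain ⟨B', hB', hφ⟩ := isC11_testFun hσ hτ hg
  set A := 2 * B * Kσ * gaussNorm g with hA
  set D := ∫ z, ‖z.1 - z.2‖ ∂γ with hD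
  set E := B * (Kσ * (Kξ * U)) * Real.exp (lam * t) / lam with hE
  have hE0 : 0 ≤ E := by positivity
  have hD0 : 0 ≤ D := integral_nonneg fun _ => norm_nonneg _
  obtain ⟨La, hLa⟩ := hξa.lipschitz
  obtain ⟨Lw, hLw⟩ := hξw.lipschitz
  have hlip : ∀ {ξ : ℝ → ℝ} {l : NNReal}, LipschitzOnWith l ξ (Ici 0) → l ≤ max La Lw →
      ∀ s ∈ Icc 0 T, ∀ t ∈ Icc 0 T, |ξ t - ξ s| ≤ (max La Lw : NNReal) * |t - s| :=
    fun h hl s hs t ht => by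
      simpa [Real.dist_eq] using (h.weaken hl).dist_le_mul t ht.1 s hs.1
  -- The step size of the Euler scheme is already gone here; `δ` enters only through the error of
  -- the averaged activation function.
  have hstep : ∀ δ, 0 < δ → gaussNorm g ^ 2
      ≤ 2 * (t * (A * Real.exp (L * t) * (B * (Kξ * (Kσ * δ * N)))))
        + A * (Real.exp (L * t) * (D + E)) := by
    intro δ hδ
    have hs := isActivation_steklov hσ hδ
    obtain ⟨L₂, hL₂0, hL₂⟩ := isC11_vel (d := d) (C := Kξ) (N := N) hs
      (by positivity : 0 ≤ 2 * Kσ * δ⁻¹) (lipschitz_deriv_deriv_steklov hσ hδ) hτ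
    have hw := isApproxField_flowVel hKσ hKξ hKρ hσ hf hfc hξa hξw hρ hρ₀ hτ hδ
      (max La Lw).coe_nonneg (hlip hLa (le_max_left _ _)) (hlip hLw (le_max_right _ _)) hL₂
    have hw' := isApproxField_flowVel hKσ hKξ hKρ hσ hf hfc hξa hξw hρ' hρ₀' hτ hδ
      (max La Lw).coe_nonneg (hlip hLa (le_max_left _ _)) (hlip hLw (le_max_right _ _)) hL₂
    have hvb : 0 ≤ velBound Kσ Kξ Kρ (gaussNorm fstar) T B :=
      (norm_nonneg _).trans (hw.norm_le t ht 0)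
    rw [hsq]
    refine (le_abs_self _).trans (abs_integral_sub_integral_le
      (isTransport_of_isMeanFieldFlow hσ hf hfc hξa hξw hρ)
      (isTransport_of_isMeanFieldFlow hσ hf hfc hξa hξw hρ')
      (fun ψ A C h1 h2 h3 =>
        evolves_of_bounded hKσ hKξ hKρ hσ hf hfc hξa hξw hρ hρ₀ hτ h1 h2 h3)
      (fun ψ A C h1 h2 h3 =>
        evolves_of_bounded hKσ hKξ hKρ hσ hf hfc hξa hξw hρ' hρ₀' hτ h1 h2 h3)
      hw hw' hL₂0 (by positivity) (by positivity) hlam (U := B * (Kσ * (Kξ * U))) (by positivity)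
      (fun s hsI θ => ?_) hφ hB' (abs_testFun_le hσ hτ hg) hγ.1 hγ.2 hint ht)
    have hm := memLp_resid hσ hf (integrable_fst hρ hsI.1)
    have hm' := memLp_resid hσ hf (integrable_fst hρ' hsI.1)
    -- Both flows have the same learning rates, so only the residuals differ, and `f*` cancels.
    refine (norm_vel_sub_vel_le hs hτ (δ := 0) hm hm' (hξa.bound s hsI.1) (hξw.bound s hsI.1)
      (by simp) (by simp) θ).trans ?_
    have h2 := hu s hsI
    simp only [resid, sub_sub_sub_cancel_right, zero_mul, zero_add]
    calc _ ≤ B * (Kσ * (Kξ * (U * Real.exp (lam * s)))) := by gcongr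
      _ = _ := by ring
  have hlim : gaussNorm g ^ 2 ≤ A * (Real.exp (L * t) * (D + E)) := by
    have hc : Tendsto (fun δ : ℝ => 2 * (t * (A * Real.exp (L * t) * (B * (Kξ * (Kσ * δ * N)))))
        + A * (Real.exp (L * t) * (D + E))) (𝓝[>] 0)
        (𝓝 (2 * (t * (A * Real.exp (L * t) * (B * (Kξ * (Kσ * 0 * N)))))
        + A * (Real.exp (L * t) * (D + E)))) :=
      (Continuous.tendsto (by fun_prop) 0).mono_left nhdsWithin_le_nhds
    have := ge_of_tendsto hc (eventually_nhdsWithin_of_forall hstep)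
    simpa using this
  rcases (gaussNorm_nonneg g).eq_or_lt with h0 | h0
  · rw [← h0, flowLip]
    positivity
  · refine le_of_mul_le_mul_left ?_ h0
    calc gaussNorm g * gaussNorm g = gaussNorm g ^ 2 := (sq _).symm
      _ ≤ A * (Real.exp (L * t) * (D + E)) := hlim
      _ ≤ A * (Real.exp (L * T) * (D + E)) := by
          have := ht.2
          gcongr
      _ = _ := by rw [hA, flowLip]; ring

/-- The least `U` with `u(s) ≤ U exp (λ s)` on `[0, T]` is finite by the residual bounds. The rate
`λ = flowRate` is chosen so that the previous estimate reads `U ≤ P D + U / 2`, hence `U ≤ 2 P D`.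
-/
theorem gaussNorm_fNN_sub_fNN_le (ht : t ∈ Icc 0 T) :
    gaussNorm (fun x => fNN σ (ρ t : Measure (Param d)) x - fNN σ (ρ' t : Measure (Param d)) x)
      ≤ 2 * flowLip Kσ Kξ Kρ (gaussNorm fstar) T B
        * Real.exp (flowRate Kσ Kξ Kρ (gaussNorm fstar) T B * T) * ∫ z, ‖z.1 - z.2‖ ∂γ := by
  have hB := zero_lt_one.trans_le hτ.one_le
  set u : ℝ → ℝ := fun s => gaussNorm (fun x => fNN σ (ρ s : Measure (Param d)) x
      - fNN σ (ρ' s : Measure (Param d)) x) with hu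
  have hu0 : ∀ s, 0 ≤ u s := fun s => gaussNorm_nonneg _
  set N := residBound Kσ Kξ Kρ (gaussNorm fstar) T
  set P := flowLip Kσ Kξ Kρ (gaussNorm fstar) T B with hP
  have hP0 : 0 < P := by rw [hP, flowLip]; positivity
  set lam := flowRate Kσ Kξ Kρ (gaussNorm fstar) T B with hlam
  have hlam0 : 0 < lam := by rw [hlam, flowRate]; positivity
  set D := ∫ z, ‖z.1 - z.2‖ ∂γ with hD
  have hD0 : 0 ≤ D := integral_nonneg fun _ => norm_nonneg _
  have hexp : ∀ s ∈ Icc 0 T, Real.exp (-(lam * s)) ≤ 1 := fun s hs => by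
    rw [Real.exp_le_one_iff]
    have := hs.1
    simp only [Left.neg_nonpos_iff]
    positivity
  have hub : ∀ s ∈ Icc 0 T, u s ≤ N + N := fun s hs => by
    have hm := memLp_resid hσ hf (integrable_fst hρ hs.1)
    have hm' := memLp_resid hσ hf (integrable_fst hρ' hs.1)
    have h := gaussNorm_add_le hm hm'.neg
    have e : u s = gaussNorm fun x => resid σ fstar (ρ s : Measure (Param d)) x
        + (-resid σ fstar (ρ' s : Measure (Param d))) x := by
      simp only [hu]
      congr 1
      funext x
      simp only [resid, Pi.neg_apply]
      ring
    rw [e]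
    refine h.trans (add_le_add
      (gaussNorm_resid_le_residBound hKσ hKξ hKρ hσ hf hfc hξa hξw hρ hρ₀ hs) ?_)
    exact (gaussNorm_neg _).le.trans
      (gaussNorm_resid_le_residBound hKσ hKξ hKρ hσ hf hfc hξa hξw hρ' hρ₀' hs)
  set S := (fun s => Real.exp (-(lam * s)) * u s) '' Icc 0 T with hS
  have hbdd : BddAbove S := by
    refine ⟨N + N, ?_⟩
    rintro _ ⟨s, hs, rfl⟩
    exact (mul_le_of_le_one_left (hu0 s) (hexp s hs)).trans (hub s hs)
  have hle : ∀ s ∈ Icc 0 T, u s ≤ sSup S * Real.exp (lam * s) := fun s hs => by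
    have h1 := mul_le_mul_of_nonneg_right (le_csSup hbdd (mem_image_of_mem _ hs))
      (Real.exp_pos (lam * s)).le
    have e : Real.exp (-(lam * s)) * u s * Real.exp (lam * s) = u s := by
      rw [mul_right_comm, ← Real.exp_add]; simp
    simp only [e] at h1
    exact h1
  have hS0 : 0 ≤ sSup S := Real.sSup_nonneg (by
    rintro _ ⟨s, hs, rfl⟩
    exact mul_nonneg (Real.exp_pos _).le (hu0 s))
  have hself : sSup S ≤ P * D + sSup S / 2 := by
    refine csSup_le ((nonempty_Icc.2 (ht.1.trans ht.2)).image _) ?_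
    rintro _ ⟨s, hs, rfl⟩
    have h1 := gaussNorm_fNN_sub_fNN_le_of_le hKσ hKξ hKρ hσ hf hfc hξa hξw hρ hρ₀ hρ' hρ₀' hτ hγ
      hint hlam0 hS0 hle hs
    have e : P * (D + B * (Kσ * (Kξ * sSup S)) * Real.exp (lam * s) / lam)
        = P * D + sSup S / 2 * Real.exp (lam * s) := by
      rw [hlam, flowRate, ← hP]
      field_simp
    have h2 := mul_le_mul_of_nonneg_left (h1.trans_eq e) (Real.exp_pos (-(lam * s))).le
    have e2 : Real.exp (-(lam * s)) * (P * D + sSup S / 2 * Real.exp (lam * s))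
        = Real.exp (-(lam * s)) * (P * D) + sSup S / 2 := by
      rw [mul_add, mul_left_comm _ (sSup S / 2), ← Real.exp_add]; simp
    refine (h2.trans_eq e2).trans (by
      have := mul_le_of_le_one_left (by positivity : 0 ≤ P * D) (hexp s hs)
      linarith)
  calc u t ≤ sSup S * Real.exp (lam * t) := hle t ht
    _ ≤ (2 * P * D) * Real.exp (lam * T) := by
        have := ht.2
        gcongr
        linarith
    _ = _ := by ring

end TwoFlows

/-- The first moment of a coupling is controlled by its quadratic cost. -/
theorem integrable_and_sq_integral_le_cost {γ : Measure (Param d × Param d)}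
    [IsProbabilityMeasure γ]
    (h : ∫⁻ z, ENNReal.ofReal (|z.1.1 - z.2.1| ^ 2 + ‖z.1.2 - z.2.2‖ ^ 2) ∂γ ≠ ⊤) :
    Integrable (fun z : Param d × Param d => ‖z.1 - z.2‖) γ ∧
      ENNReal.ofReal ((∫ z, ‖z.1 - z.2‖ ∂γ) ^ 2)
        ≤ ∫⁻ z, ENNReal.ofReal (|z.1.1 - z.2.1| ^ 2 + ‖z.1.2 - z.2.2‖ ^ 2) ∂γ := by
  set q : Param d × Param d → ℝ := fun z => |z.1.1 - z.2.1| ^ 2 + ‖z.1.2 - z.2.2‖ ^ 2 with hq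
  have hq0 : ∀ z, 0 ≤ q z := fun z => by positivity
  have hqi : Integrable q γ := by
    refine ⟨Continuous.aestronglyMeasurable (by fun_prop), ?_⟩
    rw [hasFiniteIntegral_iff_ofReal (ae_of_all _ hq0)]
    exact lt_top_iff_ne_top.2 h
  -- The maximum norm of the product is dominated by the Euclidean norm.
  have hle : ∀ z : Param d × Param d, ‖z.1 - z.2‖ ^ 2 ≤ q z := fun z => by
    rw [Prod.norm_def]
    rcases max_choice ‖(z.1 - z.2).1‖ ‖(z.1 - z.2).2‖ with h | h <;> rw [h] <;>
      simp only [hq, Prod.fst_sub, Prod.snd_sub, Real.norm_eq_abs] <;>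
      nlinarith [sq_nonneg ‖z.1.2 - z.2.2‖, sq_nonneg |z.1.1 - z.2.1|]
  have hm : MemLp (fun z : Param d × Param d => ‖z.1 - z.2‖) 2 γ := by
    rw [memLp_two_iff_integrable_sq (Continuous.aestronglyMeasurable (by fun_prop))]
    exact hqi.mono' (Continuous.aestronglyMeasurable (by fun_prop)) (ae_of_all _ fun z => by
      rw [Real.norm_of_nonneg (sq_nonneg _)]; exact hle z)
  refine ⟨hm.integrable (by norm_num), ?_⟩
  rw [← ofReal_integral_eq_lintegral_ofReal hqi (ae_of_all _ hq0)]
  refine ENNReal.ofReal_le_ofReal (le_trans ?_ (integral_mono hm.integrable_sq hqi hle))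
  have h1 := integral_abs_mul_le_sqrt hm (memLp_const (1 : ℝ))
  simp only [abs_norm, abs_one, mul_one, one_pow, integral_const, probReal_univ, smul_eq_mul,
    Real.sqrt_one] at h1
  calc (∫ z, ‖z.1 - z.2‖ ∂γ) ^ 2 ≤ √(∫ z, ‖z.1 - z.2‖ ^ 2 ∂γ) ^ 2 :=
        pow_le_pow_left₀ (integral_nonneg fun _ => norm_nonneg _) h1 2
    _ = _ := Real.sq_sqrt (integral_nonneg fun _ => sq_nonneg _)

theorem W2_sq (μ ν : Measure (Param d)) :
    W2 μ ν ^ 2 = ⨅ γ ∈ couplings μ ν,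
      ∫⁻ z, ENNReal.ofReal (|z.1.1 - z.2.1| ^ 2 + ‖z.1.2 - z.2.2‖ ^ 2) ∂γ := by
  rw [W2, ← ENNReal.rpow_natCast, ← ENNReal.rpow_mul]
  norm_num

theorem isProbabilityMeasure_of_mem_couplings {μ ν : Measure (Param d)} [IsProbabilityMeasure μ]
    {γ : Measure (Param d × Param d)} (hγ : γ ∈ couplings μ ν) : IsProbabilityMeasure γ := by
  refine ⟨?_⟩
  have := measure_univ (μ := μ)
  rwa [← hγ.1, Measure.map_apply measurable_fst MeasurableSet.univ, preimage_univ] at this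

end MeanFieldStability
end

theorem theorem3p5 (p : ℕ) (h : MvPolynomial (Fin p) ℝ) (Kσ Kξ Kρ T : ℝ)
    (hKσ : 0 < Kσ) (hKξ : 0 < Kξ) (hKρ : 0 < Kρ) (hT : 0 < T) :
    ∃ Cs : ℝ, 0 < Cs ∧
      ∀ (d : ℕ) (V : Submodule ℝ (EuclideanSpace ℝ (Fin d))) (b : OrthonormalBasis (Fin p) ℝ V)
        (σ ξa ξw : ℝ → ℝ) (ρ ρ' : ℝ → ProbabilityMeasure (Param d)),
        IsActivation σ Kσ → IsLearningRate ξa Kξ → IsLearningRate ξw Kξ →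
        IsInitialization (ρ 0) Kρ → IsInitialization (ρ' 0) Kρ →
        IsMeanFieldFlow σ (target h V b) ξa ξw ρ →
        IsMeanFieldFlow σ (target h V b) ξa ξw ρ' →
        (⨆ t ∈ Icc (0 : ℝ) T, ∫⁻ x, ENNReal.ofReal (|fNN σ (ρ t) x - fNN σ (ρ' t) x| ^ 2)
            ∂(stdGaussian (EuclideanSpace ℝ (Fin d))))
          ≤ ENNReal.ofReal Cs * W2 (ρ 0 : Measure (Param d)) (ρ' 0) ^ 2 := by
  set Q := MeanFieldStability.gaussNorm
    fun y : EuclideanSpace ℝ (Fin p) => MvPolynomial.eval (fun i => y i) h with hQ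
  have hR : 0 < MeanFieldStability.radius Kσ Kξ Kρ Q T := by
    have : 0 ≤ Q := MeanFieldStability.gaussNorm_nonneg _
    unfold MeanFieldStability.radius MeanFieldStability.growthBound MeanFieldStability.momentBound
    positivity
  -- The truncation is fixed before `d`, `V`, `σ` and the flows are given, so `B` depends on the
  -- admissible data only.
  obtain ⟨τ, B, hτ⟩ := MeanFieldStability.exists_isTruncation hR
  have hB := zero_lt_one.trans_le hτ.one_le
  set c := 2 * MeanFieldStability.flowLip Kσ Kξ Kρ Q T B
    * Real.exp (MeanFieldStability.flowRate Kσ Kξ Kρ Q T B * T) with hc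
  have hc0 : 0 < c := by
    rw [hc, MeanFieldStability.flowLip]
    positivity
  refine ⟨c ^ 2, by positivity, fun d V b σ ξa ξw ρ ρ' hσ hξa hξw hρ₀ hρ₀' hρ hρ' => ?_⟩
  have hf := MeanFieldStability.memLp_target h V b
  have hfc := MeanFieldStability.continuous_target h V b
  have hQf := MeanFieldStability.gaussNorm_target h V b
  rw [← hQ] at hQf
  rw [← hQf] at hτ
  have hCs : ENNReal.ofReal (c ^ 2) ≠ 0 := by simpa using hc0.ne'
  refine iSup₂_le fun t ht => ?_
  rw [MeanFieldStability.W2_sq]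
  -- Division by the nonzero finite constant reduces the bound by the infimum to one bound for each
  -- coupling, so no optimal coupling is needed.
  refine (ENNReal.div_le_iff' hCs ENNReal.ofReal_ne_top).1
    (le_iInf₂ fun γ hγ => ?_)
  refine (ENNReal.div_le_iff' hCs ENNReal.ofReal_ne_top).2 ?_
  have := MeanFieldStability.isProbabilityMeasure_of_mem_couplings hγ
  by_cases htop : ∫⁻ z, ENNReal.ofReal (|z.1.1 - z.2.1| ^ 2 + ‖z.1.2 - z.2.2‖ ^ 2) ∂γ = ⊤
  · rw [htop, ENNReal.mul_top hCs]
    exact le_top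
  obtain ⟨hint, hcost⟩ := MeanFieldStability.integrable_and_sq_integral_le_cost htop
  have hmain := MeanFieldStability.gaussNorm_fNN_sub_fNN_le hKσ hKξ hKρ hσ hf hfc hξa hξw hρ hρ₀
    hρ' hρ₀' hτ hγ hint ht
  rw [hQf, ← hc] at hmain
  have hm := (MeanFieldStability.memLp_fNN hσ (MeanFieldStability.integrable_fst hρ ht.1)).sub
    (MeanFieldStability.memLp_fNN hσ (MeanFieldStability.integrable_fst hρ' ht.1))
  have e : ∫⁻ x, ENNReal.ofReal (|fNN σ (ρ t) x - fNN σ (ρ' t) x| ^ 2)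
      ∂(stdGaussian (EuclideanSpace ℝ (Fin d)))
      = ENNReal.ofReal (MeanFieldStability.gaussNorm
        (fun x => fNN σ (ρ t : Measure (Param d)) x - fNN σ (ρ' t : Measure (Param d)) x) ^ 2) := by
    rw [MeanFieldStability.gaussNorm_sq]
    simp only [sq_abs]
    exact (ofReal_integral_eq_lintegral_ofReal hm.integrable_sq
      (ae_of_all _ fun x => sq_nonneg _)).symm
  rw [e]
  refine le_trans (ENNReal.ofReal_le_ofReal
    (pow_le_pow_left₀ (MeanFieldStability.gaussNorm_nonneg _) hmain 2)) ?_
  rw [mul_pow, ENNReal.ofReal_mul (sq_nonneg c)]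
  exact mul_le_mul_right hcost _
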